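/- All graphs are finite and simple. A connected graph $\Gamma$ with vertex set $V$ is *modular* if for all $x_1,x_2,x_3\in V$ there is $m\in V$ with $d_\Gamma(x_i,m)+d_\Gamma(m,x_j)=d_\Gamma(x_i,x_j)$ for $1\le i<j\le 3$. For an orientation $o$, write $p\swarrow q$ if $pq$ is an edge oriented from $q$ to $p$; $o$ is *admissible* if for every 4-cycle $u,v,v',u'$ (in cyclic order) $u\swarrow v\iff u'\swarrow v'$. A positive function $h$ on the edges is *orbit-invariant* if $h(e)=h(e')$ whenever $e,e'$ are joined by a sequence of edges in which consecutive ones are disjoint edges of a common 4-cycle. A *modular complex* is a triple $\mathbf\Gamma=(\Gamma,o,h)$ of a modular graph $\Gamma$, an admissible orientation $o$, and a positive orbit-invariant $h$. Let $d_{\Gamma,h}$ be the shortest path metric with edge length $h$, and $\preceq$ the reflexive transitive closure of $\swarrow$. *Boolean pairs, 2-subdivision.* A pair $(p,q)$ of vertices, written $q/p$, is *Boolean* if $p$ and $q$ are the minimum and the maximum of a cube subgraph which, oriented by $o$, is the Hasse diagram of a Boolean lattice; $(p,p)$ is Boolean. The *2-subdivision* $\mathbf\Gamma^*=(\Gamma^*,o^*,h^*)$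 has as vertices the Boolean pairs. Its edges are the pairs $\{q/p,q'/p\}$ with $qq'$ an edge of $\Gamma$, of length $h(qq')/2$, where $q/p\swarrow_{o^*}q'/p$ iff $q\swarrow q'$, and the pairs $\{q/p,q/p'\}$ with $pp'$ an edge of $\Gamma$, of length $h(pp')/2$, where $q/p\swarrow_{o^*}q/p'$ iff $p'\swarrow p$. For $p\in V$, the *neighborhood semilattice* $\mathcal L_p^*$ is the set of vertices $a$ of $\Gamma^*$ such that $(p/p,a)$ is a Boolean pair of $\mathbf\Gamma^*$, ordered by $\preceq_{o^*}$, with valuation $v_p^*(a)=d_{\Gamma^*,h^*}(a,p/p)$. It is a modular semilattice. *Submodularity.* Let $\mathcal L$ be a finite modular semilattice (a meet-semilattice in which every $[\mathbf 0,t]$ is a modular lattice and $a\vee b\vee c$ exists whenever $a\vee b,b\vee c,c\vee a$ do) with a positive valuation $v$ (strictly increasing, with $v(a)+v(b)=v(a\wedge b)+v(a\vee b)$ whenever $a\vee b$ exists). Give its covering graph the edge length $|v(a)-v(b)|$, let $d$ be the shortest path metric, and let $I(p,q)=\{u: d(p,u)+d(u,q)=d(p,q)\}$. For $u\in I(p,q)$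 put $$v(u;p,q)=\bigl(v(u\wedge p)-v(p\wedge q),\ v(u\wedge q)-v(p\wedge q)\bigr)\in\mathbb R_+^2 .$$ Let $\mathcal E(p,q)$ be the set of $u\in I(p,q)$ such that $z=v(u;p,q)$ is an extreme point of the convex hull $K$ of $\{v(u';p,q):u'\in I(p,q)\}$ with $z+\epsilon\notin K$ for every $\epsilon$ with both coordinates positive. Let $C(u;p,q)$ be the cone of all $w\in\mathbb R_+^2$ with $\langle w,v(u;p,q)\rangle=\max_{u'\in I(p,q)}\langle w,v(u';p,q)\rangle$. For a closed convex cone $C\ne\{0\}$ in $\mathbb R^2_+$ whose smallest and largest polar angles are $\beta\le\alpha$, let $[C]=\frac{\sin\alpha}{\cos\alpha+\sin\alpha}-\frac{\sin\beta}{\cos\beta+\sin\beta}$, and let $[\{0\}]=0$. A function $f:\mathcal L\to\mathbb R$ is *submodular* if $$f(p)+f(q)\ \ge\ f(p\wedge q)+\sum_{u\in\mathcal E(p,q)}[C(u;p,q)]\,f(u)\qquad(p,q\in\mathcal L).$$ *L-convexity.* A function $g:V\to\mathbb R$ is *L-convex* on $\mathbf\Gamma$ if for every $p\in V$ the function $\overline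 g(q/p')=\frac{g(p')+g(q)}2$ on the Boolean pairs, restricted to $\mathcal L_p^*$, is submodular with respect to $v_p^*$. *Product.* $\mathbf\Gamma\times\mathbf\Gamma$ is the Cartesian product graph $\Gamma\times\Gamma$, in which each edge $\{(p,r),(q,r)\}$ or $\{(r,p),(r,q)\}$ inherits the orientation and the length of the edge $pq$ of $\Gamma$; it is again a modular complex. **Theorem.** Let $\mathbf\Gamma=(\Gamma,o,h)$ be a modular complex. Then the distance function $d_{\Gamma,h}:V\times V\to\mathbb R$ is an L-convex function on the product modular complex $\mathbf\Gamma\times\mathbf\Gamma$. -/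

import Mathlib

noncomputable section

namespace LConvex

open scoped Classical

/-! ### Weighted shortest path distance -/

/-- The shortest path distance of a graph `G` with respect to an edge length `len`
(only the values of `len` on edges of `G` matter). -/
def pathDist {W : Type*} (G : SimpleGraph W) (len : Sym2 W → ℝ) (a b : W) : ℝ :=
  ⨅ w : G.Walk a b, (w.edges.map len).sum

/-! ### Modular graphs, orbits, modular complexes -/

/-- A connected graph is modular if every triple of vertices has a median. -/
structure IsModularGraph {V : Type*} (G : SimpleGraph V) : Prop where
  connected : G.Connected
  exists_median : ∀ x y z : V, ∃ m : V,
    G.dist x m + G.dist m y = G.dist x y ∧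
    G.dist y m + G.dist m z = G.dist y z ∧
    G.dist z m + G.dist m x = G.dist z x

/-- `u, v, v', u'` are, in this cyclic order, the vertices of a 4-cycle of `G`. -/
def IsFourCycle {V : Type*} (G : SimpleGraph V) (u v v' u' : V) : Prop :=
  G.Adj u v ∧ G.Adj v v' ∧ G.Adj v' u' ∧ G.Adj u' u ∧ u ≠ v' ∧ v ≠ u'

/-- Two edges that belong to a common 4-cycle and share no vertex. -/
def IsOpposite {V : Type*} (G : SimpleGraph V) (e e' : Sym2 V) : Prop :=
  ∃ u v v' u' : V, IsFourCycle G u v v' u' ∧ e = s(u, v) ∧ e' = s(v', u')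

/-- Projectivity of edges; its classes are the orbits. -/
def IsProjective {V : Type*} (G : SimpleGraph V) : Sym2 V → Sym2 V → Prop :=
  Relation.ReflTransGen (IsOpposite G)

/-- The data `(Γ, o, h)`: a graph, an orientation and an edge length.
`low p q` means `p ↙ q`: there is an edge `pq`, oriented from `q` to `p`.
Only the values of `len` on edges matter. -/
structure Complex (V : Type*) where
  graph : SimpleGraph V
  low : V → V → Prop
  len : Sym2 V → ℝ

namespace Complex

variable {V V' : Type*}

/-- `(Γ, o, h)` is a modular complex: `Γ` is a modular graph, `o` is an admissible orientation
of `Γ`, and `h` is a positive orbit-invariant function on the edges of `Γ`. -/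
structure IsModularComplex (X : Complex V) : Prop where
  modular : IsModularGraph X.graph
  adj_iff : ∀ p q : V, X.graph.Adj p q ↔ (X.low p q ∨ X.low q p)
  not_both : ∀ p q : V, X.low p q → ¬ X.low q p
  admissible : ∀ u v v' u' : V, IsFourCycle X.graph u v v' u' → (X.low u v ↔ X.low u' v')
  len_pos : ∀ e ∈ X.graph.edgeSet, 0 < X.len e
  len_orbit : ∀ e ∈ X.graph.edgeSet, ∀ e' ∈ X.graph.edgeSet,
    IsProjective X.graph e e' → X.len e = X.len e'

/-- The distance `d_{Γ,h}`. -/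
def dist (X : Complex V) (p q : V) : ℝ := pathDist X.graph X.len p q

/-- The relation `≼`: the reflexive transitive closure of `↙`. -/
def le (X : Complex V) : V → V → Prop := Relation.ReflTransGen X.low

/-- `(p, q)` is a Boolean pair: `p` and `q` are the minimum and the maximum of some cube subgraph
which, oriented by `o`, is the Hasse diagram of a Boolean lattice (here the lattice of subsets of
`Fin k`). The case `k = 0` gives the pairs `(p, p)`. -/
def IsBoolean (X : Complex V) (p q : V) : Prop :=
  ∃ (k : ℕ) (φ : Finset (Fin k) → V), Function.Injective φ ∧
    (∀ s : Finset (Fin k), ∀ i ∉ s,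
      X.graph.Adj (φ s) (φ (insert i s)) ∧ X.low (φ s) (φ (insert i s))) ∧
    φ ∅ = p ∧ φ Finset.univ = q

theorem isBoolean_refl (X : Complex V) (p : V) : X.IsBoolean p p :=
  ⟨0, fun _ => p, fun _ _ _ => Subsingleton.elim _ _, fun _ i => i.elim0, rfl, rfl⟩

/-! ### Products -/

/-- The product `(Γ × Γ', o × o', h × h')`. -/
def prod (X : Complex V) (X' : Complex V') : Complex (V × V') where
  graph := X.graph □ X'.graph
  low a b := (X.low a.1 b.1 ∧ a.2 = b.2) ∨ (a.1 = b.1 ∧ X'.low a.2 b.2)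
  len := Sym2.lift ⟨fun a b => if a.2 = b.2 then X.len s(a.1, b.1) else X'.len s(a.2, b.2), by
    intro a b
    dsimp only
    rw [Sym2.eq_swap (a := a.1), Sym2.eq_swap (a := a.2)]
    simp only [eq_comm]⟩

/-! ### The 2-subdivision -/

/-- The set of Boolean pairs; the pair `a`, written `q / p`, has `a.lo = p` and `a.hi = q`. -/
def BoolPair (X : Complex V) : Type _ := {a : V × V // X.IsBoolean a.1 a.2}

namespace BoolPair

variable {X : Complex V}

def lo (a : X.BoolPair) : V := a.1.1

def hi (a : X.BoolPair) : V := a.1.2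

end BoolPair

/-- The vertex `p / p`. -/
def diag (X : Complex V) (p : V) : X.BoolPair := ⟨(p, p), X.isBoolean_refl p⟩

/-- The 2-subdivision `(Γ*, o*, h*)`. -/
def subdivision (X : Complex V) : Complex X.BoolPair where
  graph :=
    { Adj := fun a b => (a.lo = b.lo ∧ X.graph.Adj a.hi b.hi) ∨
        (a.hi = b.hi ∧ X.graph.Adj a.lo b.lo)
      symm := ⟨fun _ _ h => h.imp (fun h => ⟨h.1.symm, h.2.symm⟩) (fun h => ⟨h.1.symm, h.2.symm⟩)⟩
      loopless := ⟨fun _ h => h.elim (fun h => h.2.ne rfl) (fun h => h.2.ne rfl)⟩ }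
  low a b := (a.lo = b.lo ∧ X.low a.hi b.hi) ∨ (a.hi = b.hi ∧ X.low b.lo a.lo)
  len := Sym2.lift ⟨fun a b =>
      if a.lo = b.lo then X.len s(a.hi, b.hi) / 2 else X.len s(a.lo, b.lo) / 2, by
    intro a b
    dsimp only
    rw [Sym2.eq_swap (a := a.lo), Sym2.eq_swap (a := a.hi)]
    simp only [eq_comm]⟩

/-! ### Neighborhood semilattices -/

/-- `L⁺_p`: the set of `q` such that `(p, q)` is Boolean. -/
def Upper (X : Complex V) (p : V) : Type _ := {q : V // X.IsBoolean p q}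

/-- `L⁺_p` is ordered by `≼`. -/
instance (X : Complex V) (p : V) : Preorder (X.Upper p) where
  le a b := X.le a.1 b.1
  le_refl _ := Relation.ReflTransGen.refl
  le_trans _ _ _ := Relation.ReflTransGen.trans

/-- The neighborhood semilattice `L*_p = L⁺_{p/p}(Γ*)`. -/
abbrev Nbhd (X : Complex V) (p : V) : Type _ := X.subdivision.Upper (X.diag p)

/-- The valuation `v*_p` of `L*_p`: the distance to `p / p` in `Γ*`. -/
def nbhdVal (X : Complex V) (p : V) (a : X.Nbhd p) : ℝ := X.subdivision.dist a.1 (X.diag p)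

/-- The restriction of the Lovász extension of `g` to the vertices of the 2-subdivision. -/
def lovasz (X : Complex V) (g : V → ℝ) (a : X.BoolPair) : ℝ := (g a.lo + g a.hi) / 2

end Complex

/-! ### Modular semilattices and their valuations -/

section Semilattice

variable {L : Type*} [Preorder L]

/-- `L` is a modular semilattice: a meet-semilattice with minimum `0` such that every interval
`[0, t]` is a modular lattice and such that `a ∨ b ∨ c` exists as soon as
`a ∨ b`, `b ∨ c`, `c ∨ a` exist. -/
structure IsModularSemilattice (L : Type*) [Preorder L] : Prop where
  antisymm : ∀ a b : L, a ≤ b → b ≤ a → a = b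
  exists_zero : ∃ z : L, ∀ a, z ≤ a
  exists_meet : ∀ a b : L, ∃ m, IsGLB {a, b} m
  exists_join : ∀ a b t : L, a ≤ t → b ≤ t → ∃ j, IsLUB {a, b} j
  modular_law : ∀ a b c t : L, a ≤ c → c ≤ t → b ≤ t → ∀ m j x y : L,
    IsGLB {b, c} m → IsLUB {a, m} x → IsLUB {a, b} j → IsGLB {j, c} y → x = y
  exists_join₃ : ∀ a b c : L, (∃ j, IsLUB {a, b} j) → (∃ j, IsLUB {b, c} j) →
    (∃ j, IsLUB {c, a} j) → ∃ j, IsLUB {a, b, c} j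

/-- Positive valuations. -/
structure IsValuation (v : L → ℝ) : Prop where
  strictMono : StrictMono v
  modular : ∀ a b m j : L, IsGLB {a, b} m → IsLUB {a, b} j → v a + v b = v m + v j

/-- The meet `a ∧ b` (with an arbitrary value if the meet does not exist). -/
def meet (a b : L) : L := if h : ∃ m, IsGLB {a, b} m then h.choose else a

/-- The length of edges of the covering graph given by a valuation. -/
def valLen (v : L → ℝ) : Sym2 L → ℝ :=
  Sym2.lift ⟨fun a b => |v a - v b|, fun a b => abs_sub_comm (v a) (v b)⟩

/-- The metric of `L`: the shortest path metric of the covering graph. -/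
def valDist (v : L → ℝ) (a b : L) : ℝ := pathDist (SimpleGraph.hasse L) (valLen v) a b

/-- The metric interval `I(p, q)`. -/
def interval (v : L → ℝ) (p q : L) : Set L :=
  {u | valDist v p u + valDist v u q = valDist v p q}

/-! ### The fractional join -/

/-- The vector `v(u; p, q) = (v[p ∧ q, u ∧ p], v[p ∧ q, u ∧ q])`. -/
def vec (v : L → ℝ) (p q u : L) : ℝ × ℝ :=
  (v (meet u p) - v (meet p q), v (meet u q) - v (meet p q))

/-- `Conv I(p, q)`. -/
def convI (v : L → ℝ) (p q : L) : Set (ℝ × ℝ) := convexHull ℝ (vec v p q '' interval v p q)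

/-- The `(p, q)`-envelope: the elements of `I(p, q)` that are mapped to maximal extreme points
of `Conv I(p, q)`. -/
def envelope (v : L → ℝ) (p q : L) : Set L :=
  {u ∈ interval v p q | vec v p q u ∈ (convI v p q).extremePoints ℝ ∧
    ∀ ε : ℝ × ℝ, 0 < ε.1 → 0 < ε.2 → vec v p q u + ε ∉ convI v p q}

/-- The cone `C(u; p, q)` of nonnegative vectors `w` whose inner product with `v(·; p, q)` is
maximized over `I(p, q)` at `u`. -/
def normalCone (v : L → ℝ) (p q u : L) : Set (ℝ × ℝ) :=
  {w | 0 ≤ w.1 ∧ 0 ≤ w.2 ∧ ∀ u' ∈ interval v p q,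
    w.1 * (vec v p q u').1 + w.2 * (vec v p q u').2 ≤
      w.1 * (vec v p q u).1 + w.2 * (vec v p q u).2}

/-- The polar angles in `[0, π/2]` of the rays of a cone in the nonnegative quadrant. -/
def angles (C : Set (ℝ × ℝ)) : Set ℝ :=
  {θ ∈ Set.Icc 0 (Real.pi / 2) | (Real.cos θ, Real.sin θ) ∈ C}

/-- The number `[C] = sin α / (cos α + sin α) - sin β / (cos β + sin β)` of a closed convex cone
`C` in the nonnegative quadrant, where `α` and `β` are the largest and the smallest polar angle
of its nonzero elements. The value is `0` for `C = {0}`, as `sSup ∅ = sInf ∅ = 0`. -/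
def coneVal (C : Set (ℝ × ℝ)) : ℝ :=
  let α := sSup (angles C)
  let β := sInf (angles C)
  Real.sin α / (Real.cos α + Real.sin α) - Real.sin β / (Real.cos β + Real.sin β)

/-- `f` is a submodular function on the modular semilattice `L` with valuation `v`. -/
structure IsSubmodular (v : L → ℝ) (f : L → ℝ) : Prop where
  semilattice : IsModularSemilattice L
  valuation : IsValuation v
  ineq : ∀ p q : L,
    f (meet p q) + ∑ᶠ u ∈ envelope v p q, coneVal (normalCone v p q u) * f u ≤ f p + f q

end Semilattice

/-- `g` is an L-convex function on the modular complex `X`: for every vertex `p` the restriction of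
its Lovász extension to the neighborhood semilattice `L*_p` is submodular with respect to the
valuation `v*_p`. -/
structure Complex.IsLConvex {V : Type*} (X : Complex V) (g : V → ℝ) : Prop where
  modularComplex : X.IsModularComplex
  submodular : ∀ p : V, IsSubmodular (X.nbhdVal p) fun a : X.Nbhd p => X.lovasz g a.1

end LConvex

end

/-! The proof combines a local criterion for submodularity with the gate structure of modular
graphs.

Criterion (`submodular_of_local`). Record a ray of the quadrant by the weight l of its normalised
vector (1 - l, l). Then [C] is the length of the interval of weights in C, and the sum over the
envelope is the integral over l in [0, 1] of f at the maximizer of (1 - l) v(u ∧ p) + l v(u ∧ q).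
This maximizer is piecewise constant and moves from the p side to the q side. Two inequalities
suffice: submodularity for pairs having a join, and (w₁ + w₂) f(m) ≤ w₁ f(p) + w₂ f(q) for antipodal
pairs with meet m, meaning w₁ v[m,p] = w₂ v[m,q] and w₁ v[m,a] + w₂ v[m,b] ≤ w₁ v[m,p] whenever a in
[m,p] and b in [m,q] have an upper bound. Consecutive maximizers u, u' are antipodal over u ∧ u',
and the inequalities telescope.

Distance. The vertices above (or below) a given vertex form a convex, hence gated, set. If g is the
gate of z above p, then d(z,x) = d(z,p) + d(p,x) - 2 d(p, x ∧ g) for x above p. This gives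
submodularity on pairs with joins. For an antipodal pair, applying it in both coordinates and both
orientations gives f(p) = f(m) + v[m,p] - 2 v[m,A] and f(q) = f(m) + v[m,q] - 2 v[m,B], where A ≤ p
and B ≤ q are truncations at common gates. If A and B have an upper bound, antipodality yields
exactly the required inequality.

The bound for A and B is the crux. Boolean pairs are the complemented intervals (`isBoolean_iff`),
and `complemented_extend` glues two such intervals when the ends being added point towards the ends
of a Boolean pair. -/

noncomputable section

namespace LConvex

open scoped Classical

/-! ### Modular graphs: parallel edges and weighted geodesics. -/

namespace Complex

variable {V : Type*} {X : Complex V}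

/-- The number of edges of a shortest path. -/
abbrev gdist (X : Complex V) (a b : V) : ℕ := X.graph.dist a b

/-- `b` lies on a shortest path from `a` to `c`. -/
def Btw (X : Complex V) (a b c : V) : Prop := X.gdist a b + X.gdist b c = X.gdist a c

theorem gdist_comm (a b : V) : X.gdist a b = X.gdist b a := SimpleGraph.dist_comm

theorem gdist_self (a : V) : X.gdist a a = 0 := SimpleGraph.dist_self

theorem Btw.symm {a b c : V} (h : X.Btw a b c) : X.Btw c b a := by
  unfold Btw at *
  rw [gdist_comm c b, gdist_comm b a, gdist_comm c a]; omega

theorem btw_left (a c : V) : X.Btw a a c := by simp [Btw]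

namespace IsModularComplex

variable (hX : X.IsModularComplex)
include hX

theorem gdist_triangle (a b c : V) : X.gdist a c ≤ X.gdist a b + X.gdist b c :=
  hX.modular.connected.dist_triangle

theorem eq_of_gdist_eq_zero {a b : V} (h : X.gdist a b = 0) : a = b :=
  hX.modular.connected.dist_eq_zero_iff.1 h

omit hX in
theorem adj_of_gdist_eq_one {a b : V} (h : X.gdist a b = 1) : X.graph.Adj a b :=
  SimpleGraph.dist_eq_one_iff_adj.1 h

omit hX in
theorem gdist_eq_one {a b : V} (h : X.graph.Adj a b) : X.gdist a b = 1 :=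
  SimpleGraph.dist_eq_one_iff_adj.2 h

theorem low_adj {a b : V} (h : X.low a b) : X.graph.Adj a b := (hX.adj_iff a b).2 (Or.inl h)

theorem gdist_low {a b : V} (h : X.low a b) : X.gdist a b = 1 := gdist_eq_one (hX.low_adj h)

theorem exists_median (x y z : V) : ∃ m, X.Btw x m y ∧ X.Btw y m z ∧ X.Btw z m x :=
  hX.modular.exists_median x y z

/-- Transitivity of betweenness. -/
theorem btw_trans {a b c d : V} (h₁ : X.Btw a b d) (h₂ : X.Btw b c d) :
    X.Btw a c d ∧ X.Btw a b c := by
  unfold Btw at *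
  have := hX.gdist_triangle a b c
  have := hX.gdist_triangle a c d
  omega

theorem btw_trans' {a b c d : V} (h₁ : X.Btw a c d) (h₂ : X.Btw a b c) :
    X.Btw a b d ∧ X.Btw b c d := by
  have := hX.btw_trans h₁.symm h₂.symm
  exact ⟨this.1.symm, this.2.symm⟩

/-- Modular graphs are bipartite. -/
theorem gdist_adj {x y : V} (h : X.graph.Adj x y) (z : V) :
    X.gdist z y = X.gdist z x + 1 ∨ X.gdist z x = X.gdist z y + 1 := by
  obtain ⟨m, h1, h2, h3⟩ := hX.exists_median x y z
  unfold Btw at *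
  have hxy := gdist_eq_one h
  rw [gdist_comm y m] at h2
  rw [gdist_comm m x] at h3
  rw [gdist_comm y z, gdist_comm m z] at h2
  rcases Nat.eq_zero_or_pos (X.gdist x m) with h0 | h0
  · omega
  · omega

/-- The quadrangle condition. -/
theorem quadrangle {z w x y : V} (hwx : X.graph.Adj w x) (hwy : X.graph.Adj w y) (hne : x ≠ y)
    (hx : X.gdist z x + 1 = X.gdist z w) (hy : X.gdist z y + 1 = X.gdist z w) :
    ∃ t, X.graph.Adj t x ∧ X.graph.Adj t y ∧ X.gdist z t + 1 = X.gdist z x := by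
  obtain ⟨t, h1, h2, h3⟩ := hX.exists_median x y z
  have h2' : X.gdist x y = 2 := by
    have h4 := hX.gdist_triangle x w y
    rw [gdist_comm x w, gdist_eq_one hwx, gdist_eq_one hwy] at h4
    have h5 : X.gdist x y ≠ 0 := fun h => hne (hX.eq_of_gdist_eq_zero h)
    have h6 : X.gdist x y ≠ 1 := fun h => by
      have := hX.gdist_adj (adj_of_gdist_eq_one h) z
      omega
    omega
  unfold Btw at *
  rw [gdist_comm y t, gdist_comm t z, gdist_comm y z] at h2
  have h7 := gdist_comm (X := X) t x
  have h8 : X.gdist t x = 1 := by omega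
  exact ⟨t, adj_of_gdist_eq_one h8, adj_of_gdist_eq_one (by omega), by omega⟩

theorem exists_next {a b : V} (h : a ≠ b) : ∃ c, X.graph.Adj a c ∧ X.Btw a c b := by
  obtain ⟨p, hp⟩ := hX.modular.connected.exists_walk_length_eq_dist a b
  cases p with
  | nil => exact absurd rfl h
  | @cons _ c _ hadj q =>
    refine ⟨c, hadj, ?_⟩
    unfold Btw
    have h1 : X.gdist c b ≤ q.length := SimpleGraph.dist_le q
    have h2 := hX.gdist_triangle a c b
    have h3 := gdist_eq_one hadj
    simp only [SimpleGraph.Walk.length_cons] at hp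
    change q.length + 1 = X.gdist a b at hp
    omega

/-- Edges `xy` and `zw` that are parallel, with `x` on the side of `z` and `y` on the side
of `w`, have the same orientation and the same length. -/
theorem parallel {x y z w : V} (hxy : X.graph.Adj x y) (hzw : X.graph.Adj z w)
    (h1 : X.gdist x z = X.gdist y w) (h2 : X.gdist x w = X.gdist x z + 1)
    (h3 : X.gdist y z = X.gdist x z + 1) :
    (X.low x y ↔ X.low z w) ∧ X.len s(x, y) = X.len s(z, w) := by
  obtain ⟨k, hk⟩ : ∃ k, X.gdist x z = k := ⟨_, rfl⟩
  induction k generalizing x y with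
  | zero =>
    obtain rfl := hX.eq_of_gdist_eq_zero hk
    obtain rfl := hX.eq_of_gdist_eq_zero (h1.symm.trans hk)
    exact ⟨Iff.rfl, rfl⟩
  | succ k ih =>
    have hxz : x ≠ z := by
      rintro rfl
      simp at hk
    obtain ⟨x₁, hx₁, hb⟩ := hX.exists_next hxz
    unfold Btw at hb
    have e1 := gdist_eq_one hx₁
    have e2 := hX.gdist_adj hzw x₁
    have e3 := hX.gdist_triangle x x₁ w
    have hne : x₁ ≠ y := by
      rintro rfl
      omega
    -- The quadrangle condition seen from `w` moves the edge across one square towards `zw`; the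
    -- square transports orientation and length.
    obtain ⟨y₁, hy₁, hy₁', hd⟩ := hX.quadrangle (z := w) hx₁ hxy hne
      (by rw [gdist_comm w, gdist_comm w]; omega) (by rw [gdist_comm w, gdist_comm w]; omega)
    rw [gdist_comm w, gdist_comm w] at hd
    have e4 := hX.gdist_triangle y y₁ z
    have e5 := hX.gdist_triangle y₁ x₁ z
    have e6 := gdist_eq_one hy₁
    have e7 := gdist_eq_one hy₁'.symm
    obtain ⟨i1, i2⟩ := ih hy₁.symm (by omega) (by omega) (by omega) (by omega)
    have hne' : x ≠ y₁ := by
      rintro rfl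
      omega
    have hc : IsFourCycle X.graph x y y₁ x₁ :=
      ⟨hxy, hy₁'.symm, hy₁, hx₁.symm, hne', hne.symm⟩
    refine ⟨(hX.admissible _ _ _ _ hc).trans i1, ?_⟩
    rw [← i2, Sym2.eq_swap (a := x₁)]
    exact hX.len_orbit _ hxy _ hy₁ (Relation.ReflTransGen.single ⟨x, y, y₁, x₁, hc, rfl, rfl⟩)

theorem len_pos' {x y : V} (h : X.graph.Adj x y) : 0 < X.len s(x, y) := hX.len_pos _ h

/-- Geodesics with different first steps are each compared with one through the fourth vertex of a
square, whose opposite sides have equal length. -/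
theorem geodesic_sum_eq {a b : V} (p q : X.graph.Walk a b) (hp : p.length = X.gdist a b)
    (hq : q.length = X.gdist a b) : (p.edges.map X.len).sum = (q.edges.map X.len).sum := by
  obtain ⟨k, hk⟩ : ∃ k, X.gdist a b = k := ⟨_, rfl⟩
  induction k using Nat.strong_induction_on generalizing a with
  | _ k ih =>
    cases p with
    | nil =>
      cases q with
      | nil => rfl
      | cons h q' => simp at hq
    | @cons _ x _ hx p' =>
      cases q with
      | nil => simp at hp
      | @cons _ y _ hy q' =>
        simp only [SimpleGraph.Walk.length_cons] at hp hq
        simp only [SimpleGraph.Walk.edges_cons, List.map_cons, List.sum_cons]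
        have e1 : X.gdist x b ≤ p'.length := SimpleGraph.dist_le p'
        have e2 : X.gdist y b ≤ q'.length := SimpleGraph.dist_le q'
        have e3 := hX.gdist_triangle a x b
        have e4 := hX.gdist_triangle a y b
        have e5 := gdist_eq_one hx
        have e6 := gdist_eq_one hy
        by_cases hxy : x = y
        · subst hxy
          rw [ih (X.gdist x b) (by omega) p' q' (by omega) (by omega) rfl]
        · obtain ⟨t, ht, ht', hd⟩ := hX.quadrangle (z := b) hx hy hxy
            (by rw [gdist_comm b, gdist_comm b]; omega) (by rw [gdist_comm b, gdist_comm b]; omega)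
          rw [gdist_comm b, gdist_comm b] at hd
          obtain ⟨r, hr⟩ := hX.modular.connected.exists_walk_length_eq_dist t b
          change r.length = X.gdist t b at hr
          rw [ih (X.gdist x b) (by omega) p' (.cons ht.symm r) (by omega)
              (by rw [SimpleGraph.Walk.length_cons]; omega) rfl,
            ih (X.gdist y b) (by omega) q' (.cons ht'.symm r) (by omega)
              (by rw [SimpleGraph.Walk.length_cons]; omega) rfl]
          simp only [SimpleGraph.Walk.edges_cons, List.map_cons, List.sum_cons]
          have hat : a ≠ t := by
            rintro rfl
            omega
          have c1 : X.len s(a, x) = X.len s(t, y) :=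
            hX.len_orbit _ hx _ ht' (Relation.ReflTransGen.single
              ⟨a, x, t, y, ⟨hx, ht.symm, ht', hy.symm, hat, hxy⟩, rfl, rfl⟩)
          have c2 : X.len s(a, y) = X.len s(t, x) :=
            hX.len_orbit _ hy _ ht (Relation.ReflTransGen.single
              ⟨a, y, t, x, ⟨hy, ht'.symm, ht, hx.symm, hat, fun h => hxy h.symm⟩, rfl, rfl⟩)
          rw [c1, c2, Sym2.eq_swap (a := x), Sym2.eq_swap (a := y)]
          ring

/-- By bipartiteness the first step goes towards the target or away from it. In the second case the
step back followed by the old geodesic is a geodesic from the new vertex. -/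
theorem geodesic_le {a b : V} (p q : X.graph.Walk a b) (hp : p.length = X.gdist a b) :
    (p.edges.map X.len).sum ≤ (q.edges.map X.len).sum := by
  induction q with
  | nil => simp [hX.geodesic_sum_eq p .nil hp (by simp)]
  | @cons a c b h q ih =>
    obtain ⟨r, hr⟩ := hX.modular.connected.exists_walk_length_eq_dist c b
    have i := ih r hr
    change r.length = X.gdist c b at hr
    have hl := hX.len_pos' h
    have e := hX.gdist_adj h b
    rw [gdist_comm b, gdist_comm b] at e
    simp only [SimpleGraph.Walk.edges_cons, List.map_cons, List.sum_cons]
    rcases e with e | e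
    · have := hX.geodesic_sum_eq r (.cons h.symm p) hr
        (by rw [SimpleGraph.Walk.length_cons]; omega)
      simp only [SimpleGraph.Walk.edges_cons, List.map_cons, List.sum_cons] at this
      rw [Sym2.eq_swap (a := c)] at this
      linarith
    · have := hX.geodesic_sum_eq p (.cons h r) hp
        (by rw [SimpleGraph.Walk.length_cons]; omega)
      simp only [SimpleGraph.Walk.edges_cons, List.map_cons, List.sum_cons] at this
      linarith

/-- The weighted distance is the length of any shortest path. -/
theorem dist_eq_sum {a b : V} (p : X.graph.Walk a b) (hp : p.length = X.gdist a b) :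
    X.dist a b = (p.edges.map X.len).sum := by
  unfold dist pathDist
  have : Nonempty (X.graph.Walk a b) := ⟨p⟩
  exact le_antisymm (ciInf_le ⟨_, by rintro _ ⟨q, rfl⟩; exact hX.geodesic_le p q hp⟩ p)
    (le_ciInf fun q => hX.geodesic_le p q hp)

theorem dist_self (a : V) : X.dist a a = 0 := by
  rw [hX.dist_eq_sum (.nil : X.graph.Walk a a) (by simp)]
  simp

theorem dist_comm (a b : V) : X.dist a b = X.dist b a := by
  obtain ⟨p, hp⟩ := hX.modular.connected.exists_walk_length_eq_dist a b
  rw [hX.dist_eq_sum p hp, hX.dist_eq_sum p.reverse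
    (by rw [SimpleGraph.Walk.length_reverse, gdist_comm]; exact hp)]
  simp

theorem dist_btw {a b c : V} (h : X.Btw a b c) : X.dist a b + X.dist b c = X.dist a c := by
  obtain ⟨p, hp⟩ := hX.modular.connected.exists_walk_length_eq_dist a b
  obtain ⟨q, hq⟩ := hX.modular.connected.exists_walk_length_eq_dist b c
  rw [hX.dist_eq_sum p hp, hX.dist_eq_sum q hq, hX.dist_eq_sum (p.append q)
    (by rw [SimpleGraph.Walk.length_append, hp, hq]; exact h)]
  simp

theorem dist_adj {a b : V} (h : X.graph.Adj a b) : X.dist a b = X.len s(a, b) := by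
  rw [hX.dist_eq_sum (.cons h .nil) (by rw [gdist_eq_one h]; rfl)]
  simp

theorem dist_nonneg (a b : V) : 0 ≤ X.dist a b := by
  obtain ⟨p, hp⟩ := hX.modular.connected.exists_walk_length_eq_dist a b
  rw [hX.dist_eq_sum p hp]
  refine List.sum_nonneg fun x hx => ?_
  obtain ⟨e, he, rfl⟩ := List.mem_map.1 hx
  exact (hX.len_pos e (p.edges_subset_edgeSet he)).le

theorem dist_pos {a b : V} (h : a ≠ b) : 0 < X.dist a b := by
  obtain ⟨c, hc, hb⟩ := hX.exists_next h
  rw [← hX.dist_btw hb, hX.dist_adj hc]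
  have := hX.len_pos' hc
  have := hX.dist_nonneg c b
  linarith

theorem dist_le_len_add {a b : V} (h : X.graph.Adj a b) (c : V) :
    X.dist a c ≤ X.len s(a, b) + X.dist b c := by
  have hl := hX.len_pos' h
  rcases hX.gdist_adj h c with e | e
  · have : X.Btw b a c := by
      unfold Btw
      rw [gdist_comm b a, gdist_eq_one h, gdist_comm a, gdist_comm b]; omega
    have := hX.dist_btw this
    have := hX.dist_nonneg b a
    linarith
  · have : X.Btw a b c := by
      unfold Btw
      rw [gdist_eq_one h, gdist_comm a, gdist_comm b]; omega
    have := hX.dist_btw this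
    rw [hX.dist_adj h] at this
    linarith

end IsModularComplex

/-! ### The order: convexity, gates, meets and joins, submodularity of the distance. -/

/-- The complex with the reversed orientation. -/
def op (X : Complex V) : Complex V where
  graph := X.graph
  low a b := X.low b a
  len := X.len

theorem op_le {a b : V} : X.op.le a b ↔ X.le b a := Relation.reflTransGen_swap

theorem le_refl (a : V) : X.le a a := Relation.ReflTransGen.refl

theorem le_trans {a b c : V} (h₁ : X.le a b) (h₂ : X.le b c) : X.le a c :=
  Relation.ReflTransGen.trans h₁ h₂

theorem le_of_low {a b : V} (h : X.low a b) : X.le a b := Relation.ReflTransGen.single h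

/-- `m` is the meet of `x` and `y`. -/
def IsMeet (X : Complex V) (x y m : V) : Prop :=
  X.le m x ∧ X.le m y ∧ ∀ c, X.le c x → X.le c y → X.le c m

/-- `j` is the join of `x` and `y`. -/
def IsJoin (X : Complex V) (x y j : V) : Prop :=
  X.le x j ∧ X.le y j ∧ ∀ c, X.le x c → X.le y c → X.le j c

theorem op_isMeet {x y m : V} : X.op.IsMeet x y m ↔ X.IsJoin x y m := by
  simp [IsMeet, IsJoin, op_le]

theorem op_isJoin {x y m : V} : X.op.IsJoin x y m ↔ X.IsMeet x y m := by
  simp [IsMeet, IsJoin, op_le]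

theorem IsMeet.symm {x y m : V} (h : X.IsMeet x y m) : X.IsMeet y x m :=
  ⟨h.2.1, h.1, fun c h1 h2 => h.2.2 c h2 h1⟩

theorem IsJoin.symm {x y m : V} (h : X.IsJoin x y m) : X.IsJoin y x m :=
  ⟨h.2.1, h.1, fun c h1 h2 => h.2.2 c h2 h1⟩

/-- `g` is the gate of `z` in the set of vertices above `p`. -/
def IsGate (X : Complex V) (p z g : V) : Prop :=
  X.le p g ∧ ∀ y, X.le p y → X.Btw z g y

namespace IsModularComplex

variable (hX : X.IsModularComplex)
include hX

theorem op : X.op.IsModularComplex where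
  modular := hX.modular
  adj_iff p q := (hX.adj_iff p q).trans Or.comm
  not_both p q h h' := hX.not_both p q h' h
  admissible u v v' u' h :=
    hX.admissible v u u' v' ⟨h.1.symm, h.2.2.2.1.symm, h.2.2.1.symm, h.2.1.symm, h.2.2.2.2.2,
      h.2.2.2.2.1⟩
  len_pos := hX.len_pos
  len_orbit := hX.len_orbit

/-- The side of the upper end of an edge is an up-set: an upward edge leaving it would be parallel
to `xy` with the wrong orientation. -/
theorem low_sign {x y z w : V} (h : X.low x y) (hzw : X.le z w)
    (hz : X.gdist z y + 1 = X.gdist z x) : X.gdist w y + 1 = X.gdist w x := by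
  induction hzw with
  | refl => exact hz
  | @tail z w _ hl ih =>
    by_contra hcon
    have e1 := hX.gdist_adj (hX.low_adj h) w
    have e2 := hX.gdist_low hl
    have e3 := hX.gdist_triangle z w x
    have e4 := hX.gdist_triangle w z y
    rw [gdist_comm w z] at e4
    have := (hX.parallel (hX.low_adj h) (hX.low_adj hl).symm
      (by rw [gdist_comm x, gdist_comm y]; omega) (by rw [gdist_comm x, gdist_comm x]; omega)
      (by rw [gdist_comm x, gdist_comm y]; omega)).1.1 h
    exact hX.not_both _ _ hl this

theorem low_sign' {x y z w : V} (h : X.low x y) (hzw : X.le z w)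
    (hw : X.gdist w x + 1 = X.gdist w y) : X.gdist z x + 1 = X.gdist z y := by
  by_contra hcon
  have e1 := hX.gdist_adj (hX.low_adj h) z
  have := hX.low_sign h hzw (by omega)
  omega

theorem gdist_low_le {x y z : V} (h : X.low x y) (hyz : X.le y z) :
    X.gdist x z = X.gdist y z + 1 := by
  have := hX.low_sign h hyz (by rw [gdist_self, gdist_comm, hX.gdist_low h])
  rw [gdist_comm x, gdist_comm y]; omega

/-- Ascending paths are geodesics, since everything above the top of an edge lies on the side of the
top. -/
theorem btw_of_le {p q r : V} (h₁ : X.le p q) (h₂ : X.le q r) : X.Btw p q r := by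
  induction h₁ using Relation.ReflTransGen.head_induction_on with
  | refl => exact btw_left _ _
  | head hl hle ih =>
    unfold Btw at *
    have := hX.gdist_low_le hl hle
    have := hX.gdist_low_le hl (le_trans hle h₂)
    omega

theorem le_antisymm {p q : V} (h₁ : X.le p q) (h₂ : X.le q p) : p = q := by
  have := hX.btw_of_le h₁ h₂
  unfold Btw at this
  rw [gdist_self] at this
  exact hX.eq_of_gdist_eq_zero (by omega)

theorem low_of_adj_btw {p q r : V} (h : X.le p q) (hr : X.graph.Adj p r)
    (hd : X.gdist r q + 1 = X.gdist p q) : X.low p r ∧ X.le r q := by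
  obtain ⟨k, hk⟩ : ∃ k, X.gdist p q = k := ⟨_, rfl⟩
  induction k generalizing p r with
  | zero => omega
  | succ k ih =>
    have hl : X.low p r := by
      rcases (hX.adj_iff p r).1 hr with h' | h'
      · exact h'
      · have := hX.gdist_low_le h' h
        omega
    refine ⟨hl, ?_⟩
    rcases Relation.ReflTransGen.cases_head h with rfl | ⟨p₁, h1, h2⟩
    · simp at hk
    have e1 := hX.gdist_low_le h1 h2
    by_cases hne : p₁ = r
    · exact hne ▸ h2
    obtain ⟨t, ht, ht', hd'⟩ := hX.quadrangle (z := q) (hX.low_adj h1) hr hne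
      (by rw [gdist_comm q, gdist_comm q]; omega) (by rw [gdist_comm q, gdist_comm q]; omega)
    rw [gdist_comm q, gdist_comm q] at hd'
    obtain ⟨i1, i2⟩ := ih h2 ht.symm (by omega) (by omega)
    have hpt : p ≠ t := by
      rintro rfl
      omega
    exact le_trans (le_of_low ((hX.admissible p p₁ t r
      ⟨hX.low_adj h1, ht.symm, ht', hr.symm, hpt, hne⟩).1 h1)) i2

/-- The metric interval between comparable vertices is the order interval. -/
theorem le_of_btw {p q r : V} (h : X.le p q) (hb : X.Btw p r q) : X.le p r ∧ X.le r q := by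
  obtain ⟨k, hk⟩ : ∃ k, X.gdist p r = k := ⟨_, rfl⟩
  induction k generalizing p with
  | zero =>
    obtain rfl := hX.eq_of_gdist_eq_zero hk
    exact ⟨le_refl _, h⟩
  | succ k ih =>
    obtain ⟨p₁, h1, h2⟩ := hX.exists_next (a := p) (b := r) (by rintro rfl; simp at hk)
    have h3 := hX.btw_trans' hb h2
    have e := gdist_eq_one h1
    obtain ⟨i1, i2⟩ := hX.low_of_adj_btw h h1 (by have := h3.1; unfold Btw at this; omega)
    obtain ⟨i3, i4⟩ := ih i2 h3.2 (by unfold Btw at h2; omega)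
    exact ⟨le_trans (le_of_low i1) i3, i4⟩

theorem low_of_le_gdist {p q : V} (h : X.le p q) (hd : X.gdist p q = 1) : X.low p q :=
  (hX.low_of_adj_btw h (adj_of_gdist_eq_one hd) (by simp [hd])).1

/-- Only a descending step of the geodesic needs an argument. It moves towards `y`, hence by
`low_sign'` also towards `p`, so it stays in the interval between `p` and `x`. -/
theorem filter_convex {p x y r : V} (hx : X.le p x) (hy : X.le p y) (h : X.Btw x r y) :
    X.le p r := by
  obtain ⟨k, hk⟩ : ∃ k, X.gdist x r = k := ⟨_, rfl⟩
  induction k generalizing x with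
  | zero => exact hX.eq_of_gdist_eq_zero hk ▸ hx
  | succ k ih =>
    obtain ⟨x₁, h1, h2⟩ := hX.exists_next (a := x) (b := r) (by rintro rfl; simp at hk)
    have h3 := hX.btw_trans' h h2
    have e := gdist_eq_one h1
    refine ih ?_ h3.2 (by unfold Btw at h2; omega)
    rcases (hX.adj_iff x x₁).1 h1 with hl | hl
    · exact le_trans hx (le_of_low hl)
    · have h4 := h3.1
      unfold Btw at h4
      have := hX.low_sign' hl hy (by rw [gdist_comm y, gdist_comm y]; omega)
      refine (hX.le_of_btw (r := x₁) hx ?_).1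
      unfold Btw
      rw [gdist_comm x₁]; omega

theorem ideal_convex {p x y r : V} (hx : X.le x p) (hy : X.le y p) (h : X.Btw x r y) :
    X.le r p :=
  op_le.1 (hX.op.filter_convex (op_le.2 hx) (op_le.2 hy) h)

/-- Convex sets are gated. -/
theorem exists_gate {C : V → Prop} (hC : ∀ x y r, C x → C y → X.Btw x r y → C r)
    (hne : ∃ x, C x) (z : V) : ∃ g, C g ∧ ∀ y, C y → X.Btw z g y := by
  obtain ⟨g, hg, hmin⟩ := (measure fun y => X.gdist z y).wf.has_min {x | C x} hne
  refine ⟨g, hg, fun y hy => ?_⟩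
  -- Convexity puts the median in the set, so a nearest point `g` coincides with it.
  obtain ⟨m, h1, h2, h3⟩ := hX.exists_median z g y
  have hm : C m := hC _ _ _ hg hy h2
  have h4 : ¬ X.gdist z m < X.gdist z g := hmin m hm
  have : m = g := hX.eq_of_gdist_eq_zero (by unfold Btw at h1; omega)
  exact this ▸ h3.symm

theorem exists_upGate (p z : V) : ∃ g, X.IsGate p z g :=
  hX.exists_gate (fun _ _ _ => hX.filter_convex) ⟨p, le_refl p⟩ z

/-- The meet is the gate of `x` in the down-set of `y`; the common lower bound forces this gate
below `x`. -/
theorem exists_meet {p x y : V} (hx : X.le p x) (hy : X.le p y) :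
    ∃ m, X.IsMeet x y m ∧ X.le p m := by
  obtain ⟨g, hg, hgate⟩ := hX.exists_gate (C := fun r => X.le r y)
    (fun _ _ _ => hX.ideal_convex) ⟨y, le_refl y⟩ x
  have key : ∀ c, X.le c x → X.le c y → X.le c g ∧ X.le g x := fun c h1 h2 =>
    hX.le_of_btw h1 (hgate c h2).symm
  exact ⟨g, ⟨(key p hx hy).2, hg, fun c h1 h2 => (key c h1 h2).1⟩, (key p hx hy).1⟩

theorem exists_join {p x y : V} (hx : X.le x p) (hy : X.le y p) :
    ∃ j, X.IsJoin x y j ∧ X.le j p := by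
  obtain ⟨j, h1, h2⟩ := hX.op.exists_meet (op_le.2 hx) (op_le.2 hy)
  exact ⟨j, op_isMeet.1 h1, op_le.1 h2⟩

theorem meet_unique {x y m m' : V} (h : X.IsMeet x y m) (h' : X.IsMeet x y m') : m = m' :=
  hX.le_antisymm (h'.2.2 m h.1 h.2.1) (h.2.2 m' h'.1 h'.2.1)

theorem meet_btw {x y m : V} (h : X.IsMeet x y m) : X.Btw x m y := by
  obtain ⟨n, h1, h2, h3⟩ := hX.exists_median m x y
  have h4 := hX.le_of_btw h.1 h1
  have h5 := hX.le_of_btw h.2.1 h3.symm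
  have := hX.le_antisymm (h.2.2 n h4.2 h5.2) h4.1
  exact this ▸ h2

theorem join_btw {x y m : V} (h : X.IsJoin x y m) : X.Btw x m y :=
  hX.op.meet_btw (op_isMeet.2 h)

theorem gdist_meet_join {x y m j : V} (hm : X.IsMeet x y m) (hj : X.IsJoin x y j) :
    X.gdist m x = X.gdist y j := by
  have h1 := hX.meet_btw hm
  have h2 := hX.join_btw hj
  have h3 := hX.btw_of_le hm.1 hj.1
  have h4 := hX.btw_of_le hm.2.1 hj.2.1
  unfold Btw at *
  rw [gdist_comm x m] at h1
  rw [gdist_comm j y] at h2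
  omega

theorem dist_meet_join {x y m j : V} (hm : X.IsMeet x y m) (hj : X.IsJoin x y j) :
    X.dist m x = X.dist y j := by
  have h1 := hX.dist_btw (hX.meet_btw hm)
  have h2 := hX.dist_btw (hX.join_btw hj)
  have h3 := hX.dist_btw (hX.btw_of_le hm.1 hj.1)
  have h4 := hX.dist_btw (hX.btw_of_le hm.2.1 hj.2.1)
  rw [hX.dist_comm x m] at h1
  rw [hX.dist_comm j y] at h2
  linarith

theorem dist_le_add {p q r : V} (h₁ : X.le p q) (h₂ : X.le q r) :
    X.dist p r = X.dist p q + X.dist q r := (hX.dist_btw (hX.btw_of_le h₁ h₂)).symm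

/-- Distances from `z` to elements above `p`, in terms of the gate of `z`. -/
theorem dist_gate {p z g x a : V} (hg : X.IsGate p z g) (hx : X.le p x) (ha : X.IsMeet x g a) :
    X.dist z x = X.dist z p + X.dist p x - 2 * X.dist p a := by
  have h1 := hX.dist_btw (hg.2 x hx)
  have h2 := hX.dist_btw (hg.2 p (le_refl p))
  have h3 := hX.dist_btw (hX.meet_btw ha)
  have hpa := ha.2.2 p hx hg.1
  have h4 := hX.dist_le_add hpa ha.1
  have h5 := hX.dist_le_add hpa ha.2.1
  rw [hX.dist_comm x a, hX.dist_comm x g] at h3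
  rw [hX.dist_comm g p] at h2
  linarith

omit hX in
theorem exists_low_of_lt {p q : V} (h : X.le p q) (hne : p ≠ q) :
    ∃ a, X.low p a ∧ X.le a q := by
  rcases Relation.ReflTransGen.cases_head h with rfl | h'
  · exact absurd rfl hne
  · exact h'

omit hX in
theorem exists_low_of_lt' {p q : V} (h : X.le p q) (hne : p ≠ q) :
    ∃ a, X.low a q ∧ X.le p a := by
  rcases Relation.ReflTransGen.cases_tail h with rfl | ⟨a, h1, h2⟩
  · exact absurd rfl hne
  · exact ⟨a, h2, h1⟩

/-- If `g ∧ g'` were not `g`, a cover of it below `g` would be a step towards `z`, hence towards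
`z'`, and so would also lie below `g'`. -/
theorem gate_mono {p z z' g g' : V} (hg : X.IsGate p z g) (hg' : X.IsGate p z' g')
    (h : X.le z z') : X.le g g' := by
  obtain ⟨n, hn, hpn⟩ := hX.exists_meet hg.1 hg'.1
  by_cases hne : n = g
  · exact hne ▸ hn.2.1
  obtain ⟨x, hnx, hxg⟩ := exists_low_of_lt hn.1 hne
  have hpx := le_trans hpn (le_of_low hnx)
  have e1 := hg.2 n hpn
  have e2 := hg.2 x hpx
  have e3 := hX.gdist_low_le hnx hxg
  unfold Btw at e1 e2
  rw [gdist_comm g] at e1 e2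
  have e4 := hX.low_sign hnx h (by omega)
  have e5 := hg'.2 n hpn
  have e6 := hg'.2 x hpx
  unfold Btw at e5 e6
  rw [gdist_comm g'] at e5 e6
  have e7 := hX.low_of_adj_btw hn.2.1 (hX.low_adj hnx) (by omega)
  have e8 := hX.le_antisymm (hn.2.2 x hxg e7.2) (le_of_low hnx)
  have := hX.gdist_low hnx
  rw [e8, gdist_self] at this
  omega

/-- The median of the three joins lies in each of the three convex up-sets. -/
theorem exists_upper_bound₃ {a b c x y z : V} (hx : X.IsJoin a b x) (hy : X.IsJoin b c y)
    (hz : X.IsJoin c a z) : ∃ t, X.le a t ∧ X.le b t ∧ X.le c t := by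
  obtain ⟨t, h1, h2, h3⟩ := hX.exists_median x y z
  exact ⟨t, hX.filter_convex hz.2.1 hx.1 h3, hX.filter_convex hx.2.1 hy.1 h1,
    hX.filter_convex hy.2.1 hz.1 h2⟩

theorem exists_join₃ {a b c x y z : V} (hx : X.IsJoin a b x) (hy : X.IsJoin b c y)
    (hz : X.IsJoin c a z) : ∃ t, X.IsJoin x c t := by
  obtain ⟨t, h1, h2, h3⟩ := hX.exists_upper_bound₃ hx hy hz
  obtain ⟨j, hj, _⟩ := hX.exists_join (hx.2.2 t h1 h2) h3
  exact ⟨j, hj⟩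

theorem eq_or_eq_of_low {x j y : V} (h : X.low x y) (h1 : X.le x j) (h2 : X.le j y) :
    j = x ∨ j = y := by
  have e := hX.btw_of_le h1 h2
  unfold Btw at e
  rw [hX.gdist_low h] at e
  rcases Nat.eq_zero_or_pos (X.gdist x j) with h0 | h0
  · exact Or.inl (hX.eq_of_gdist_eq_zero h0).symm
  · exact Or.inr (hX.eq_of_gdist_eq_zero (by omega))

/-- An upper cover of `x` is below every upper bound of `x` and one further element. -/
theorem cover_le {x y e c : V} (h : X.low x y) (hxc : X.le x c) (hey : X.le e y)
    (hec : X.le e c) (hex : ¬ X.le e x) : X.le y c := by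
  obtain ⟨j, hj, hjy⟩ := hX.exists_join (le_of_low h) hey
  rcases hX.eq_or_eq_of_low h hj.1 hjy with rfl | rfl
  · exact absurd hj.2.1 hex
  · exact hj.2.2 c hxc hec

theorem not_le_of_low {x y : V} (h : X.low x y) : ¬ X.le y x := fun h' => by
  have h1 := hX.gdist_low h
  rw [hX.le_antisymm (le_of_low h) h', gdist_self] at h1
  omega

/-- Submodularity of the distance in one variable. -/
theorem dist_submodular_left {p q m j : V} (hm : X.IsMeet p q m) (hj : X.IsJoin p q j) (z : V) :
    X.dist z j + X.dist z m ≤ X.dist z p + X.dist z q := by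
  -- By the gate formula the distance to `z` is modular up to -2 times the height of `x ∧ g`, and (p
  -- ∧ g) ∨ (q ∧ g) ≤ j ∧ g makes that height supermodular.
  obtain ⟨g, hg⟩ := hX.exists_upGate m z
  obtain ⟨a, ha, hma⟩ := hX.exists_meet hm.1 hg.1
  obtain ⟨b, hb, hmb⟩ := hX.exists_meet hm.2.1 hg.1
  have hmj := le_trans hm.1 hj.1
  obtain ⟨c, hc, hmc⟩ := hX.exists_meet hmj hg.1
  have e1 := hX.dist_gate hg hm.1 ha
  have e2 := hX.dist_gate hg hm.2.1 hb
  have e3 := hX.dist_gate hg hmj hc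
  have e4 := hX.dist_meet_join hm hj
  have e5 := hX.dist_le_add hm.2.1 hj.2.1
  have hac : X.le a c := hc.2.2 a (le_trans ha.1 hj.1) ha.2.1
  have hbc : X.le b c := hc.2.2 b (le_trans hb.1 hj.2.1) hb.2.1
  obtain ⟨n, hn, hnc⟩ := hX.exists_join hac hbc
  have hmab : X.IsMeet a b m :=
    ⟨hma, hmb, fun d h1 h2 => hm.2.2 d (le_trans h1 ha.1) (le_trans h2 hb.1)⟩
  have e6 := hX.dist_meet_join hmab hn
  have e7 := hX.dist_le_add hmb hn.2.1
  have e8 := hX.dist_le_add (le_trans hmb hn.2.1) hnc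
  have := hX.dist_nonneg n c
  linarith

/-- Along a chain from `m` to `p`, each edge contributes plus or minus its length according to the
side of `y`; raising `y` can only switch plus to minus. -/
theorem dist_mono_diff {m p y y' : V} (hm : X.le m p) (hy : X.le y y') :
    X.dist p y' - X.dist m y' ≤ X.dist p y - X.dist m y := by
  induction hm with
  | refl => simp
  | @tail p p' _ hl ih =>
    have hadj := hX.low_adj hl
    have key : X.dist p' y' - X.dist p y' ≤ X.dist p' y - X.dist p y := by
      have up : ∀ z, X.gdist z p' + 1 = X.gdist z p → X.dist p' z - X.dist p z = -X.dist p p' :=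
        fun z hz => by
          have : X.Btw z p' p := by
            unfold Btw; rw [gdist_comm p', hX.gdist_low hl]; exact hz
          have := hX.dist_btw this
          rw [hX.dist_comm p' p, hX.dist_comm z, hX.dist_comm z] at this
          linarith
      have down : ∀ z, X.gdist z p + 1 = X.gdist z p' → X.dist p' z - X.dist p z = X.dist p p' :=
        fun z hz => by
          have : X.Btw z p p' := by
            unfold Btw; rw [hX.gdist_low hl]; exact hz
          have := hX.dist_btw this
          rw [hX.dist_comm z, hX.dist_comm z] at this
          linarith
      have hn := hX.dist_nonneg p p'
      rcases hX.gdist_adj hadj y with e | e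
      · rw [down y e.symm]
        rcases hX.gdist_adj hadj y' with e' | e'
        · rw [down y' e'.symm]
        · rw [up y' e'.symm]; linarith
      · rw [up y e.symm, up y' (hX.low_sign hl hy e.symm)]
    linarith

/-- Submodularity of the distance for pairs that have joins. -/
theorem dist_submodular {p₁ q₁ m₁ j₁ p₂ q₂ m₂ j₂ : V} (hm₁ : X.IsMeet p₁ q₁ m₁)
    (hj₁ : X.IsJoin p₁ q₁ j₁) (hm₂ : X.IsMeet p₂ q₂ m₂) (hj₂ : X.IsJoin p₂ q₂ j₂) :
    X.dist m₁ m₂ + X.dist j₁ j₂ ≤ X.dist p₁ p₂ + X.dist q₁ q₂ := by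
  have e1 := hX.dist_submodular_left hm₁ hj₁ j₂
  have e2 := hX.dist_submodular_left hm₂ hj₂ q₁
  have e3 := hX.dist_mono_diff hm₁.1 hj₂.1
  have e4 := hX.dist_mono_diff hm₂.1 hm₁.2.1
  rw [hX.dist_comm j₂, hX.dist_comm j₂, hX.dist_comm j₂, hX.dist_comm j₂] at e1
  rw [hX.dist_comm p₂, hX.dist_comm m₂, hX.dist_comm p₂, hX.dist_comm m₂] at e4
  linarith

/-- Distances from an element above `m₁` to an element above `m₂`, in terms of gates. -/
theorem dist_gate_gate {m₁ p₁ m₂ p₂ g₁ g₂ a₁ a₂ : V} (h₁ : X.le m₁ p₁) (h₂ : X.le m₂ p₂)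
    (hg₁ : X.IsGate m₁ p₂ g₁) (hg₂ : X.IsGate m₂ m₁ g₂) (ha₁ : X.IsMeet p₁ g₁ a₁)
    (ha₂ : X.IsMeet p₂ g₂ a₂) :
    X.dist p₁ p₂ = X.dist m₁ m₂ + (X.dist m₁ p₁ - 2 * X.dist m₁ a₁) +
      (X.dist m₂ p₂ - 2 * X.dist m₂ a₂) := by
  have e1 := hX.dist_gate hg₁ h₁ ha₁
  have e2 := hX.dist_gate hg₂ h₂ ha₂
  rw [hX.dist_comm p₂ p₁, hX.dist_comm p₂ m₁] at e1
  linarith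

end IsModularComplex

/-! ### Complemented intervals and their extension. -/

/-- The interval between `p` and `q` is a complemented lattice: every element of it that is not
above `q` fails to be above some atom. -/
def IsComplemented (X : Complex V) (p q : V) : Prop :=
  X.le p q ∧ ∀ c, X.le p c → ¬ X.le q c → ∃ a, X.low p a ∧ X.le a q ∧ ¬ X.le a c

namespace IsModularComplex

variable (hX : X.IsModularComplex)
include hX

/-- An atom `a` missed by `c` meets `p'` in `p`, so by modularity its join with `p'` covers `p'`. -/
theorem complemented_raise {p p' q : V} (h : X.IsComplemented p q) (h₁ : X.le p p')
    (h₂ : X.le p' q) : X.IsComplemented p' q := by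
  refine ⟨h₂, fun c hc hqc => ?_⟩
  obtain ⟨a, ha, haq, hac⟩ := h.2 c (le_trans h₁ hc) hqc
  obtain ⟨j, hj, hjq⟩ := hX.exists_join h₂ haq
  obtain ⟨m, hm, hpm⟩ := hX.exists_meet h₁ (le_of_low ha)
  have hap : ¬ X.le a p' := fun h' => hac (le_trans h' hc)
  have hmp : m = p := by
    rcases hX.eq_or_eq_of_low ha hpm hm.2.1 with h' | h'
    · exact h'
    · exact absurd (h' ▸ hm.1) hap
  have e := hX.gdist_meet_join hm.symm hj.symm
  rw [hmp, hX.gdist_low ha] at e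
  exact ⟨j, hX.low_of_le_gdist hj.1 e.symm, hjq, fun h' => hac (le_trans hj.2.1 h')⟩

theorem complemented_op {p q : V} (h : X.IsComplemented p q) :
    X.op.IsComplemented q p := by
  refine ⟨op_le.2 h.1, fun c hc hpc => ?_⟩
  rw [op_le] at hc hpc
  -- a maximal element of the interval that is not above an element not below `c`
  obtain ⟨x, ⟨hpx, hxq, hx⟩, hmin⟩ := (measure fun y => X.gdist y q).wf.has_min
    {x | X.le p x ∧ X.le x q ∧ ¬ X.le c x} ⟨p, le_refl p, h.1, hpc⟩
  have hmax : ∀ y, X.le x y → X.le y q → x ≠ y → X.le c y := fun y hxy hyq hne => by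
    by_contra hcy
    have h1 : ¬ X.gdist y q < X.gdist x q := hmin y ⟨le_trans hpx hxy, hyq, hcy⟩
    have h2 := hX.btw_of_le hxy hyq
    unfold Btw at h2
    exact hne (hX.eq_of_gdist_eq_zero (by omega))
  have hne : x ≠ q := by
    rintro rfl
    exact hx hc
  refine ⟨x, ?_, op_le.2 hpx, fun h' => hx (op_le.1 h')⟩
  change X.low x q
  -- If `x` is not a coatom, it has two distinct covers `a`, `b` below `q`. By maximality both are
  -- above `c`, and then so is their meet `x`.
  obtain ⟨b, hb, hbq⟩ := exists_low_of_lt hxq hne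
  by_cases hqb : X.le q b
  · exact hX.le_antisymm hqb hbq ▸ hb
  · obtain ⟨a, ha, haq, hab⟩ :=
      (hX.complemented_raise h hpx hxq).2 b (le_of_low hb) hqb
    have hxa : x ≠ a := by
      rintro rfl
      exact hX.not_le_of_low ha (le_refl _)
    have hxb : x ≠ b := by
      rintro rfl
      exact hX.not_le_of_low hb (le_refl _)
    obtain ⟨m, hm, hxm⟩ := hX.exists_meet (le_of_low ha) (le_of_low hb)
    rcases hX.eq_or_eq_of_low ha hxm hm.1 with rfl | rfl
    · exact absurd (hm.2.2 c (hmax a (le_of_low ha) haq hxa) (hmax b (le_of_low hb) hbq hxb)) hx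
    · exact absurd hm.2.1 hab

theorem complemented_lower {p q q' : V} (h : X.IsComplemented p q) (h₁ : X.le p q')
    (h₂ : X.le q' q) : X.IsComplemented p q' :=
  hX.op.complemented_op (hX.op.complemented_raise (hX.complemented_op h) (op_le.2 h₂)
    (op_le.2 h₁))

theorem complemented_sub {p q p' q' : V} (h : X.IsComplemented p q) (h₁ : X.le p p')
    (h₂ : X.le p' q') (h₃ : X.le q' q) : X.IsComplemented p' q' :=
  hX.complemented_lower (hX.complemented_raise h h₁ (le_trans h₂ h₃)) h₂ h₃

omit hX in
-- Direct because `IsComplemented` tests every `c` above `p`, also outside the interval.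
theorem complemented_join {p q q' j : V} (h : X.IsComplemented p q) (h' : X.IsComplemented p q')
    (hj : X.IsJoin q q' j) : X.IsComplemented p j := by
  refine ⟨le_trans h.1 hj.1, fun c hc hjc => ?_⟩
  by_cases hq : X.le q c
  · have hq' : ¬ X.le q' c := fun hq' => hjc (hj.2.2 c hq hq')
    obtain ⟨a, h1, h2, h3⟩ := h'.2 c hc hq'
    exact ⟨a, h1, le_trans h2 hj.2.1, h3⟩
  · obtain ⟨a, h1, h2, h3⟩ := h.2 c hc hq
    exact ⟨a, h1, le_trans h2 hj.1, h3⟩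

theorem complemented_meet {p p' q m : V} (h : X.IsComplemented p q)
    (h' : X.IsComplemented p' q) (hm : X.IsMeet p p' m) : X.IsComplemented m q :=
  hX.op.complemented_op
    (complemented_join (hX.complemented_op h) (hX.complemented_op h') (op_isJoin.2 hm))

/-- If the endpoints of a complemented interval lie on different sides of an edge, then the
edge separates the minimum from some atom. -/
theorem exists_atom_separated {z₀ z₁ m s : V} (hz : X.IsComplemented z₀ z₁)
    (hms : X.low m s) (h₀ : X.gdist z₀ m + 1 = X.gdist z₀ s)
    (h₁ : X.gdist z₁ s + 1 = X.gdist z₁ m) :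
    ∃ t, X.low z₀ t ∧ X.le t z₁ ∧ X.gdist t s + 1 = X.gdist t m := by
  -- A minimal element on the side of `s`; the claim is that it covers `z₀`.
  obtain ⟨j, ⟨hzj, hjz, hj⟩, hmin⟩ := (measure fun y => X.gdist z₀ y).wf.has_min
    {x | X.le z₀ x ∧ X.le x z₁ ∧ X.gdist x s + 1 = X.gdist x m} ⟨z₁, hz.1, le_refl _, h₁⟩
  have hadj := hX.low_adj hms
  have hlt : ∀ y, X.le z₀ y → X.low y j → X.gdist y m + 1 = X.gdist y s := fun y hy hyj => by
    by_contra hcon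
    have h1 : ¬ X.gdist z₀ y < X.gdist z₀ j :=
      hmin y ⟨hy, le_trans (le_of_low hyj) hjz, by have := hX.gdist_adj hadj y; omega⟩
    have h2 := hX.btw_of_le hy (le_of_low hyj)
    unfold Btw at h2
    rw [hX.gdist_low hyj] at h2
    omega
  have hne : z₀ ≠ j := by
    rintro rfl
    omega
  obtain ⟨x, hxj, hzx⟩ := exists_low_of_lt' hzj hne
  by_cases hne' : z₀ = x
  · exact ⟨j, hne' ▸ hxj, hjz, hj⟩
  exfalso
  obtain ⟨p, hpx, hzp⟩ := exists_low_of_lt' hzx hne'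
  have hpj := le_trans (le_of_low hpx) (le_of_low hxj)
  -- Otherwise complementedness supplies a second element `y` between `p` and `j`; by minimality `x`
  -- and `y` are on the side of `m`.
  obtain ⟨y, hpy, hyj, hyx⟩ := (hX.complemented_sub hz hzp hpj hjz).2 x (le_of_low hpx)
    (hX.not_le_of_low hxj)
  have e1 := hX.btw_of_le (le_of_low hpx) (le_of_low hxj)
  have e2 := hX.btw_of_le (le_of_low hpy) hyj
  unfold Btw at e1 e2
  rw [hX.gdist_low hpx, hX.gdist_low hxj] at e1
  rw [hX.gdist_low hpy] at e2
  have hyj' : X.low y j := hX.low_of_le_gdist hyj (by omega)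
  have sx := hlt x hzx hxj
  have sy := hlt y (le_trans hzp (le_of_low hpy)) hyj'
  have sp := hX.low_sign' hms (le_of_low hpx) sx
  have d1 := hX.gdist_adj (hX.low_adj hxj) s
  have d2 := hX.gdist_adj (hX.low_adj hxj) m
  have d3 := hX.gdist_adj (hX.low_adj hyj') s
  have d4 := hX.gdist_adj (hX.low_adj hyj') m
  have d5 := hX.gdist_adj (hX.low_adj hpx) m
  rw [gdist_comm s, gdist_comm s] at d1 d3
  rw [gdist_comm m, gdist_comm m] at d2 d4 d5
  rcases d5 with d5 | d5
  · -- `p` is closer to `m` than `x`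
    have hpj' : p ≠ j := by
      rintro rfl
      simp at e1
    -- The new vertex `t` is a lower cover of `j`, hence on the side of `m`; then the distances of
    -- `t` and `j` to `m` differ by 3, although they are adjacent.
    obtain ⟨t, ht, ht', hd⟩ := hX.quadrangle (z := s) (hX.low_adj hpx).symm (hX.low_adj hxj) hpj'
      (by rw [gdist_comm s, gdist_comm s]; omega) (by rw [gdist_comm s, gdist_comm s]; omega)
    rw [gdist_comm s, gdist_comm s] at hd
    have hb : X.Btw p t j := by
      unfold Btw
      rw [gdist_comm p, gdist_eq_one ht, gdist_eq_one ht']; exact e1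
    have hl := hX.le_of_btw hpj hb
    have htj : X.low t j := hX.low_of_le_gdist hl.2 (gdist_eq_one ht')
    have st := hlt t (le_trans hzp hl.1) htj
    have := hX.gdist_adj ht' m
    rw [gdist_comm m, gdist_comm m] at this
    omega
  -- Now `x` and `y` are both nearer to `m` than `p`, so both lie below the gate of `m`, and hence
  -- so does `j`. But `j` is no nearer to `m` than `p`.
  · obtain ⟨g, hg⟩ := hX.exists_upGate p m
    have g1 := hg.2 p (le_refl p)
    have g2 := hg.2 x (le_of_low hpx)
    have g3 := hg.2 y (le_of_low hpy)
    have g4 := hg.2 j hpj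
    unfold Btw at g1 g2 g3 g4
    rw [gdist_comm m, gdist_comm m] at g1 g2 g3 g4
    rw [gdist_comm g p] at g1
    rw [gdist_comm g x] at g2
    rw [gdist_comm g y] at g3
    rw [gdist_comm g j] at g4
    have hxg := (hX.low_of_adj_btw hg.1 (hX.low_adj hpx) (by omega)).2
    have hyg := (hX.low_of_adj_btw hg.1 (hX.low_adj hpy) (by omega)).2
    have hjg := hX.cover_le hxj hxg hyj hyg hyx
    have := hX.btw_of_le hpj hjg
    unfold Btw at this
    omega

/-- Some vertex `w` lies both on the `r`-side of `r m₀` and on the `s`-side of `m₁ s`. Its gate in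
the interval from `r` to `s` is neither above `m₀` nor below `m₁`, and yields an atom `e` not below
`m₁`, which complements the atoms below `m₁`. -/
theorem complemented_extend_step {z₀ z₁ r m₀ m₁ s : V} (hz : X.IsComplemented z₀ z₁)
    (hr : X.low r m₀) (hm : X.le m₀ m₁) (hs : X.low m₁ s) (h₀ : X.IsComplemented r m₁)
    (h₁ : X.IsComplemented m₀ s) (hd₀ : X.gdist z₀ r + 1 = X.gdist z₀ m₀)
    (hd₁ : X.gdist z₁ s + 1 = X.gdist z₁ m₁) : X.IsComplemented r s := by
  obtain ⟨w, hwr, hws⟩ : ∃ w, X.gdist w r + 1 = X.gdist w m₀ ∧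
      X.gdist w s + 1 = X.gdist w m₁ := by
    rcases hX.gdist_adj (hX.low_adj hs) z₀ with e | e
    · obtain ⟨t, ht, htz, hts⟩ := hX.exists_atom_separated hz hs e.symm hd₁
      rcases hX.gdist_adj (hX.low_adj hr) t with e' | e'
      · exact ⟨t, e'.symm, hts⟩
      -- Otherwise `m₀` lies on the upper side of the edge `z₀ t` and `m₁` on its lower side,
      -- against `m₀ ≼ m₁`.
      · exfalso
        have f1 := hX.gdist_adj (hX.low_adj ht) r
        have f2 := hX.gdist_adj (hX.low_adj ht) m₀
        have f3 := hX.gdist_adj (hX.low_adj ht) s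
        have f4 := hX.gdist_adj (hX.low_adj ht) m₁
        rw [gdist_comm r, gdist_comm r] at f1
        rw [gdist_comm m₀, gdist_comm m₀] at f2
        rw [gdist_comm s, gdist_comm s] at f3
        rw [gdist_comm m₁, gdist_comm m₁] at f4
        have := hX.low_sign ht hm (by rw [gdist_comm m₀, gdist_comm m₀]; omega)
        rw [gdist_comm m₁, gdist_comm m₁] at this
        omega
    · exact ⟨z₀, hd₀, e.symm⟩
  have hrm₁ := le_trans (le_of_low hr) hm
  have hrs := le_trans hrm₁ (le_of_low hs)
  have hm₀s := le_trans hm (le_of_low hs)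
  obtain ⟨g, ⟨hrg, hgs⟩, hg⟩ := hX.exists_gate (C := fun x => X.le r x ∧ X.le x s)
    (fun x y t hx hy h => ⟨hX.filter_convex hx.1 hy.1 h, hX.ideal_convex hx.2 hy.2 h⟩)
    ⟨r, le_refl r, hrs⟩ w
  have g1 := hg r ⟨le_refl r, hrs⟩
  have g2 := hg m₀ ⟨le_of_low hr, hm₀s⟩
  have g3 := hg m₁ ⟨hrm₁, le_of_low hs⟩
  have g4 := hg s ⟨hrs, le_refl s⟩
  unfold Btw at g1 g2 g3 g4
  have hmg : ¬ X.le m₀ g := fun h => by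
    have := hX.gdist_low_le hr h
    rw [gdist_comm r, gdist_comm m₀] at this
    omega
  have hgm : ¬ X.le g m₁ := fun h => by
    have h1 := hX.btw_of_le h (le_of_low hs)
    have h2 := hX.gdist_low hs
    unfold Btw at h1
    omega
  obtain ⟨n, hn, hrn⟩ := hX.exists_meet hrg (le_of_low hr)
  have hnr : n = r := by
    rcases hX.eq_or_eq_of_low hr hrn hn.2.1 with h | h
    · exact h
    · exact absurd (h ▸ hn.1) hmg
  rw [hnr] at hn
  obtain ⟨j, hj, hjs⟩ := hX.exists_join hgs hm₀s
  obtain ⟨t, hmt, htj, htm⟩ := (hX.complemented_lower h₁ hj.2.1 hjs).2 m₁ hm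
    (fun h => hgm (le_trans hj.1 h))
  have hrt := le_trans (le_of_low hr) (le_of_low hmt)
  -- Meeting with `g` transposes the cover `t` of `m₀` down to a cover `e` of `r`.
  obtain ⟨e, he, hre⟩ := hX.exists_meet hrt hrg
  have htg : ¬ X.le m₀ e := fun h => hmg (le_trans h he.2.1)
  have hjt : X.IsJoin t g j :=
    ⟨htj, hj.1, fun c h1 h2 => hj.2.2 c h2 (le_trans (le_of_low hmt) h1)⟩
  have k1 := hX.gdist_meet_join he hjt
  have k2 := hX.gdist_meet_join hn.symm hj.symm
  have k3 := hX.btw_of_le (le_of_low hr) (le_of_low hmt)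
  have k4 := hX.btw_of_le hre he.1
  unfold Btw at k3 k4
  rw [hX.gdist_low hr] at k2
  rw [hX.gdist_low hr, hX.gdist_low hmt] at k3
  have hre' : X.low r e := hX.low_of_le_gdist hre (by omega)
  have hem : ¬ X.le e m₀ := fun h => by
    have h1 := hn.2.2 e he.2.1 h
    have h2 := hX.not_le_of_low hre'
    exact h2 h1
  have hem₁ : ¬ X.le e m₁ := fun h => htm (hX.cover_le hmt hm he.1 h hem)
  refine ⟨hrs, fun c hc hsc => ?_⟩
  by_cases hmc : X.le m₁ c
  · exact ⟨e, hre', le_trans he.2.1 hgs, fun h =>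
      hsc (hX.cover_le hs hmc (le_trans he.2.1 hgs) h hem₁)⟩
  · obtain ⟨a, ha, ham, hac⟩ := h₀.2 c hc hmc
    exact ⟨a, ha, le_trans ham (le_of_low hs), hac⟩

/-- Peeling one edge off either end leaves two smaller instances, which are the hypotheses of the
one-edge step. -/
theorem complemented_extend {z₀ z₁ r m₀ m₁ s : V} (hz : X.IsComplemented z₀ z₁)
    (hm : X.le m₀ m₁) (hrm : X.le r m₀) (hms : X.le m₁ s) (h₀ : X.IsComplemented r m₁)
    (h₁ : X.IsComplemented m₀ s) (hb₀ : X.Btw z₀ r m₀) (hb₁ : X.Btw z₁ s m₁) :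
    X.IsComplemented r s := by
  obtain ⟨k, hk⟩ : ∃ k, X.gdist r m₀ + X.gdist m₁ s = k := ⟨_, rfl⟩
  induction k using Nat.strong_induction_on generalizing r s with
  | _ k ih =>
    by_cases hr : r = m₀
    · exact hr ▸ h₁
    by_cases hs : m₁ = s
    · exact hs ▸ h₀
    obtain ⟨r', hr', hrm'⟩ := exists_low_of_lt hrm hr
    obtain ⟨s', hs', hms'⟩ := exists_low_of_lt' hms hs
    have hrs' : X.le r' s' := le_trans hrm' (le_trans hm hms')
    have e1 := hX.btw_of_le (le_of_low hr') hrm'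
    have e2 := hX.btw_of_le hms' (le_of_low hs')
    have e3 := hX.btw_trans hb₀ e1
    have e4 := hX.btw_trans hb₁ e2.symm
    have i1 := hX.complemented_raise h₀ (le_of_low hr') (le_trans hrm' hm)
    have i2 := hX.complemented_lower h₁ (le_trans hm hms') (le_of_low hs')
    have d1 := hX.gdist_low hr'
    have d2 := hX.gdist_low hs'
    have f1 := e3.2
    have f2 := e4.2
    unfold Btw at e1 e2 f1 f2
    rw [gdist_comm s s'] at f2
    have j1 := ih _ (by omega) hrm' hms i1 h₁ e3.1 hb₁ rfl
    have j2 := ih _ (by omega) hrm hms' h₀ i2 hb₀ e4.1 rfl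
    exact hX.complemented_extend_step hz hr' hrs' hs' j2 j1 (by omega) (by omega)

end IsModularComplex

/-! ### Boolean pairs are the complemented intervals. -/

theorem isBoolean_of_cube {ι : Type*} [Fintype ι] [DecidableEq ι] (φ : Finset ι → V)
    (hinj : Function.Injective φ)
    (h : ∀ s : Finset ι, ∀ i ∉ s,
      X.graph.Adj (φ s) (φ (insert i s)) ∧ X.low (φ s) (φ (insert i s))) :
    X.IsBoolean (φ ∅) (φ Finset.univ) := by
  let e := (Fintype.equivFin ι).symm
  refine ⟨Fintype.card ι, fun s => φ (s.map e.toEmbedding), fun s t hst => ?_, fun s i hi => ?_,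
    ?_, ?_⟩
  · exact Finset.map_injective _ (hinj hst)
  · have := h (s.map e.toEmbedding) (e i) (by simpa using hi)
    beta_reduce
    rw [Finset.map_insert]
    exact this
  · simp
  · simp

theorem le_of_cube {k : ℕ} {φ : Finset (Fin k) → V}
    (h : ∀ s : Finset (Fin k), ∀ i ∉ s,
      X.graph.Adj (φ s) (φ (insert i s)) ∧ X.low (φ s) (φ (insert i s)))
    (s t : Finset (Fin k)) : X.le (φ s) (φ (s ∪ t)) := by
  induction t using Finset.induction_on with
  | empty => simpa using le_refl _
  | insert i t hi ih =>
    by_cases his : i ∈ s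
    · rwa [Finset.union_insert, Finset.insert_eq_of_mem (Finset.mem_union_left _ his)]
    · rw [Finset.union_insert]
      exact le_trans ih (le_of_low (h _ i (by simp [his, hi])).2)

theorem IsBoolean.le {p q : V} (h : X.IsBoolean p q) : X.le p q := by
  obtain ⟨k, φ, _, hφ, rfl, rfl⟩ := h
  simpa using le_of_cube hφ ∅ Finset.univ

namespace IsModularComplex

variable (hX : X.IsModularComplex)
include hX

/-- An element above all atoms of the cube is above every vertex, because a vertex of rank at least
2 is the join of two of its lower covers. -/
theorem complemented_of_isBoolean {p q : V} (h : X.IsBoolean p q) : X.IsComplemented p q := by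
  refine ⟨h.le, fun c hc hqc => ?_⟩
  obtain ⟨k, φ, hinj, hφ, rfl, rfl⟩ := h
  by_contra hcon
  push Not at hcon
  refine hqc ?_
  have key : ∀ n, ∀ s : Finset (Fin k), s.card = n → X.le (φ s) c := by
    intro n
    induction n using Nat.strong_induction_on with
    | _ n ih =>
      intro s hs
      rcases s.eq_empty_or_nonempty with rfl | ⟨i, hi⟩
      · exact hc
      obtain ⟨t, hit, rfl⟩ : ∃ t, i ∉ t ∧ insert i t = s :=
        ⟨s.erase i, Finset.notMem_erase i s, Finset.insert_erase hi⟩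
      rw [Finset.card_insert_of_notMem hit] at hs
      rcases t.eq_empty_or_nonempty with rfl | ⟨j, hj⟩
      · refine hcon _ (hφ ∅ i hit).2 ?_
        simpa using le_of_cube hφ (insert i ∅) Finset.univ
      obtain ⟨u, hju, rfl⟩ : ∃ u, j ∉ u ∧ insert j u = t :=
        ⟨t.erase j, Finset.notMem_erase j t, Finset.insert_erase hj⟩
      have hij : j ≠ i := by
        rintro rfl
        exact hit hj
      have hiu : i ∉ u := fun h => hit (Finset.mem_insert_of_mem h)
      rw [Finset.card_insert_of_notMem hju] at hs
      have hju' : j ∉ insert i u := by simp [hij, hju]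
      have hl := (hφ (insert i u) j hju').2
      rw [Finset.insert_comm] at hl
      refine hX.cover_le (hφ _ i hit).2 (ih _ (by omega) _ (Finset.card_insert_of_notMem hju))
        (le_of_low hl) (ih (u.card + 1) (by omega) _ (Finset.card_insert_of_notMem hiu))
        (fun hle => ?_)
      have e := hX.btw_of_le hle (le_of_low (hφ _ i hit).2)
      unfold Btw at e
      rw [hX.gdist_low hl, hX.gdist_low (hφ _ i hit).2] at e
      have := hinj (hX.eq_of_gdist_eq_zero
        (by omega : X.gdist (φ (insert i u)) (φ (insert j u)) = 0))
      have h2 : j ∈ insert i u := this.symm ▸ Finset.mem_insert_self j u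
      exact hju' h2
  exact key _ _ rfl

/-- The inductive cube below a coatom `c` is doubled by joining each vertex with an atom `a` not
below `c`; `none` is the new direction. -/
theorem isBoolean_of_complemented {p q : V} (h : X.IsComplemented p q) : X.IsBoolean p q := by
  obtain ⟨n, hn⟩ : ∃ n, X.gdist p q = n := ⟨_, rfl⟩
  induction n generalizing q with
  | zero =>
    obtain rfl := hX.eq_of_gdist_eq_zero hn
    exact X.isBoolean_refl p
  | succ n ih =>
    have hpq : p ≠ q := by
      rintro rfl
      simp at hn
    obtain ⟨c, hcq, hpc⟩ := exists_low_of_lt' h.1 hpq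
    have e := hX.btw_of_le hpc (le_of_low hcq)
    unfold Btw at e
    rw [hX.gdist_low hcq] at e
    have hB := ih (hX.complemented_lower h hpc (le_of_low hcq)) (by omega)
    obtain ⟨a, hpa, haq, hac⟩ := h.2 c hpc (hX.not_le_of_low hcq)
    obtain ⟨k, φ, hinj, hφ, rfl, rfl⟩ := hB
    have hle : ∀ s, X.le (φ s) (φ Finset.univ) := fun s => by
      have := le_of_cube hφ s Finset.univ
      rwa [show s ∪ Finset.univ = Finset.univ by ext; simp] at this
    have hge : ∀ s, X.le (φ ∅) (φ s) := fun s => by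
      simpa using le_of_cube hφ ∅ s
    have hJ : ∀ s, ∃ j, X.IsJoin (φ s) a j ∧ X.le j q := fun s =>
      hX.exists_join (le_trans (hle s) (le_of_low hcq)) haq
    choose J hJ hJq using hJ
    have hmeet : ∀ s, X.IsMeet (φ s) a (φ ∅) := fun s => by
      obtain ⟨m, hm, hpm⟩ := hX.exists_meet (hge s) (le_of_low hpa)
      rcases hX.eq_or_eq_of_low hpa hpm hm.2.1 with rfl | rfl
      · exact hm
      · exact absurd (le_trans hm.1 (hle s)) hac
    have hlow : ∀ s, X.low (φ s) (J s) := fun s => by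
      have := hX.gdist_meet_join (hmeet s).symm (hJ s).symm
      rw [hX.gdist_low hpa] at this
      exact hX.low_of_le_gdist (hJ s).1 this.symm
    have hJlow : ∀ s, ∀ i ∉ s, X.low (J s) (J (insert i s)) := fun s i hi => by
      have h1 := (hφ s i hi).2
      have h2 : X.le (J s) (J (insert i s)) :=
        (hJ s).2.2 _ (le_trans (le_of_low h1) (hJ _).1) (hJ _).2.1
      have h3 := hX.btw_of_le (le_of_low h1) (le_of_low (hlow (insert i s)))
      have h4 := hX.btw_of_le (le_of_low (hlow s)) h2
      unfold Btw at h3 h4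
      rw [hX.gdist_low h1, hX.gdist_low (hlow _)] at h3
      rw [hX.gdist_low (hlow _)] at h4
      exact hX.low_of_le_gdist h2 (by omega)
    have hJc : ∀ s, X.IsMeet (J s) (φ Finset.univ) (φ s) := fun s => by
      obtain ⟨m, hm, hpm⟩ := hX.exists_meet (le_of_low (hlow s)) (hle s)
      rcases hX.eq_or_eq_of_low (hlow s) hpm hm.1 with h' | h'
      · exact h' ▸ hm
      · exact absurd (le_trans (hJ s).2.1 (h' ▸ hm.2.1)) hac
    have hJinj : ∀ s t, J s = J t → s = t := fun s t hst =>
      hinj (hX.meet_unique (hJc s) (hst ▸ hJc t))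
    have hne : ∀ s t, J s ≠ φ t := fun s t hst =>
      hac (le_trans (hJ s).2.1 (hst ▸ hle t))
    have hJtop : J Finset.univ = q := by
      rcases hX.eq_or_eq_of_low hcq (hJ Finset.univ).1 (hJq _) with h' | h'
      · exact absurd h' (hne _ _)
      · exact h'
    have hbool := isBoolean_of_cube (X := X) (ι := Option (Fin k))
      (fun S => if none ∈ S then J S.eraseNone else φ S.eraseNone) (fun S T hST => ?_)
      (fun S i hi => ?_)
    · have : (Finset.univ : Finset (Option (Fin k))).eraseNone = Finset.univ := by
        ext x
        simp
      simpa [hJtop, this] using hbool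
    · have hext : ∀ S T : Finset (Option (Fin k)), (none ∈ S ↔ none ∈ T) →
          S.eraseNone = T.eraseNone → S = T := fun S T h1 h2 => by
        ext x
        cases x with
        | none => exact h1
        | some x => rw [← Finset.mem_eraseNone, h2, Finset.mem_eraseNone]
      dsimp only at hST
      split_ifs at hST with h1 h2 h2
      · exact hext S T (by simp [h1, h2]) (hJinj _ _ hST)
      · exact absurd hST (hne _ _)
      · exact absurd hST.symm (hne _ _)
      · exact hext S T (by simp [h1, h2]) (hinj hST)
    · suffices hl : X.low _ _ from ⟨hX.low_adj hl, hl⟩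
      cases i with
      | none =>
        have : (insert none S).eraseNone = S.eraseNone := by
          ext x
          simp
        simpa [hi, this] using hlow S.eraseNone
      | some i =>
        have h1 : (insert (some i) S).eraseNone = insert i S.eraseNone := by
          ext x
          simp
        have h2 : i ∉ S.eraseNone := by simpa using hi
        by_cases hS : none ∈ S
        · simpa [hS, h1] using hJlow S.eraseNone i h2
        · simpa [hS, h1] using (hφ S.eraseNone i h2).2

theorem isBoolean_iff {p q : V} : X.IsBoolean p q ↔ X.IsComplemented p q :=
  ⟨hX.complemented_of_isBoolean, hX.isBoolean_of_complemented⟩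

end IsModularComplex

end Complex

section Bounds

variable {L : Type*} [Preorder L]

theorem isGLB_pair_iff {a b m : L} :
    IsGLB {a, b} m ↔ m ≤ a ∧ m ≤ b ∧ ∀ c, c ≤ a → c ≤ b → c ≤ m := by
  simp only [IsGLB, IsGreatest, mem_lowerBounds, mem_upperBounds, Set.mem_insert_iff,
    Set.mem_singleton_iff, forall_eq_or_imp, forall_eq, and_assoc]
  exact and_congr_right fun _ => and_congr_right fun _ =>
    ⟨fun h c h1 h2 => h c ⟨h1, h2⟩, fun h c h1 => h c h1.1 h1.2⟩

theorem isLUB_pair_iff {a b j : L} :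
    IsLUB {a, b} j ↔ a ≤ j ∧ b ≤ j ∧ ∀ c, a ≤ c → b ≤ c → j ≤ c := by
  simp only [IsLUB, IsLeast, mem_lowerBounds, mem_upperBounds, Set.mem_insert_iff,
    Set.mem_singleton_iff, forall_eq_or_imp, forall_eq, and_assoc]
  exact and_congr_right fun _ => and_congr_right fun _ =>
    ⟨fun h c h1 h2 => h c ⟨h1, h2⟩, fun h c h1 => h c h1.1 h1.2⟩

end Bounds

/-! ### The order and the metric of the 2-subdivision. -/

namespace Complex

variable {V : Type*} {X : Complex V}

theorem BoolPair.ext {a b : X.BoolPair} (h₁ : a.lo = b.lo) (h₂ : a.hi = b.hi) : a = b :=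
  Subtype.ext (Prod.ext h₁ h₂)

theorem BoolPair.lo_le_hi (a : X.BoolPair) : X.le a.lo a.hi := IsBoolean.le a.2

theorem le_of_subdivision_le {a b : X.BoolPair} (h : X.subdivision.le a b) :
    X.le b.lo a.lo ∧ X.le a.hi b.hi := by
  induction h with
  | refl => exact ⟨le_refl _, le_refl _⟩
  | tail _ hl ih =>
    rcases hl with ⟨h1, h2⟩ | ⟨h1, h2⟩
    · exact ⟨h1 ▸ ih.1, le_trans ih.2 (le_of_low h2)⟩
    · exact ⟨le_trans (le_of_low h2) ih.1, h1 ▸ ih.2⟩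

theorem exists_walk_edges_map_append {W : Type*} {G : SimpleGraph W} (len : Sym2 W → ℝ)
    {a b c : W} {r s : ℝ} (h : ∃ w : G.Walk a b, (w.edges.map len).sum = r) (hbc : G.Adj b c)
    (hs : len s(b, c) = s) : ∃ w : G.Walk a c, (w.edges.map len).sum = r + s := by
  obtain ⟨w, hw⟩ := h
  exact ⟨w.append (.cons hbc .nil), by simp [hw, hs]⟩

namespace IsModularComplex

variable (hX : X.IsModularComplex)
include hX

theorem subdivision_le_of_hi {p q q' : V} (h : X.le q q') (hq : X.IsBoolean p q)
    (hq' : X.IsBoolean p q') : X.subdivision.le ⟨(p, q), hq⟩ ⟨(p, q'), hq'⟩ := by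
  induction h with
  | refl => exact le_refl _
  | @tail r q' hqr hl ih =>
    have hr : X.IsBoolean p r := hX.isBoolean_iff.2 (hX.complemented_lower (hX.isBoolean_iff.1 hq')
      (le_trans hq.le hqr) (le_of_low hl))
    exact le_trans (ih hr) (le_of_low (Or.inl ⟨rfl, hl⟩))

theorem subdivision_le_of_lo {p p' q : V} (h : X.le p' p) (hp : X.IsBoolean p q)
    (hp' : X.IsBoolean p' q) : X.subdivision.le ⟨(p, q), hp⟩ ⟨(p', q), hp'⟩ := by
  induction h using Relation.ReflTransGen.head_induction_on with
  | refl => exact le_refl _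
  | @head p' r hl hrp ih =>
    have hr : X.IsBoolean r q := hX.isBoolean_iff.2 (hX.complemented_raise (hX.isBoolean_iff.1 hp')
      (le_of_low hl) (le_trans hrp hp.le))
    exact le_trans (ih hr) (le_of_low (Or.inr ⟨rfl, hl⟩))

theorem subdivision_le_iff {a b : X.BoolPair} :
    X.subdivision.le a b ↔ X.le b.lo a.lo ∧ X.le a.hi b.hi := by
  refine ⟨le_of_subdivision_le, fun ⟨h1, h2⟩ => ?_⟩
  have hc : X.IsBoolean a.lo b.hi := hX.isBoolean_iff.2
    (hX.complemented_raise (hX.isBoolean_iff.1 b.2) h1 (le_trans a.lo_le_hi h2))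
  exact le_trans (hX.subdivision_le_of_hi h2 a.2 hc) (hX.subdivision_le_of_lo h1 hc b.2)

/-- The cube is the product of the cube from `z` up to `a.hi` and the one from `a.lo` to `z`
traversed downwards, hence the complement in the first factor. Subintervals of complemented
intervals are complemented, so all its vertices are Boolean pairs. -/
theorem subdivision_isBoolean_iff {z : V} {a : X.BoolPair} :
    X.subdivision.IsBoolean (X.diag z) a ↔ X.le a.lo z ∧ X.le z a.hi := by
  refine ⟨fun h => le_of_subdivision_le h.le, fun ⟨h1, h2⟩ => ?_⟩
  have ha := hX.isBoolean_iff.1 a.2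
  obtain ⟨k, φ, hφi, hφ, hφ0, hφ1⟩ := hX.isBoolean_of_complemented (hX.complemented_lower ha h1 h2)
  obtain ⟨l, ψ, hψi, hψ, hψ0, hψ1⟩ := hX.isBoolean_of_complemented (hX.complemented_raise ha h1 h2)
  have b1 : ∀ s, X.le a.lo (φ s) ∧ X.le (φ s) z := fun s => by
    have := le_of_cube hφ ∅ s
    have h' := le_of_cube hφ s Finset.univ
    rw [show s ∪ Finset.univ = Finset.univ by ext; simp, hφ1] at h'
    rw [show ∅ ∪ s = s by ext; simp, hφ0] at this
    exact ⟨this, h'⟩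
  have b2 : ∀ s, X.le z (ψ s) ∧ X.le (ψ s) a.hi := fun s => by
    have := le_of_cube hψ ∅ s
    have h' := le_of_cube hψ s Finset.univ
    rw [show s ∪ Finset.univ = Finset.univ by ext; simp, hψ1] at h'
    rw [show ∅ ∪ s = s by ext; simp, hψ0] at this
    exact ⟨this, h'⟩
  have hb : ∀ s t, X.IsBoolean (φ s) (ψ t) := fun s t =>
    hX.isBoolean_of_complemented (hX.complemented_sub ha (b1 s).1
      (le_trans (b1 s).2 (b2 t).1) (b2 t).2)
  have hcube := isBoolean_of_cube (X := X.subdivision) (ι := Fin k ⊕ Fin l)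
    (fun S => ⟨(φ S.toLeftᶜ, ψ S.toRight), hb _ _⟩) (fun S T hST => ?_) (fun S i hi => ?_)
  · have e0 : X.diag z = ⟨(φ (∅ : Finset (Fin k ⊕ Fin l)).toLeftᶜ,
        ψ (∅ : Finset (Fin k ⊕ Fin l)).toRight), hb _ _⟩ := by
      refine BoolPair.ext ?_ ?_
      · change z = φ _
        rw [← hφ1]
        congr 1
      · change z = ψ _
        rw [← hψ0]
        congr 1
    have e1 : a = ⟨(φ (Finset.univ : Finset (Fin k ⊕ Fin l)).toLeftᶜ,
        ψ (Finset.univ : Finset (Fin k ⊕ Fin l)).toRight), hb _ _⟩ := by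
      refine BoolPair.ext ?_ ?_
      · refine hφ0.symm.trans ?_
        congr 1
        ext
        simp
      · refine hψ1.symm.trans ?_
        congr 1
        ext
        simp
    rw [e0, e1]
    exact hcube
  · have e := congrArg Subtype.val hST
    simp only [Prod.mk.injEq] at e
    have e1 := compl_injective (hφi e.1)
    have e2 := hψi e.2
    rw [← Finset.toLeft_disjSum_toRight (u := S), ← Finset.toLeft_disjSum_toRight (u := T), e1, e2]
  · cases i with
    | inl i =>
      have hi' : i ∉ (insert i S.toLeft)ᶜ := by simp
      have h' := hφ _ i hi'
      have e : insert i (insert i S.toLeft)ᶜ = S.toLeftᶜ := by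
        ext x
        by_cases hx : x = i
        · subst hx
          simpa using hi
        · simp [hx]
      rw [e] at h'
      have e1 : (insert (Sum.inl i) S).toLeft = insert i S.toLeft := by ext; simp
      have e2 : (insert (Sum.inl i) S).toRight = S.toRight := by ext; simp
      refine ⟨Or.inr ⟨?_, ?_⟩, Or.inr ⟨?_, ?_⟩⟩ <;> simp only [BoolPair.lo, BoolPair.hi, e1, e2]
      · exact h'.1.symm
      · exact h'.2
    | inr i =>
      have h' := hψ S.toRight i (by simpa using hi)
      have e1 : (insert (Sum.inr i) S).toLeft = S.toLeft := by ext; simp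
      have e2 : (insert (Sum.inr i) S).toRight = insert i S.toRight := by ext; simp
      refine ⟨Or.inl ⟨?_, ?_⟩, Or.inl ⟨?_, ?_⟩⟩ <;> simp only [BoolPair.lo, BoolPair.hi, e1, e2]
      · exact h'.1
      · exact h'.2

omit hX in
theorem subdivision_len_hi {a b : X.BoolPair} (h : a.lo = b.lo) :
    X.subdivision.len s(a, b) = X.len s(a.hi, b.hi) / 2 := if_pos h

omit hX in
theorem subdivision_len_lo {a b : X.BoolPair} (h : a.lo ≠ b.lo) :
    X.subdivision.len s(a, b) = X.len s(a.lo, b.lo) / 2 := if_neg h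

theorem le_subdivision_walk {a b : X.BoolPair} (w : X.subdivision.graph.Walk a b) :
    (X.dist a.lo b.lo + X.dist a.hi b.hi) / 2 ≤ (w.edges.map X.subdivision.len).sum := by
  induction w with
  | nil => simp [hX.dist_self]
  | @cons a c b h w ih =>
    simp only [SimpleGraph.Walk.edges_cons, List.map_cons, List.sum_cons]
    rcases h with ⟨h1, h2⟩ | ⟨h1, h2⟩
    · rw [subdivision_len_hi h1, h1]
      have := hX.dist_le_len_add h2 b.hi
      linarith
    · rw [subdivision_len_lo h2.ne, h1]
      have := hX.dist_le_len_add h2 b.lo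
      linarith

theorem exists_subdivision_walk {a b : X.BoolPair} (h : X.subdivision.le a b) :
    ∃ w : X.subdivision.graph.Walk a b, (w.edges.map X.subdivision.len).sum =
      (X.dist b.lo a.lo + X.dist a.hi b.hi) / 2 := by
  induction h with
  | refl => exact ⟨.nil, by simp [hX.dist_self]⟩
  | @tail b c hab hl ih =>
    have h' := le_of_subdivision_le hab
    rcases hl with ⟨h1, h2⟩ | ⟨h1, h2⟩
    · obtain ⟨w, hw⟩ := exists_walk_edges_map_append _ ih (Or.inl ⟨h1, hX.low_adj h2⟩)
        (subdivision_len_hi h1)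
      refine ⟨w, hw.trans ?_⟩
      rw [← h1, hX.dist_le_add h'.2 (le_of_low h2), hX.dist_adj (hX.low_adj h2)]
      ring
    · obtain ⟨w, hw⟩ := exists_walk_edges_map_append _ ih (Or.inr ⟨h1, (hX.low_adj h2).symm⟩)
        (subdivision_len_lo (hX.low_adj h2).ne')
      refine ⟨w, hw.trans ?_⟩
      rw [← h1, hX.dist_le_add (le_of_low h2) h'.1, hX.dist_adj (hX.low_adj h2), Sym2.eq_swap]
      ring

/-! ### Neighborhood semilattices -/

theorem nbhd_lo_le {z : V} (a : X.Nbhd z) : X.le a.1.lo z :=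
  (hX.subdivision_isBoolean_iff.1 a.2).1

theorem nbhd_le_hi {z : V} (a : X.Nbhd z) : X.le z a.1.hi :=
  (hX.subdivision_isBoolean_iff.1 a.2).2

theorem nbhd_complemented {z : V} (a : X.Nbhd z) : X.IsComplemented a.1.lo a.1.hi :=
  hX.isBoolean_iff.1 a.1.2

theorem exists_nbhd {z p q : V} (h : X.IsComplemented p q) (hp : X.le p z) (hq : X.le z q) :
    ∃ a : X.Nbhd z, a.1.lo = p ∧ a.1.hi = q :=
  ⟨⟨⟨(p, q), hX.isBoolean_iff.2 h⟩, hX.subdivision_isBoolean_iff.2 ⟨hp, hq⟩⟩, rfl, rfl⟩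

theorem nbhd_le_iff {z : V} {a b : X.Nbhd z} :
    a ≤ b ↔ X.le b.1.lo a.1.lo ∧ X.le a.1.hi b.1.hi := hX.subdivision_le_iff

theorem nbhdVal_eq {z : V} (a : X.Nbhd z) :
    X.nbhdVal z a = (X.dist a.1.lo z + X.dist z a.1.hi) / 2 := by
  obtain ⟨w, hw⟩ := hX.exists_subdivision_walk
    (a := X.diag z) (b := a.1) (hX.subdivision_le_iff.2 ⟨hX.nbhd_lo_le a, hX.nbhd_le_hi a⟩)
  have hw' : (w.reverse.edges.map X.subdivision.len).sum =
      (X.dist a.1.lo z + X.dist z a.1.hi) / 2 := by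
    rw [SimpleGraph.Walk.edges_reverse, List.map_reverse, List.sum_reverse, hw]
    rfl
  have hle : ∀ w : X.subdivision.graph.Walk a.1 (X.diag z),
      (X.dist a.1.lo z + X.dist z a.1.hi) / 2 ≤ (w.edges.map X.subdivision.len).sum := fun w => by
    have := hX.le_subdivision_walk w
    rw [hX.dist_comm z]
    exact this
  unfold nbhdVal dist pathDist
  have : Nonempty (X.subdivision.graph.Walk a.1 (X.diag z)) := ⟨w.reverse⟩
  exact _root_.le_antisymm (le_of_le_of_eq
    (ciInf_le ⟨_, by rintro _ ⟨q, rfl⟩; exact hle q⟩ w.reverse) hw') (le_ciInf hle)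

theorem nbhd_antisymm {z : V} {a b : X.Nbhd z} (h₁ : a ≤ b) (h₂ : b ≤ a) : a = b := by
  rw [hX.nbhd_le_iff] at h₁ h₂
  exact Subtype.ext (BoolPair.ext (hX.le_antisymm h₂.1 h₁.1) (hX.le_antisymm h₁.2 h₂.2))

/-- The order is inclusion of intervals, so the lower ends are joined and the upper ends met. -/
theorem nbhd_isGLB {z : V} {a b m : X.Nbhd z} (h₁ : X.IsJoin a.1.lo b.1.lo m.1.lo)
    (h₂ : X.IsMeet a.1.hi b.1.hi m.1.hi) : IsGLB {a, b} m := by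
  simp only [isGLB_pair_iff, hX.nbhd_le_iff]
  exact ⟨⟨h₁.1, h₂.1⟩, ⟨h₁.2.1, h₂.2.1⟩, fun c h h' =>
    ⟨h₁.2.2 _ h.1 h'.1, h₂.2.2 _ h.2 h'.2⟩⟩

theorem nbhd_isLUB {z : V} {a b j : X.Nbhd z} (h₁ : X.IsMeet a.1.lo b.1.lo j.1.lo)
    (h₂ : X.IsJoin a.1.hi b.1.hi j.1.hi) : IsLUB {a, b} j := by
  simp only [isLUB_pair_iff, hX.nbhd_le_iff]
  exact ⟨⟨h₁.1, h₂.1⟩, ⟨h₁.2.1, h₂.2.1⟩, fun c h h' =>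
    ⟨h₁.2.2 _ h.1 h'.1, h₂.2.2 _ h.2 h'.2⟩⟩

theorem nbhd_exists_glb {z : V} (a b : X.Nbhd z) : ∃ m : X.Nbhd z,
    X.IsJoin a.1.lo b.1.lo m.1.lo ∧ X.IsMeet a.1.hi b.1.hi m.1.hi := by
  obtain ⟨j, hj, hjz⟩ := hX.exists_join (hX.nbhd_lo_le a) (hX.nbhd_lo_le b)
  obtain ⟨m, hm, hzm⟩ := hX.exists_meet (hX.nbhd_le_hi a) (hX.nbhd_le_hi b)
  obtain ⟨c, rfl, rfl⟩ := hX.exists_nbhd (hX.complemented_sub (hX.nbhd_complemented a) hj.1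
    (le_trans hjz hzm) hm.1) hjz hzm
  exact ⟨c, hj, hm⟩

theorem nbhd_exists_lub {z : V} {a b t : X.Nbhd z} (ha : a ≤ t) (hb : b ≤ t) : ∃ j : X.Nbhd z,
    X.IsMeet a.1.lo b.1.lo j.1.lo ∧ X.IsJoin a.1.hi b.1.hi j.1.hi := by
  rw [hX.nbhd_le_iff] at ha hb
  obtain ⟨j, hj, hjt⟩ := hX.exists_join ha.2 hb.2
  obtain ⟨m, hm, htm⟩ := hX.exists_meet ha.1 hb.1
  have hmz := le_trans hm.1 (hX.nbhd_lo_le a)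
  have hzj := le_trans (hX.nbhd_le_hi a) hj.1
  obtain ⟨c, rfl, rfl⟩ := hX.exists_nbhd (hX.complemented_sub (hX.nbhd_complemented t) htm
    (le_trans hmz hzj) hjt) hmz hzj
  exact ⟨c, hm, hj⟩

theorem nbhd_isGLB_iff {z : V} {a b m : X.Nbhd z} :
    IsGLB {a, b} m ↔ X.IsJoin a.1.lo b.1.lo m.1.lo ∧ X.IsMeet a.1.hi b.1.hi m.1.hi := by
  refine ⟨fun h => ?_, fun h => hX.nbhd_isGLB h.1 h.2⟩
  obtain ⟨m', h'⟩ := hX.nbhd_exists_glb a b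
  have h'' := hX.nbhd_isGLB h'.1 h'.2
  obtain rfl := hX.nbhd_antisymm (h''.2 h.1) (h.2 h''.1)
  exact h'

theorem nbhd_isLUB_iff {z : V} {a b j : X.Nbhd z} :
    IsLUB {a, b} j ↔ X.IsMeet a.1.lo b.1.lo j.1.lo ∧ X.IsJoin a.1.hi b.1.hi j.1.hi := by
  refine ⟨fun h => ?_, fun h => hX.nbhd_isLUB h.1 h.2⟩
  obtain ⟨m', h'⟩ := hX.nbhd_exists_lub (h.1 (Set.mem_insert a {b}))
    (h.1 (Set.mem_insert_of_mem a rfl))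
  have h'' := hX.nbhd_isLUB h'.1 h'.2
  obtain rfl := hX.nbhd_antisymm (h''.2 h.1) (h.2 h''.1)
  exact h'

theorem nbhd_isValuation (z : V) : IsValuation (X.nbhdVal z) where
  strictMono a b hab := by
    have h := hX.nbhd_le_iff.1 hab.le
    rw [hX.nbhdVal_eq, hX.nbhdVal_eq, hX.dist_le_add h.1 (hX.nbhd_lo_le a),
      hX.dist_le_add (hX.nbhd_le_hi a) h.2]
    have h1 := hX.dist_nonneg b.1.lo a.1.lo
    have h2 := hX.dist_nonneg a.1.hi b.1.hi
    by_cases e : b.1.lo = a.1.lo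
    · have e' : a.1.hi ≠ b.1.hi := fun e' => hab.ne (Subtype.ext (BoolPair.ext e.symm e'))
      have := hX.dist_pos e'
      linarith
    · have := hX.dist_pos e
      linarith
  modular a b m j hm hj := by
    rw [hX.nbhd_isGLB_iff] at hm
    rw [hX.nbhd_isLUB_iff] at hj
    simp only [hX.nbhdVal_eq]
    have e1 := hX.dist_meet_join hj.1 hm.1
    have e2 := hX.dist_meet_join hm.2 hj.2
    rw [hX.dist_le_add hj.1.1 (hX.nbhd_lo_le a), hX.dist_le_add hm.1.2.1 (hX.nbhd_lo_le m),
      hX.dist_le_add (hX.nbhd_le_hi b) hj.2.2.1, hX.dist_le_add (hX.nbhd_le_hi m) hm.2.1]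
    linarith

end IsModularComplex

end Complex

/-- A meet-semilattice with a positive valuation satisfies the modular law. -/
theorem IsValuation.modular_law {L : Type*} [Preorder L] {v : L → ℝ} (hv : IsValuation v)
    (hanti : ∀ a b : L, a ≤ b → b ≤ a → a = b)
    (hmeet : ∀ a b : L, ∃ m, IsGLB {a, b} m)
    (hjoin : ∀ a b t : L, a ≤ t → b ≤ t → ∃ j, IsLUB {a, b} j)
    {a b c t : L} (hac : a ≤ c) (hct : c ≤ t) (hbt : b ≤ t) {m j x y : L}
    (hm : IsGLB {b, c} m) (hx : IsLUB {a, m} x) (hj : IsLUB {a, b} j) (hy : IsGLB {j, c} y) :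
    x = y := by
  obtain ⟨n, hn⟩ := hmeet a b
  obtain ⟨k, hk⟩ := hjoin b c t hbt hct
  have hm' := isGLB_pair_iff.1 hm
  have hx' := isLUB_pair_iff.1 hx
  have hj' := isLUB_pair_iff.1 hj
  have hy' := isGLB_pair_iff.1 hy
  have hn' := isGLB_pair_iff.1 hn
  have hk' := isLUB_pair_iff.1 hk
  -- This inequality always holds; four valuation identities give `v x = v y`, and strictness
  -- concludes.
  have hxy : x ≤ y := hy'.2.2 _ (hx'.2.2 _ hj'.1 (hm'.1.trans hj'.2.1)) (hx'.2.2 _ hac hm'.2.1)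
  have e1 := hv.modular _ _ _ _ hm hk
  have e2 := hv.modular _ _ _ _ hn hj
  have e3 := hv.modular a m n x (isGLB_pair_iff.2 ⟨hn'.1, hm'.2.2 _ hn'.2.1 (hn'.1.trans hac),
    fun d h1 h2 => hn'.2.2 _ h1 (h2.trans hm'.1)⟩) hx
  have e4 := hv.modular j c y k hy (isLUB_pair_iff.2 ⟨hj'.2.2 _ (hac.trans hk'.2.1) hk'.1,
    hk'.2.1, fun d h1 h2 => hk'.2.2 _ (hj'.2.1.trans h1) h2⟩)
  by_contra hne
  have := hv.strictMono (lt_of_le_not_ge hxy fun h => hne (hanti _ _ hxy h))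
  linarith

namespace Complex.IsModularComplex

variable {V : Type*} {X : Complex V} (hX : X.IsModularComplex)
include hX

theorem nbhd_isModularSemilattice (z : V) : IsModularSemilattice (X.Nbhd z) where
  antisymm _ _ := hX.nbhd_antisymm
  exists_zero := by
    have hc : X.IsComplemented z z := hX.isBoolean_iff.1 (X.isBoolean_refl z)
    obtain ⟨c, h1, h2⟩ := hX.exists_nbhd hc (le_refl z) (le_refl z)
    refine ⟨c, fun a => hX.nbhd_le_iff.2 ?_⟩
    rw [h1, h2]
    exact ⟨hX.nbhd_lo_le a, hX.nbhd_le_hi a⟩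
  exists_meet a b := by
    obtain ⟨m, hm⟩ := hX.nbhd_exists_glb a b
    exact ⟨m, hX.nbhd_isGLB hm.1 hm.2⟩
  exists_join a b t ha hb := by
    obtain ⟨j, hj⟩ := hX.nbhd_exists_lub ha hb
    exact ⟨j, hX.nbhd_isLUB hj.1 hj.2⟩
  modular_law a b c t hac hct hbt m j x y hm hx hj hy := by
    refine (hX.nbhd_isValuation z).modular_law (fun _ _ => hX.nbhd_antisymm) (fun a b => ?_)
      (fun a b t ha hb => ?_) hac hct hbt hm hx hj hy
    · obtain ⟨m, hm⟩ := hX.nbhd_exists_glb a b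
      exact ⟨m, hX.nbhd_isGLB hm.1 hm.2⟩
    · obtain ⟨j, hj⟩ := hX.nbhd_exists_lub ha hb
      exact ⟨j, hX.nbhd_isLUB hj.1 hj.2⟩
  exists_join₃ a b c := by
    rintro ⟨x, hx⟩ ⟨y, hy⟩ ⟨w, hw⟩
    rw [hX.nbhd_isLUB_iff] at hx hy hw
    obtain ⟨j, hj⟩ := hX.exists_join₃ hx.2 hy.2 hw.2
    obtain ⟨m, hm⟩ := hX.op.exists_join₃ (op_isJoin.2 hx.1) (op_isJoin.2 hy.1) (op_isJoin.2 hw.1)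
    rw [op_isJoin] at hm
    -- the pairs formed by `m` and the upper parts of `a`, `b`, `c` are Boolean
    have hmx : X.IsMeet x.1.lo w.1.lo m := ⟨hm.1, hw.1.2.2 _ hm.2.1 (le_trans hm.1 hx.1.1),
      fun d h1 h2 => hm.2.2 d h1 (le_trans h2 hw.1.1)⟩
    have hmy : X.IsMeet x.1.lo y.1.lo m := ⟨hm.1, hy.1.2.2 _ (le_trans hm.1 hx.1.2.1) hm.2.1,
      fun d h1 h2 => hm.2.2 d h1 (le_trans h2 hy.1.2.1)⟩
    have hmw : X.IsMeet y.1.lo w.1.lo m := ⟨hmy.2.1, hmx.2.1, fun d h1 h2 =>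
      hm.2.2 d (hx.1.2.2 _ (le_trans h2 hw.1.2.1) (le_trans h1 hy.1.1)) (le_trans h2 hw.1.1)⟩
    have ca : X.IsComplemented m a.1.hi := hX.complemented_meet
      (hX.complemented_lower (hX.nbhd_complemented x)
        (le_trans (hX.nbhd_lo_le x) (hX.nbhd_le_hi a)) hx.2.1)
      (hX.complemented_lower (hX.nbhd_complemented w)
        (le_trans (hX.nbhd_lo_le w) (hX.nbhd_le_hi a)) hw.2.2.1) hmx
    have cb : X.IsComplemented m b.1.hi := hX.complemented_meet
      (hX.complemented_lower (hX.nbhd_complemented x)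
        (le_trans (hX.nbhd_lo_le x) (hX.nbhd_le_hi b)) hx.2.2.1)
      (hX.complemented_lower (hX.nbhd_complemented y)
        (le_trans (hX.nbhd_lo_le y) (hX.nbhd_le_hi b)) hy.2.1) hmy
    have cc : X.IsComplemented m c.1.hi := hX.complemented_meet
      (hX.complemented_lower (hX.nbhd_complemented y)
        (le_trans (hX.nbhd_lo_le y) (hX.nbhd_le_hi c)) hy.2.2.1)
      (hX.complemented_lower (hX.nbhd_complemented w)
        (le_trans (hX.nbhd_lo_le w) (hX.nbhd_le_hi c)) hw.2.1) hmw
    obtain ⟨t, ht1, ht2⟩ := hX.exists_nbhd (complemented_join (complemented_join ca cb hx.2) cc hj)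
      (le_trans hm.1 (hX.nbhd_lo_le x)) (le_trans (hX.nbhd_le_hi x) hj.1)
    refine ⟨t, ?_, ?_⟩
    · rintro d (rfl | rfl | rfl) <;> rw [hX.nbhd_le_iff, ht1, ht2]
      · exact ⟨le_trans hm.1 hx.1.1, le_trans hx.2.1 hj.1⟩
      · exact ⟨le_trans hm.1 hx.1.2.1, le_trans hx.2.2.1 hj.1⟩
      · exact ⟨hm.2.1, hj.2.1⟩
    · intro d hd
      have ha := hX.nbhd_le_iff.1 (hd (by simp : a ∈ _))
      have hb := hX.nbhd_le_iff.1 (hd (by simp : b ∈ _))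
      have hc := hX.nbhd_le_iff.1 (hd (by simp : c ∈ _))
      rw [hX.nbhd_le_iff, ht1, ht2]
      exact ⟨hm.2.2 _ (hx.1.2.2 _ ha.1 hb.1) hc.1, hj.2.2 _ (hx.2.2.2 _ ha.2 hb.2) hc.2⟩

end Complex.IsModularComplex

/-! ### Products of modular complexes. -/

namespace Complex

variable {V V' : Type*} {X : Complex V} {X' : Complex V'}

theorem prod_adj {a b : V × V'} : (X.prod X').graph.Adj a b ↔
    (X.graph.Adj a.1 b.1 ∧ a.2 = b.2) ∨ (X'.graph.Adj a.2 b.2 ∧ a.1 = b.1) :=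
  SimpleGraph.boxProd_adj

/-- The shape of the 4-cycles of a product. -/
theorem prod_fourCycle {u v v' u' : V × V'} (h : IsFourCycle (X.prod X').graph u v v' u') :
    (u.2 = v.2 ∧ u'.2 = v'.2 ∧ ((u.1 = u'.1 ∧ v.1 = v'.1) ∨
      IsFourCycle X.graph u.1 v.1 v'.1 u'.1)) ∨
    (u.1 = v.1 ∧ u'.1 = v'.1 ∧ ((u.2 = u'.2 ∧ v.2 = v'.2) ∨
      IsFourCycle X'.graph u.2 v.2 v'.2 u'.2)) := by
  obtain ⟨h1, h2, h3, h4, h5, h6⟩ := h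
  rw [prod_adj] at h1 h2 h3 h4
  rw [Ne, Prod.ext_iff] at h5 h6
  unfold IsFourCycle
  rcases h1 with ⟨h1, e1⟩ | ⟨h1, e1⟩ <;> rcases h2 with ⟨h2, e2⟩ | ⟨h2, e2⟩ <;>
    rcases h3 with ⟨h3, e3⟩ | ⟨h3, e3⟩ <;> rcases h4 with ⟨h4, e4⟩ | ⟨h4, e4⟩ <;>
    have n1 := h1.ne <;> have n2 := h2.ne <;> have n3 := h3.ne <;> have n4 := h4.ne <;> grind

theorem prod_low {a b : V × V'} : (X.prod X').low a b ↔
    (X.low a.1 b.1 ∧ a.2 = b.2) ∨ (a.1 = b.1 ∧ X'.low a.2 b.2) := Iff.rfl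

theorem prod_len_left {a b : V × V'} (h : a.2 = b.2) :
    (X.prod X').len s(a, b) = X.len s(a.1, b.1) := if_pos h

theorem prod_len_right {a b : V × V'} (h : a.2 ≠ b.2) :
    (X.prod X').len s(a, b) = X'.len s(a.2, b.2) := if_neg h

theorem prod_le {a b : V × V'} : (X.prod X').le a b ↔ X.le a.1 b.1 ∧ X'.le a.2 b.2 := by
  constructor
  · intro h
    induction h with
    | refl => exact ⟨le_refl _, le_refl _⟩
    | tail _ hl ih =>
      rcases hl with ⟨h1, h2⟩ | ⟨h1, h2⟩
      · exact ⟨le_trans ih.1 (le_of_low h1), h2 ▸ ih.2⟩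
      · exact ⟨h1 ▸ ih.1, le_trans ih.2 (le_of_low h2)⟩
  · rintro ⟨h1, h2⟩
    have k1 : (X.prod X').le a (b.1, a.2) :=
      Relation.ReflTransGen.lift (r := X.low) (fun x => (x, a.2))
        (fun _ _ h => Or.inl ⟨h, rfl⟩) _ _ h1
    have k2 : (X.prod X').le (b.1, a.2) b :=
      Relation.ReflTransGen.lift (r := X'.low) (fun x => (b.1, x))
        (fun _ _ h => Or.inr ⟨rfl, h⟩) _ _ h2
    exact le_trans k1 k2

theorem prod_isMeet {a b m : V × V'} :
    (X.prod X').IsMeet a b m ↔ X.IsMeet a.1 b.1 m.1 ∧ X'.IsMeet a.2 b.2 m.2 := by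
  simp only [IsMeet, prod_le]
  constructor
  · rintro ⟨⟨h1, h2⟩, ⟨h3, h4⟩, h5⟩
    exact ⟨⟨h1, h3, fun c hc hc' => (h5 (c, m.2) ⟨hc, h2⟩ ⟨hc', h4⟩).1⟩,
      ⟨h2, h4, fun c hc hc' => (h5 (m.1, c) ⟨h1, hc⟩ ⟨h3, hc'⟩).2⟩⟩
  · rintro ⟨⟨h1, h3, h5⟩, h2, h4, h6⟩
    exact ⟨⟨h1, h2⟩, ⟨h3, h4⟩, fun c hc hc' => ⟨h5 _ hc.1 hc'.1, h6 _ hc.2 hc'.2⟩⟩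

theorem prod_isJoin {a b m : V × V'} :
    (X.prod X').IsJoin a b m ↔ X.IsJoin a.1 b.1 m.1 ∧ X'.IsJoin a.2 b.2 m.2 := by
  simp only [IsJoin, prod_le]
  constructor
  · rintro ⟨⟨h1, h2⟩, ⟨h3, h4⟩, h5⟩
    exact ⟨⟨h1, h3, fun c hc hc' => (h5 (c, m.2) ⟨hc, h2⟩ ⟨hc', h4⟩).1⟩,
      ⟨h2, h4, fun c hc hc' => (h5 (m.1, c) ⟨h1, hc⟩ ⟨h3, hc'⟩).2⟩⟩
  · rintro ⟨⟨h1, h3, h5⟩, h2, h4, h6⟩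
    exact ⟨⟨h1, h2⟩, ⟨h3, h4⟩, fun c hc hc' => ⟨h5 _ hc.1 hc'.1, h6 _ hc.2 hc'.2⟩⟩

theorem prod_isComplemented {p q : V × V'} : (X.prod X').IsComplemented p q ↔
    X.IsComplemented p.1 q.1 ∧ X'.IsComplemented p.2 q.2 := by
  constructor
  · rintro ⟨hle, h⟩
    rw [prod_le] at hle
    refine ⟨⟨hle.1, fun c hc hqc => ?_⟩, ⟨hle.2, fun c hc hqc => ?_⟩⟩
    -- With the second coordinate at its top, a missed atom must move the first one.
    · obtain ⟨a, ha | ha, haq, hac⟩ := h (c, q.2) (prod_le.2 ⟨hc, hle.2⟩)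
        (fun h' => hqc (prod_le.1 h').1) <;> rw [prod_le] at haq hac
      · exact ⟨a.1, ha.1, haq.1, fun h' => hac ⟨h', haq.2⟩⟩
      · refine absurd ⟨?_, haq.2⟩ hac
        rw [← ha.1]
        exact hc
    · obtain ⟨a, ha | ha, haq, hac⟩ := h (q.1, c) (prod_le.2 ⟨hle.1, hc⟩)
        (fun h' => hqc (prod_le.1 h').2) <;> rw [prod_le] at haq hac
      · refine absurd ⟨haq.1, ?_⟩ hac
        rw [← ha.2]
        exact hc
      · exact ⟨a.2, ha.2, haq.2, fun h' => hac ⟨haq.1, h'⟩⟩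
  · rintro ⟨⟨h1, h2⟩, h3, h4⟩
    refine ⟨prod_le.2 ⟨h1, h3⟩, fun c hc hqc => ?_⟩
    rw [prod_le] at hc hqc
    by_cases hq : X.le q.1 c.1
    · obtain ⟨a, ha, haq, hac⟩ := h4 c.2 hc.2 fun h' => hqc ⟨hq, h'⟩
      exact ⟨(p.1, a), Or.inr ⟨rfl, ha⟩, prod_le.2 ⟨h1, haq⟩, fun h' => hac (prod_le.1 h').2⟩
    · obtain ⟨a, ha, haq, hac⟩ := h2 c.1 hc.1 hq
      exact ⟨(a, p.2), Or.inl ⟨ha, rfl⟩, prod_le.2 ⟨haq, h3⟩, fun h' => hac (prod_le.1 h').1⟩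

namespace IsModularComplex

variable (hX : X.IsModularComplex) (hX' : X'.IsModularComplex)
include hX hX'

theorem gdist_prod (a b : V × V') :
    (X.prod X').gdist a b = X.gdist a.1 b.1 + X'.gdist a.2 b.2 := by
  have h := SimpleGraph.edist_boxProd (G := X.graph) (H := X'.graph) a b
  have hc : (X.graph □ X'.graph).Connected := hX.modular.connected.boxProd hX'.modular.connected
  rw [← (hX.modular.connected a.1 b.1).coe_dist_eq_edist,
    ← (hX'.modular.connected a.2 b.2).coe_dist_eq_edist, ← (hc a b).coe_dist_eq_edist] at h
  exact_mod_cast h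

theorem prod : (X.prod X').IsModularComplex where
  modular :=
    { connected := hX.modular.connected.boxProd hX'.modular.connected
      exists_median := fun x y z => by
        obtain ⟨m, h1, h2, h3⟩ := hX.exists_median x.1 y.1 z.1
        obtain ⟨n, k1, k2, k3⟩ := hX'.exists_median x.2 y.2 z.2
        have e := hX.gdist_prod hX'
        unfold Btw at *
        refine ⟨(m, n), ?_, ?_, ?_⟩
        all_goals
          change (X.prod X').gdist _ _ + (X.prod X').gdist _ _ = (X.prod X').gdist _ _
          simp only [e]
          omega }
  adj_iff p q := by
    rw [prod_adj, prod_low, prod_low, hX.adj_iff, hX'.adj_iff]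
    grind
  not_both p q := by
    rw [prod_low, prod_low]
    have h1 := hX.not_both p.1 q.1
    have h2 := hX'.not_both p.2 q.2
    have h3 : ∀ x, ¬ X.low x x := fun x h => hX.not_both x x h h
    have h4 : ∀ x, ¬ X'.low x x := fun x h => hX'.not_both x x h h
    grind
  admissible u v v' u' h := by
    rw [prod_low, prod_low]
    have h3 : ∀ x, ¬ X.low x x := fun x h => hX.not_both x x h h
    have h4 : ∀ x, ¬ X'.low x x := fun x h => hX'.not_both x x h h
    rcases prod_fourCycle h with ⟨e1, e2, ⟨e3, e4⟩ | hc⟩ | ⟨e1, e2, ⟨e3, e4⟩ | hc⟩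
    · simp [e1, e2, e3, e4, h4]
    · simp [e1, e2, h4, hX.admissible _ _ _ _ hc]
    · simp [e1, e2, e3, e4, h3]
    · simp [e1, e2, h3, hX'.admissible _ _ _ _ hc]
  len_pos e := by
    induction e with
    | h a b =>
      intro h
      rcases prod_adj.1 h with ⟨h1, h2⟩ | ⟨h1, h2⟩
      · rw [prod_len_left h2]
        exact hX.len_pos _ h1
      · rw [prod_len_right h1.ne]
        exact hX'.len_pos _ h1
  len_orbit e _ e' he' h := by
    clear he'
    induction h with
    | refl => rfl
    | tail _ ho ih =>
      refine ih.trans ?_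
      obtain ⟨u, v, v', u', hc, rfl, rfl⟩ := ho
      have hadj := hc.1
      have hadj' := hc.2.2.1
      rw [prod_adj] at hadj hadj'
      rcases prod_fourCycle hc with ⟨e1, e2, hc⟩ | ⟨e1, e2, hc⟩
      · rw [prod_len_left e1, prod_len_left e2.symm]
        rcases hc with ⟨e3, e4⟩ | hc
        · rw [e3, e4, Sym2.eq_swap]
        · exact hX.len_orbit _ hc.1 _ hc.2.2.1
            (Relation.ReflTransGen.single ⟨_, _, _, _, hc, rfl, rfl⟩)
      · have n1 : u.2 ≠ v.2 := by
          rcases hadj with h | h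
          · exact absurd e1 h.1.ne
          · exact h.1.ne
        have n2 : v'.2 ≠ u'.2 := by
          rcases hadj' with h | h
          · exact absurd e2.symm h.1.ne
          · exact h.1.ne
        rw [prod_len_right n1, prod_len_right n2]
        rcases hc with ⟨e3, e4⟩ | hc
        · rw [e3, e4, Sym2.eq_swap]
        · exact hX'.len_orbit _ hc.1 _ hc.2.2.1
            (Relation.ReflTransGen.single ⟨_, _, _, _, hc, rfl, rfl⟩)

theorem dist_prod_left (a b : V) (r : V') : (X.prod X').dist (a, r) (b, r) = X.dist a b := by
  obtain ⟨k, hk⟩ : ∃ k, X.gdist a b = k := ⟨_, rfl⟩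
  induction k generalizing a with
  | zero =>
    obtain rfl := hX.eq_of_gdist_eq_zero hk
    rw [hX.dist_self, (hX.prod hX').dist_self]
  | succ k ih =>
    obtain ⟨c, hc, hb⟩ := hX.exists_next (a := a) (b := b) (by rintro rfl; simp at hk)
    have hb' : (X.prod X').Btw (a, r) (c, r) (b, r) := by
      unfold Btw at *
      simpa [hX.gdist_prod hX'] using hb
    have e := gdist_eq_one hc
    have hadj : (X.prod X').graph.Adj (a, r) (c, r) := prod_adj.2 (Or.inl ⟨hc, rfl⟩)
    rw [← hX.dist_btw hb, ← (hX.prod hX').dist_btw hb', ih c (by unfold Btw at hb; omega),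
      hX.dist_adj hc, (hX.prod hX').dist_adj hadj,
      prod_len_left (a := (a, r)) (b := (c, r)) rfl]

theorem dist_prod_right (r : V) (a b : V') :
    (X.prod X').dist (r, a) (r, b) = X'.dist a b := by
  obtain ⟨k, hk⟩ : ∃ k, X'.gdist a b = k := ⟨_, rfl⟩
  induction k generalizing a with
  | zero =>
    obtain rfl := hX'.eq_of_gdist_eq_zero hk
    rw [hX'.dist_self, (hX.prod hX').dist_self]
  | succ k ih =>
    obtain ⟨c, hc, hb⟩ := hX'.exists_next (a := a) (b := b) (by rintro rfl; simp at hk)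
    have hb' : (X.prod X').Btw (r, a) (r, c) (r, b) := by
      unfold Btw at *
      simpa [hX.gdist_prod hX'] using hb
    have e := gdist_eq_one hc
    have hadj : (X.prod X').graph.Adj (r, a) (r, c) := prod_adj.2 (Or.inr ⟨hc, rfl⟩)
    rw [← hX'.dist_btw hb, ← (hX.prod hX').dist_btw hb', ih c (by unfold Btw at hb; omega),
      hX'.dist_adj hc, (hX.prod hX').dist_adj hadj,
      prod_len_right (a := (r, a)) (b := (r, c)) hc.ne]

theorem dist_prod (a b : V × V') :
    (X.prod X').dist a b = X.dist a.1 b.1 + X'.dist a.2 b.2 := by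
  have hb : (X.prod X').Btw (a.1, a.2) (b.1, a.2) (b.1, b.2) := by
    unfold Btw
    simp [hX.gdist_prod hX']
  have := (hX.prod hX').dist_btw hb
  rw [hX.dist_prod_left hX', hX.dist_prod_right hX'] at this
  exact this.symm

end IsModularComplex

end Complex

/-! ### The distance on neighborhood semilattices of the square of the complex. -/

namespace Complex.IsModularComplex

variable {V : Type*} {X : Complex V} (hX : X.IsModularComplex)
include hX

/-- The asymmetry is deliberate: from `m₁`, `m₂`, the pair `p` is reached by moving the second
coordinate first, the pair `q` by moving the first one first. By `gate_mono`, both truncations in a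
coordinate then lie below a single gate. -/
theorem exists_gate_meets {m₁ m₂ p₁ p₂ q₁ q₂ : V} (hp₁ : X.le m₁ p₁) (hp₂ : X.le m₂ p₂)
    (hq₁ : X.le m₁ q₁) (hq₂ : X.le m₂ q₂) : ∃ g₁ g₂ a₁ a₂ b₁ b₂,
    X.IsGate m₁ p₂ g₁ ∧ X.IsGate m₂ q₁ g₂ ∧
    (X.le m₁ a₁ ∧ X.le a₁ p₁ ∧ X.le a₁ g₁) ∧ (X.le m₂ a₂ ∧ X.le a₂ p₂ ∧ X.le a₂ g₂) ∧
    (X.le m₁ b₁ ∧ X.le b₁ q₁ ∧ X.le b₁ g₁) ∧ (X.le m₂ b₂ ∧ X.le b₂ q₂ ∧ X.le b₂ g₂) ∧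
    X.dist p₁ p₂ = X.dist m₁ m₂ + (X.dist m₁ p₁ - 2 * X.dist m₁ a₁) +
      (X.dist m₂ p₂ - 2 * X.dist m₂ a₂) ∧
    X.dist q₁ q₂ = X.dist m₁ m₂ + (X.dist m₁ q₁ - 2 * X.dist m₁ b₁) +
      (X.dist m₂ q₂ - 2 * X.dist m₂ b₂) := by
  obtain ⟨g₁, hg₁⟩ := hX.exists_upGate m₁ p₂
  obtain ⟨g₂, hg₂⟩ := hX.exists_upGate m₂ q₁
  obtain ⟨k₁, hk₁⟩ := hX.exists_upGate m₁ m₂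
  obtain ⟨k₂, hk₂⟩ := hX.exists_upGate m₂ m₁
  have h₁ := hX.gate_mono hk₁ hg₁ hp₂
  have h₂ := hX.gate_mono hk₂ hg₂ hq₁
  obtain ⟨a₁, ha₁, ma₁⟩ := hX.exists_meet hp₁ hg₁.1
  obtain ⟨a₂, ha₂, ma₂⟩ := hX.exists_meet hp₂ hk₂.1
  obtain ⟨b₁, hb₁, mb₁⟩ := hX.exists_meet hq₁ hk₁.1
  obtain ⟨b₂, hb₂, mb₂⟩ := hX.exists_meet hq₂ hg₂.1
  have e := hX.dist_gate_gate hq₂ hq₁ hg₂ hk₁ hb₂ hb₁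
  rw [hX.dist_comm q₂, hX.dist_comm m₂ m₁] at e
  exact ⟨g₁, g₂, a₁, a₂, b₁, b₂, hg₁, hg₂, ⟨ma₁, ha₁.1, ha₁.2.1⟩,
    ⟨ma₂, ha₂.1, le_trans ha₂.2.1 h₂⟩, ⟨mb₁, hb₁.1, le_trans hb₁.2.1 h₁⟩, ⟨mb₂, hb₂.1, hb₂.2.1⟩,
    hX.dist_gate_gate hp₁ hp₂ hg₁ hk₂ ha₁ ha₂, by linarith⟩

theorem btw_of_le_gate {m z g a : V} (hg : X.IsGate m z g) (hma : X.le m a) (hag : X.le a g) :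
    X.Btw z a m :=
  (hX.btw_trans (hg.2 m (le_refl m)) (hX.btw_of_le hma hag).symm).1

/-- Boolean pairs around `(m₀, m₁)` that point towards a Boolean pair `(z₀, z₁)` are below a common
Boolean pair. -/
theorem exists_complemented_bound {z₀ z₁ m₀ m₁ g₀ g₁ a₀ a₁ b₀ b₁ : V}
    (hz : X.IsComplemented z₀ z₁) (hm : X.le m₀ m₁)
    (hg₀ : X.op.IsGate m₀ z₀ g₀) (hg₁ : X.IsGate m₁ z₁ g₁)
    (ha : X.IsComplemented a₀ a₁) (hb : X.IsComplemented b₀ b₁)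
    (ha₀ : X.le g₀ a₀ ∧ X.le a₀ m₀) (hb₀ : X.le g₀ b₀ ∧ X.le b₀ m₀)
    (ha₁ : X.le m₁ a₁ ∧ X.le a₁ g₁) (hb₁ : X.le m₁ b₁ ∧ X.le b₁ g₁) :
    ∃ t₀ t₁, X.IsComplemented t₀ t₁ ∧ X.le t₀ a₀ ∧ X.le t₀ b₀ ∧ X.le a₁ t₁ ∧ X.le b₁ t₁ := by
  have lo : ∀ {c}, X.le g₀ c ∧ X.le c m₀ → X.Btw z₀ c m₀ := fun h =>
    hX.op.btw_of_le_gate hg₀ (op_le.2 h.2) (op_le.2 h.1)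
  have hi : ∀ {c}, X.le m₁ c ∧ X.le c g₁ → X.Btw z₁ c m₁ := fun h =>
    hX.btw_of_le_gate hg₁ h.1 h.2
  have ha' := hX.complemented_lower ha (le_trans ha₀.2 hm) ha₁.1
  have ha'' := hX.complemented_raise ha ha₀.2 (le_trans hm ha₁.1)
  have hb' := hX.complemented_lower hb (le_trans hb₀.2 hm) hb₁.1
  have hb'' := hX.complemented_raise hb hb₀.2 (le_trans hm hb₁.1)
  -- The mixed intervals are complemented by extension; joins of upper ends and meets of lower ends
  -- preserve this.
  have hab := hX.complemented_extend hz hm ha₀.2 hb₁.1 ha' hb'' (lo ha₀) (hi hb₁)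
  have hba := hX.complemented_extend hz hm hb₀.2 ha₁.1 hb' ha'' (lo hb₀) (hi ha₁)
  obtain ⟨t₁, ht₁, _⟩ := hX.exists_join ha₁.2 hb₁.2
  obtain ⟨t₀, ht₀, _⟩ := hX.exists_meet ha₀.1 hb₀.1
  exact ⟨t₀, t₁, hX.complemented_meet (complemented_join ha hab ht₁)
    (complemented_join hba hb ht₁) ht₀, ht₀.1, ht₀.2.1, ht₁.1, ht₁.2.1⟩

theorem nbhdVal_sub {z : V} {m a : X.Nbhd z} (h : m ≤ a) : X.nbhdVal z a - X.nbhdVal z m =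
    (X.dist m.1.lo a.1.lo + X.dist m.1.hi a.1.hi) / 2 := by
  rw [hX.nbhd_le_iff] at h
  rw [hX.nbhdVal_eq, hX.nbhdVal_eq, hX.dist_le_add h.1 (hX.nbhd_lo_le m),
    hX.dist_le_add (hX.nbhd_le_hi m) h.2, hX.dist_comm m.1.lo a.1.lo]
  ring

/-- Upper and lower ends are treated separately, the lower ones in the reversed orientation. -/
theorem lovasz_dist_submodular {z : V × V} {p q m j : (X.prod X).Nbhd z}
    (hm : IsGLB {p, q} m) (hj : IsLUB {p, q} j) :
    (X.prod X).lovasz (fun a => X.dist a.1 a.2) m.1 +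
      (X.prod X).lovasz (fun a => X.dist a.1 a.2) j.1 ≤
    (X.prod X).lovasz (fun a => X.dist a.1 a.2) p.1 +
      (X.prod X).lovasz (fun a => X.dist a.1 a.2) q.1 := by
  rw [(hX.prod hX).nbhd_isGLB_iff, prod_isJoin, prod_isMeet] at hm
  rw [(hX.prod hX).nbhd_isLUB_iff, prod_isJoin, prod_isMeet] at hj
  have h1 := hX.dist_submodular hm.2.1 hj.2.1 hm.2.2 hj.2.2
  have h2 := hX.op.dist_submodular (op_isMeet.2 hm.1.1) (op_isJoin.2 hj.1.1)
    (op_isMeet.2 hm.1.2) (op_isJoin.2 hj.1.2)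
  change X.dist _ _ + X.dist _ _ ≤ X.dist _ _ + X.dist _ _ at h2
  simp only [lovasz]
  linarith

theorem lovasz_dist_antipodal {z : V × V} {p q m : (X.prod X).Nbhd z} {w₁ w₂ : ℝ}
    (hm : IsGLB {p, q} m)
    (hw : w₁ * ((X.prod X).nbhdVal z p - (X.prod X).nbhdVal z m) =
      w₂ * ((X.prod X).nbhdVal z q - (X.prod X).nbhdVal z m))
    (hanti : ∀ a b, m ≤ a → a ≤ p → m ≤ b → b ≤ q → (∃ t, a ≤ t ∧ b ≤ t) →
      w₁ * ((X.prod X).nbhdVal z a - (X.prod X).nbhdVal z m) +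
        w₂ * ((X.prod X).nbhdVal z b - (X.prod X).nbhdVal z m) ≤
      w₁ * ((X.prod X).nbhdVal z p - (X.prod X).nbhdVal z m)) :
    (w₁ + w₂) * (X.prod X).lovasz (fun a => X.dist a.1 a.2) m.1 ≤
      w₁ * (X.prod X).lovasz (fun a => X.dist a.1 a.2) p.1 +
        w₂ * (X.prod X).lovasz (fun a => X.dist a.1 a.2) q.1 := by
  have hY := hX.prod hX
  have hGLB := isGLB_pair_iff.1 hm
  rw [hY.nbhd_isGLB_iff, prod_isJoin, prod_isMeet] at hm
  obtain ⟨⟨mlo₁, mlo₂⟩, mhi₁, mhi₂⟩ := hm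
  obtain ⟨g₁, g₂, a₁, a₂, b₁, b₂, hg₁, hg₂, ha₁, ha₂, hb₁, hb₂, ep, eq⟩ :=
    hX.exists_gate_meets mhi₁.1 mhi₂.1 mhi₁.2.1 mhi₂.2.1
  obtain ⟨k₁, k₂, c₁, c₂, d₁, d₂, hk₁, hk₂, hc₁, hc₂, hd₁, hd₂, ep', eq'⟩ :=
    hX.op.exists_gate_meets (op_le.2 mlo₁.1) (op_le.2 mlo₂.1) (op_le.2 mlo₁.2.1)
      (op_le.2 mlo₂.2.1)
  simp only [op_le] at hc₁ hc₂ hd₁ hd₂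
  change X.dist _ _ = X.dist _ _ + (X.dist _ _ - 2 * X.dist _ _) +
    (X.dist _ _ - 2 * X.dist _ _) at ep' eq'
  have cp := prod_isComplemented.1 (hY.nbhd_complemented p)
  have cq := prod_isComplemented.1 (hY.nbhd_complemented q)
  have mle := prod_le.1 m.1.lo_le_hi
  have mlo := prod_le.1 (hY.nbhd_lo_le m)
  have mhi := prod_le.1 (hY.nbhd_le_hi m)
  have ca₁ := hX.complemented_sub cp.1 hc₁.2.1 (le_trans hc₁.1 (le_trans mle.1 ha₁.1)) ha₁.2.1
  have ca₂ := hX.complemented_sub cp.2 hc₂.2.1 (le_trans hc₂.1 (le_trans mle.2 ha₂.1)) ha₂.2.1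
  have cb₁ := hX.complemented_sub cq.1 hd₁.2.1 (le_trans hd₁.1 (le_trans mle.1 hb₁.1)) hb₁.2.1
  have cb₂ := hX.complemented_sub cq.2 hd₂.2.1 (le_trans hd₂.1 (le_trans mle.2 hb₂.1)) hb₂.2.1
  -- In the first coordinate the lower and upper gates come from the ends of one Boolean pair, the
  -- second coordinate of `p`; below, the first coordinate of `q` plays this role.
  obtain ⟨s₁, t₁, ct₁, s₁c, s₁d, at₁, bt₁⟩ := hX.exists_complemented_bound cp.2 mle.1 hk₁ hg₁ ca₁
    cb₁ ⟨hc₁.2.2, hc₁.1⟩ ⟨hd₁.2.2, hd₁.1⟩ ⟨ha₁.1, ha₁.2.2⟩ ⟨hb₁.1, hb₁.2.2⟩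
  obtain ⟨s₂, t₂, ct₂, s₂c, s₂d, at₂, bt₂⟩ := hX.exists_complemented_bound cq.1 mle.2 hk₂ hg₂ ca₂
    cb₂ ⟨hc₂.2.2, hc₂.1⟩ ⟨hd₂.2.2, hd₂.1⟩ ⟨ha₂.1, ha₂.2.2⟩ ⟨hb₂.1, hb₂.2.2⟩
  obtain ⟨A, hAlo, hAhi⟩ := hY.exists_nbhd (z := z) (p := (c₁, c₂)) (q := (a₁, a₂))
    (prod_isComplemented.2 ⟨ca₁, ca₂⟩)
    (prod_le.2 ⟨le_trans hc₁.1 mlo.1, le_trans hc₂.1 mlo.2⟩)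
    (prod_le.2 ⟨le_trans mhi.1 ha₁.1, le_trans mhi.2 ha₂.1⟩)
  obtain ⟨B, hBlo, hBhi⟩ := hY.exists_nbhd (z := z) (p := (d₁, d₂)) (q := (b₁, b₂))
    (prod_isComplemented.2 ⟨cb₁, cb₂⟩)
    (prod_le.2 ⟨le_trans hd₁.1 mlo.1, le_trans hd₂.1 mlo.2⟩)
    (prod_le.2 ⟨le_trans mhi.1 hb₁.1, le_trans mhi.2 hb₂.1⟩)
  obtain ⟨T, hTlo, hThi⟩ := hY.exists_nbhd (z := z) (p := (s₁, s₂)) (q := (t₁, t₂))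
    (prod_isComplemented.2 ⟨ct₁, ct₂⟩)
    (prod_le.2 ⟨le_trans s₁c (le_trans hc₁.1 mlo.1), le_trans s₂c (le_trans hc₂.1 mlo.2)⟩)
    (prod_le.2 ⟨le_trans mhi.1 (le_trans ha₁.1 at₁), le_trans mhi.2 (le_trans ha₂.1 at₂)⟩)
  have mA : m ≤ A := by
    rw [hY.nbhd_le_iff, prod_le, prod_le, hAlo, hAhi]
    exact ⟨⟨hc₁.1, hc₂.1⟩, ha₁.1, ha₂.1⟩
  have mB : m ≤ B := by
    rw [hY.nbhd_le_iff, prod_le, prod_le, hBlo, hBhi]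
    exact ⟨⟨hd₁.1, hd₂.1⟩, hb₁.1, hb₂.1⟩
  have Ap : A ≤ p := by
    rw [hY.nbhd_le_iff, prod_le, prod_le, hAlo, hAhi]
    exact ⟨⟨hc₁.2.1, hc₂.2.1⟩, ha₁.2.1, ha₂.2.1⟩
  have Bq : B ≤ q := by
    rw [hY.nbhd_le_iff, prod_le, prod_le, hBlo, hBhi]
    exact ⟨⟨hd₁.2.1, hd₂.2.1⟩, hb₁.2.1, hb₂.2.1⟩
  have AT : A ≤ T := by
    rw [hY.nbhd_le_iff, prod_le, prod_le, hAlo, hAhi, hTlo, hThi]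
    exact ⟨⟨s₁c, s₂c⟩, at₁, at₂⟩
  have BT : B ≤ T := by
    rw [hY.nbhd_le_iff, prod_le, prod_le, hBlo, hBhi, hTlo, hThi]
    exact ⟨⟨s₁d, s₂d⟩, bt₁, bt₂⟩
  have key := hanti A B mA Ap mB Bq ⟨T, AT, BT⟩
  have vA := hY.nbhdVal_sub mA
  have vB := hY.nbhdVal_sub mB
  have vp := hY.nbhdVal_sub hGLB.1
  have vq := hY.nbhdVal_sub hGLB.2.1
  rw [hX.dist_prod hX, hX.dist_prod hX, hAlo, hAhi] at vA
  rw [hX.dist_prod hX, hX.dist_prod hX, hBlo, hBhi] at vB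
  rw [hX.dist_prod hX, hX.dist_prod hX] at vp vq
  -- Each of the four components of `A` enters with factor -2 by the gate formula.
  have fp : (X.prod X).lovasz (fun a => X.dist a.1 a.2) p.1 =
      (X.prod X).lovasz (fun a => X.dist a.1 a.2) m.1 +
        ((X.prod X).nbhdVal z p - (X.prod X).nbhdVal z m) -
        2 * ((X.prod X).nbhdVal z A - (X.prod X).nbhdVal z m) := by
    simp only [lovasz]
    rw [ep, ep', vA, vp]
    ring
  have fq : (X.prod X).lovasz (fun a => X.dist a.1 a.2) q.1 =
      (X.prod X).lovasz (fun a => X.dist a.1 a.2) m.1 +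
        ((X.prod X).nbhdVal z q - (X.prod X).nbhdVal z m) -
        2 * ((X.prod X).nbhdVal z B - (X.prod X).nbhdVal z m) := by
    simp only [lovasz]
    rw [eq, eq', vB, vq]
    ring
  rw [fp, fq]
  linarith

end Complex.IsModularComplex

/-! ### Metric intervals of modular semilattices -/

section Inf

variable {L : Type*} [SemilatticeInf L] {v : L → ℝ}

theorem isGLB_inf' (a b : L) : IsGLB {a, b} (a ⊓ b) :=
  isGLB_pair_iff.2 ⟨inf_le_left, inf_le_right, fun _ => le_inf⟩

theorem meet_eq_inf (a b : L) : meet a b = a ⊓ b := by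
  have h : ∃ m, IsGLB {a, b} m := ⟨_, isGLB_inf' a b⟩
  rw [meet, dif_pos h]
  exact h.choose_spec.unique (isGLB_inf' a b)

theorem IsValuation.mono (hv : IsValuation v) {a b : L} (h : a ≤ b) : v a ≤ v b :=
  hv.strictMono.monotone h

theorem IsValuation.eq_of_le (hv : IsValuation v) {a b : L} (h : a ≤ b) (h' : v b ≤ v a) :
    a = b := by
  by_contra hne
  exact (hv.strictMono (lt_of_le_of_ne h hne)).not_ge h'

omit [SemilatticeInf L] in
theorem valLen_mk (v : L → ℝ) (a b : L) : valLen v s(a, b) = |v a - v b| := rfl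

theorem exists_hasse_walk [Finite L] (hv : IsValuation v) {a b : L} (h : a ≤ b) :
    ∃ w : (SimpleGraph.hasse L).Walk a b, (w.edges.map (valLen v)).sum = v b - v a := by
  induction b using WellFoundedLT.induction with
  | _ b ih =>
    rcases h.eq_or_lt with rfl | hlt
    · exact ⟨.nil, by simp⟩
    · obtain ⟨c, hac, hcb⟩ := exists_le_covBy_of_lt hlt
      obtain ⟨w, hw⟩ := ih c hcb.lt hac
      have hadj : (SimpleGraph.hasse L).Adj c b := Or.inl hcb
      refine ⟨w.append (.cons hadj .nil), ?_⟩
      have := hv.mono hcb.le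
      simp only [SimpleGraph.Walk.edges_append, SimpleGraph.Walk.edges_cons,
        SimpleGraph.Walk.edges_nil, List.map_append, List.map_cons, List.map_nil, List.sum_append,
        List.sum_cons, List.sum_nil, hw, valLen_mk]
      rw [abs_of_nonpos (by linarith)]
      ring

/-- An upward step from `a` to `c` raises the value of the meet with `b` by at most `v c - v a`,
because `a ∨ (c ⊓ b) ≤ c`. -/
theorem valDist_le_walk (hv : IsValuation v)
    (hjoin : ∀ a b t : L, a ≤ t → b ≤ t → ∃ j, IsLUB {a, b} j) {a b : L}
    (w : (SimpleGraph.hasse L).Walk a b) :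
    v a + v b - 2 * v (a ⊓ b) ≤ (w.edges.map (valLen v)).sum := by
  induction w with
  | nil => simp only [inf_idem, SimpleGraph.Walk.edges_nil, List.map_nil, List.sum_nil]; linarith
  | @cons a c b h w ih =>
    simp only [SimpleGraph.Walk.edges_cons, List.map_cons, List.sum_cons, valLen_mk]
    rcases h with h | h
    · obtain ⟨j, hj⟩ := hjoin a (c ⊓ b) c h.le inf_le_left
      have e := hv.modular _ _ _ _ (isGLB_inf' _ _) hj
      rw [← inf_assoc, inf_eq_left.2 h.le] at e
      have h1 := hv.mono ((isLUB_pair_iff.1 hj).2.2 c h.le inf_le_left)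
      have h2 := neg_abs_le (v a - v c)
      linarith
    · have h1 := hv.mono (inf_le_inf_right b h.le)
      have h2 := le_abs_self (v a - v c)
      linarith

theorem valDist_eq [Finite L] (hv : IsValuation v)
    (hjoin : ∀ a b t : L, a ≤ t → b ≤ t → ∃ j, IsLUB {a, b} j) (a b : L) :
    valDist v a b = v a + v b - 2 * v (a ⊓ b) := by
  obtain ⟨w₁, hw₁⟩ := exists_hasse_walk hv (inf_le_left : a ⊓ b ≤ a)
  obtain ⟨w₂, hw₂⟩ := exists_hasse_walk hv (inf_le_right : a ⊓ b ≤ b)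
  have hw : ((w₁.reverse.append w₂).edges.map (valLen v)).sum = v a + v b - 2 * v (a ⊓ b) := by
    simp only [SimpleGraph.Walk.edges_append, SimpleGraph.Walk.edges_reverse, List.map_append,
      List.map_reverse, List.sum_append, List.sum_reverse, hw₁, hw₂]
    ring
  unfold valDist pathDist
  have : Nonempty ((SimpleGraph.hasse L).Walk a b) := ⟨w₁.reverse.append w₂⟩
  exact le_antisymm (le_of_le_of_eq
    (ciInf_le ⟨_, by rintro _ ⟨q, rfl⟩; exact valDist_le_walk hv hjoin q⟩ _) hw)
    (le_ciInf (valDist_le_walk hv hjoin))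

theorem mem_interval_iff [Finite L] (hv : IsValuation v)
    (hjoin : ∀ a b t : L, a ≤ t → b ≤ t → ∃ j, IsLUB {a, b} j) {p q u : L} :
    u ∈ interval v p q ↔ v (u ⊓ p) + v (u ⊓ q) = v u + v (p ⊓ q) := by
  rw [interval, Set.mem_ofPred_eq, valDist_eq hv hjoin, valDist_eq hv hjoin, valDist_eq hv hjoin,
    inf_comm p u]
  constructor <;> intro h <;> linarith

/-- `u` lies in the metric interval of `p` and `q`, in terms of the valuation. -/
def InInterval (v : L → ℝ) (p q u : L) : Prop := v (u ⊓ p) + v (u ⊓ q) = v u + v (p ⊓ q)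

theorem InInterval.symm {p q u : L} (h : InInterval v p q u) : InInterval v q p u := by
  unfold InInterval at *
  rw [inf_comm q p]
  linarith

theorem inInterval_left (v : L → ℝ) (p q : L) : InInterval v p q p := by
  simp [InInterval]

/-- In the valuation identity for `u ⊓ p` and `u ⊓ q`, the join is at most `u` and the meet at most
`p ⊓ q`; membership in the interval forces both equalities. -/
theorem InInterval.isLUB (hv : IsValuation v)
    (hjoin : ∀ a b t : L, a ≤ t → b ≤ t → ∃ j, IsLUB {a, b} j) {p q u : L}
    (h : InInterval v p q u) : IsLUB {u ⊓ p, u ⊓ q} u ∧ p ⊓ q ≤ u := by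
  obtain ⟨j, hj⟩ := hjoin (u ⊓ p) (u ⊓ q) u inf_le_left inf_le_left
  have e := hv.modular _ _ _ _ (isGLB_inf' _ _) hj
  have hju := (isLUB_pair_iff.1 hj).2.2 u inf_le_left inf_le_left
  have hm : u ⊓ p ⊓ (u ⊓ q) = u ⊓ (p ⊓ q) := by
    rw [inf_inf_inf_comm, inf_idem]
  rw [hm] at e
  have h1 := hv.mono hju
  have h2 := hv.mono (inf_le_right : u ⊓ (p ⊓ q) ≤ p ⊓ q)
  unfold InInterval at h
  have h3 := hv.eq_of_le hju (by linarith)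
  have h4 := hv.eq_of_le (inf_le_right : u ⊓ (p ⊓ q) ≤ p ⊓ q) (by linarith)
  exact ⟨h3 ▸ hj, inf_eq_right.1 h4⟩

theorem inInterval_of_isLUB (hv : IsValuation v) {p q a b u : L}
    (ha : p ⊓ q ≤ a) (hap : a ≤ p) (hb : p ⊓ q ≤ b) (hbq : b ≤ q) (hu : IsLUB {a, b} u) :
    InInterval v p q u ∧ u ⊓ p = a ∧ u ⊓ q = b := by
  have hu' := isLUB_pair_iff.1 hu
  have hab : a ⊓ b = p ⊓ q := le_antisymm (inf_le_inf hap hbq) (le_inf ha hb)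
  have e := hv.modular _ _ _ _ (isGLB_inf' a b) hu
  rw [hab] at e
  have k1 : u ⊓ p = a := by
    have h1 : u ⊓ p ⊓ b = p ⊓ q := le_antisymm
      (inf_le_inf inf_le_right hbq) (le_inf (le_inf (ha.trans hu'.1) inf_le_left) hb)
    have h2 : IsLUB {u ⊓ p, b} u := isLUB_pair_iff.2 ⟨inf_le_left, hu'.2.1,
      fun c hc hc' => hu'.2.2 c ((le_inf hu'.1 hap).trans hc) hc'⟩
    have e1 := hv.modular _ _ _ _ (isGLB_inf' _ _) h2
    rw [h1] at e1
    exact (hv.eq_of_le (le_inf hu'.1 hap) (by linarith)).symm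
  have k2 : u ⊓ q = b := by
    have h1 : u ⊓ q ⊓ a = p ⊓ q := le_antisymm
      (le_inf (inf_le_right.trans hap) (inf_le_left.trans inf_le_right))
      (le_inf (le_inf (ha.trans hu'.1) inf_le_right) ha)
    have h2 : IsLUB {u ⊓ q, a} u := isLUB_pair_iff.2 ⟨inf_le_left, hu'.1,
      fun c hc hc' => hu'.2.2 c hc' ((le_inf hu'.2.1 hbq).trans hc)⟩
    have e1 := hv.modular _ _ _ _ (isGLB_inf' _ _) h2
    rw [h1] at e1
    exact (hv.eq_of_le (le_inf hu'.2.1 hbq) (by linarith)).symm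
  exact ⟨by unfold InInterval; rw [k1, k2]; linarith, k1, k2⟩

/-- The part of an interval element above its projection to `q` stays in the interval. -/
theorem InInterval.of_le (hv : IsValuation v)
    (hjoin : ∀ a b t : L, a ≤ t → b ≤ t → ∃ j, IsLUB {a, b} j) {p q u w : L}
    (h : InInterval v p q u) (hwu : w ≤ u) (hw : u ⊓ q ≤ w) :
    InInterval v p q w ∧ w ⊓ q = u ⊓ q := by
  have hu := h.isLUB hv hjoin
  have h1 : w ⊓ q = u ⊓ q := le_antisymm (inf_le_inf_right q hwu) (le_inf hw inf_le_right)
  have h2 : w ⊓ (u ⊓ p) = w ⊓ p := by rw [← inf_assoc, inf_eq_left.2 hwu]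
  have h3 : IsLUB {w, u ⊓ p} u := isLUB_pair_iff.2 ⟨hwu, inf_le_left,
    fun c hc hc' => (isLUB_pair_iff.1 hu.1).2.2 c hc' (hw.trans hc)⟩
  have e := hv.modular _ _ _ _ (isGLB_inf' _ _) h3
  rw [h2] at e
  unfold InInterval at *
  rw [h1]
  exact ⟨by linarith, rfl⟩

/-- Uncrossing: meet of the projections to `p`, join of those to `q`. The triple join axiom applies,
the pairs being bounded by `u`, `q` and `u'`. With the mirrored version, total weighted value is
preserved. -/
theorem InInterval.exchange (hv : IsValuation v)
    (hjoin : ∀ a b t : L, a ≤ t → b ≤ t → ∃ j, IsLUB {a, b} j)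
    (hjoin₃ : ∀ a b c : L, (∃ j, IsLUB {a, b} j) → (∃ j, IsLUB {b, c} j) →
      (∃ j, IsLUB {c, a} j) → ∃ j, IsLUB {a, b, c} j) {p q u u' : L}
    (hu : InInterval v p q u) (hu' : InInterval v p q u') :
    ∃ s, InInterval v p q s ∧ s ⊓ p = u ⊓ p ⊓ (u' ⊓ p) ∧ u ⊓ q ≤ s ⊓ q ∧ u' ⊓ q ≤ s ⊓ q ∧
      v (s ⊓ q) = v (u ⊓ q) + v (u' ⊓ q) - v (u ⊓ q ⊓ (u' ⊓ q)) := by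
  have lu := (hu.isLUB hv hjoin).2
  have lu' := (hu'.isLUB hv hjoin).2
  obtain ⟨t, ht⟩ := hjoin₃ (u ⊓ p ⊓ (u' ⊓ p)) (u ⊓ q) (u' ⊓ q)
    (hjoin _ _ u (inf_le_left.trans inf_le_left) inf_le_left)
    (hjoin _ _ q inf_le_right inf_le_right)
    (hjoin _ _ u' inf_le_left (inf_le_right.trans inf_le_left))
  obtain ⟨j, hj⟩ := hjoin (u ⊓ q) (u' ⊓ q) q inf_le_right inf_le_right
  have hj' := isLUB_pair_iff.1 hj
  have ht1 : u ⊓ p ⊓ (u' ⊓ p) ≤ t := ht.1 (by simp)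
  have ht2 : u ⊓ q ≤ t := ht.1 (by simp)
  have ht3 : u' ⊓ q ≤ t := ht.1 (by simp)
  obtain ⟨s, hs⟩ := hjoin (u ⊓ p ⊓ (u' ⊓ p)) j t ht1 (hj'.2.2 t ht2 ht3)
  have key := inInterval_of_isLUB hv (p := p) (q := q)
    (le_inf (le_inf lu inf_le_left) (le_inf lu' inf_le_left))
    (inf_le_left.trans inf_le_right) ((le_inf lu inf_le_right).trans hj'.1)
    (hj'.2.2 q inf_le_right inf_le_right) hs
  have e := hv.modular _ _ _ _ (isGLB_inf' _ _) hj
  refine ⟨s, key.1, key.2.1, ?_, ?_, ?_⟩ <;> rw [key.2.2]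
  · exact hj'.1
  · exact hj'.2.1
  · linarith

/-- The values of `l` for which `u` maximizes the weighted valuation on the interval. -/
def argmaxSet (v : L → ℝ) (p q u : L) : Set ℝ :=
  {l ∈ Set.Icc 0 1 | ∀ u', InInterval v p q u' →
    (1 - l) * v (u' ⊓ p) + l * v (u' ⊓ q) ≤ (1 - l) * v (u ⊓ p) + l * v (u ⊓ q)}

theorem exists_mem_argmaxSet [Finite L] (v : L → ℝ) (p q : L) {l : ℝ} (hl : l ∈ Set.Icc (0 : ℝ) 1) :
    ∃ u, InInterval v p q u ∧ l ∈ argmaxSet v p q u := by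
  obtain ⟨u, hu, hmax⟩ := (Set.toFinite {u | InInterval v p q u}).exists_maximalFor
    (fun u => (1 - l) * v (u ⊓ p) + l * v (u ⊓ q)) _ ⟨p, inInterval_left v p q⟩
  refine ⟨u, hu, hl, fun u' hu' => ?_⟩
  by_contra hcon
  exact hcon (hmax hu' (not_le.1 hcon).le)

theorem argmaxSet_eq_Icc {p q u : L} (h : (argmaxSet v p q u).Nonempty) :
    ∃ l r, l ≤ r ∧ argmaxSet v p q u = Set.Icc l r := by
  have heq : argmaxSet v p q u = Set.Icc 0 1 ∩ ⋂ u' ∈ {u' | InInterval v p q u'},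
      {l : ℝ | (1 - l) * v (u' ⊓ p) + l * v (u' ⊓ q) ≤ (1 - l) * v (u ⊓ p) + l * v (u ⊓ q)} := by
    ext l
    simp [argmaxSet]
  have hcl : IsCompact (argmaxSet v p q u) := by
    rw [heq]
    refine isCompact_Icc.inter_right (isClosed_biInter fun u' _ => ?_)
    exact isClosed_le (by fun_prop) (by fun_prop)
  have hord : (argmaxSet v p q u).OrdConnected := by
    refine ⟨fun a ha b hb c hc => ⟨⟨ha.1.1.trans hc.1, hc.2.trans hb.1.2⟩, fun u' hu' => ?_⟩⟩
    have h1 := ha.2 u' hu'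
    have h2 := hb.2 u' hu'
    have h3 := hc.1
    have h4 := hc.2
    rcases h3.eq_or_lt with rfl | h3
    · exact h1
    · have k1 := mul_le_mul_of_nonneg_left h1 (sub_nonneg.2 h4)
      have k2 := mul_le_mul_of_nonneg_left h2 (sub_nonneg.2 h3.le)
      have : 0 < b - a := by linarith
      refine le_of_mul_le_mul_left ?_ this
      linarith
  have := eq_Icc_of_connected_compact ⟨h, hord.isPreconnected⟩ hcl
  refine ⟨_, _, ?_, this⟩
  rw [this, Set.nonempty_Icc] at h
  exact h

end Inf

/-! ### The measure of cones -/

section Cone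

theorem cos_add_sin_pos {θ : ℝ} (h : θ ∈ Set.Icc 0 (Real.pi / 2)) :
    0 < Real.cos θ + Real.sin θ := by
  have h1 := Real.cos_nonneg_of_mem_Icc ⟨by linarith [h.1, Real.pi_pos], h.2⟩
  have h2 := Real.sin_nonneg_of_nonneg_of_le_pi h.1 (by linarith [h.2, Real.pi_pos])
  rcases h1.eq_or_lt with h3 | h3
  · rcases h2.eq_or_lt with h4 | h4
    · have := Real.sin_sq_add_cos_sq θ
      rw [← h3, ← h4] at this
      norm_num at this
    · linarith
  · linarith

theorem slope_strictMonoOn : StrictMonoOn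
    (fun θ => Real.sin θ / (Real.cos θ + Real.sin θ)) (Set.Icc 0 (Real.pi / 2)) := by
  intro a ha b hb hab
  simp only
  rw [div_lt_div_iff₀ (cos_add_sin_pos ha) (cos_add_sin_pos hb)]
  have := Real.sin_pos_of_pos_of_lt_pi (sub_pos.2 hab) (by linarith [ha.1, hb.2, Real.pi_pos])
  rw [Real.sin_sub] at this
  linarith

theorem slope_mem_Icc {θ : ℝ} (h : θ ∈ Set.Icc 0 (Real.pi / 2)) :
    Real.sin θ / (Real.cos θ + Real.sin θ) ∈ Set.Icc (0 : ℝ) 1 := by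
  have h1 := Real.cos_nonneg_of_mem_Icc ⟨by linarith [h.1, Real.pi_pos], h.2⟩
  have h2 := Real.sin_nonneg_of_nonneg_of_le_pi h.1 (by linarith [h.2, Real.pi_pos])
  exact ⟨div_nonneg h2 (by linarith), div_le_one_of_le₀ (by linarith) (by linarith)⟩

theorem exists_slope_eq {l : ℝ} (hl : l ∈ Set.Icc (0 : ℝ) 1) : ∃ θ ∈ Set.Icc 0 (Real.pi / 2),
    Real.sin θ / (Real.cos θ + Real.sin θ) = l := by
  have hc : ContinuousOn (fun θ => Real.sin θ / (Real.cos θ + Real.sin θ))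
      (Set.Icc 0 (Real.pi / 2)) :=
    Real.continuous_sin.continuousOn.div (by fun_prop) fun θ hθ => (cos_add_sin_pos hθ).ne'
  have := intermediate_value_Icc (by linarith [Real.pi_pos] : (0 : ℝ) ≤ Real.pi / 2) hc
  simp only [Real.sin_zero, zero_div, Real.sin_pi_div_two, Real.cos_pi_div_two, zero_add,
    div_one] at this
  exact this hl

/-- Scaling a ray to coordinate sum 1 turns its angle into the weight appearing in [C], so that [C]
measures an interval of weights. -/
theorem mem_angles_iff {C : Set (ℝ × ℝ)} {S : Set ℝ}
    (hC : ∀ c > 0, ∀ w : ℝ × ℝ, (c * w.1, c * w.2) ∈ C ↔ w ∈ C)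
    (hS : ∀ l ∈ Set.Icc (0 : ℝ) 1, (1 - l, l) ∈ C ↔ l ∈ S) {θ : ℝ} :
    θ ∈ angles C ↔ θ ∈ Set.Icc 0 (Real.pi / 2) ∧
      Real.sin θ / (Real.cos θ + Real.sin θ) ∈ S := by
  unfold angles
  refine and_congr_right fun hθ => ?_
  have hpos := cos_add_sin_pos hθ
  rw [← hS _ (slope_mem_Icc hθ)]
  have h := hC _ hpos (1 - Real.sin θ / (Real.cos θ + Real.sin θ),
    Real.sin θ / (Real.cos θ + Real.sin θ))
  have e1 : (Real.cos θ + Real.sin θ) * (1 - Real.sin θ / (Real.cos θ + Real.sin θ)) =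
      Real.cos θ := by
    field_simp
    ring
  have e2 : (Real.cos θ + Real.sin θ) * (Real.sin θ / (Real.cos θ + Real.sin θ)) =
      Real.sin θ := by
    field_simp
  simp only [e1, e2] at h
  exact h

theorem coneVal_eq {C : Set (ℝ × ℝ)} {S : Set ℝ}
    (hC : ∀ c > 0, ∀ w : ℝ × ℝ, (c * w.1, c * w.2) ∈ C ↔ w ∈ C)
    (hS : ∀ l ∈ Set.Icc (0 : ℝ) 1, (1 - l, l) ∈ C ↔ l ∈ S)
    {l r : ℝ} (hlr : l ≤ r) (hl : 0 ≤ l) (hr : r ≤ 1) (h : S = Set.Icc l r) :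
    coneVal C = r - l := by
  obtain ⟨β, hβ, rfl⟩ := exists_slope_eq ⟨hl, hlr.trans hr⟩
  obtain ⟨α, hα, rfl⟩ := exists_slope_eq ⟨hl.trans hlr, hr⟩
  have hβα : β ≤ α := (slope_strictMonoOn.le_iff_le hβ hα).1 hlr
  have hang : angles C = Set.Icc β α := by
    ext θ
    rw [mem_angles_iff hC hS, h]
    constructor
    · rintro ⟨h1, h2, h3⟩
      exact ⟨(slope_strictMonoOn.le_iff_le hβ h1).1 h2, (slope_strictMonoOn.le_iff_le h1 hα).1 h3⟩
    · rintro ⟨h1, h2⟩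
      have hθ : θ ∈ Set.Icc 0 (Real.pi / 2) := ⟨hβ.1.trans h1, h2.trans hα.2⟩
      exact ⟨hθ, (slope_strictMonoOn.le_iff_le hβ hθ).2 h1,
        (slope_strictMonoOn.le_iff_le hθ hα).2 h2⟩
  simp only [coneVal, hang, csSup_Icc hβα, csInf_Icc hβα]

theorem coneVal_eq_zero {C : Set (ℝ × ℝ)}
    (hC : ∀ c > 0, ∀ w : ℝ × ℝ, (c * w.1, c * w.2) ∈ C ↔ w ∈ C)
    (hS : ∀ l ∈ Set.Icc (0 : ℝ) 1, (1 - l, l) ∈ C ↔ l ∈ (∅ : Set ℝ)) :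
    coneVal C = 0 := by
  have hang : angles C = ∅ := by
    ext θ
    rw [mem_angles_iff hC hS]
    simp
  simp [coneVal, hang]

end Cone

/-! ### Subdivisions of the unit interval -/

theorem exists_unit_subdivision (T : Finset ℝ) (h0 : 0 ∈ T) (h1 : 1 ∈ T)
    (hT : ∀ x ∈ T, x ∈ Set.Icc (0 : ℝ) 1) : ∃ (n : ℕ) (t : ℕ → ℝ), t 0 = 0 ∧ t (n + 1) = 1 ∧
      (∀ i j, i < j → j ≤ n + 1 → t i < t j) ∧ ∀ x ∈ T, ∃ i ≤ n + 1, t i = x := by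
  have hcard : 1 < T.card := Finset.one_lt_card.2 ⟨0, h0, 1, h1, zero_ne_one⟩
  obtain ⟨n, hn⟩ : ∃ n, T.card = n + 2 := ⟨T.card - 2, by omega⟩
  let e := T.orderEmbOfFin hn
  -- The cells run from `t 0` to `t (n + 1)`; the value past the last point is never used.
  let t : ℕ → ℝ := fun i => if h : i < n + 2 then e ⟨i, h⟩ else 0
  have ht : ∀ i (h : i < n + 2), t i = e ⟨i, h⟩ := fun i h => dif_pos h
  have hmono : ∀ i j, i < j → j ≤ n + 1 → t i < t j := fun i j hij hj => by
    rw [ht i (by omega), ht j (by omega)]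
    exact e.strictMono hij
  have hsurj : ∀ x ∈ T, ∃ i ≤ n + 1, t i = x := fun x hx => by
    have : x ∈ Set.range e := by
      rw [Finset.range_orderEmbOfFin]
      exact hx
    obtain ⟨i, hi⟩ := this
    exact ⟨i, by omega, (ht i i.2).trans hi⟩
  have hmem : ∀ i ≤ n + 1, t i ∈ Set.Icc (0 : ℝ) 1 := fun i hi => by
    rw [ht i (by omega)]
    exact hT _ (T.orderEmbOfFin_mem hn _)
  refine ⟨n, t, ?_, ?_, hmono, hsurj⟩
  · obtain ⟨i, hi, h⟩ := hsurj 0 h0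
    rcases Nat.eq_zero_or_pos i with rfl | hpos
    · exact h
    · have := hmono 0 i hpos hi
      have := (hmem 0 (by omega)).1
      linarith
  · obtain ⟨i, hi, h⟩ := hsurj 1 h1
    rcases hi.eq_or_lt with rfl | hlt
    · exact h
    · have := hmono i (n + 1) hlt le_rfl
      have := (hmem (n + 1) le_rfl).2
      linarith

/-! ### Envelopes -/

section Envelope

variable {L : Type*} [SemilatticeInf L] {v : L → ℝ} [Finite L]

theorem mem_normalCone_iff (hv : IsValuation v)
    (hjoin : ∀ a b t : L, a ≤ t → b ≤ t → ∃ j, IsLUB {a, b} j) {p q u : L} {w : ℝ × ℝ} :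
    w ∈ normalCone v p q u ↔ 0 ≤ w.1 ∧ 0 ≤ w.2 ∧ ∀ u', InInterval v p q u' →
      w.1 * v (u' ⊓ p) + w.2 * v (u' ⊓ q) ≤ w.1 * v (u ⊓ p) + w.2 * v (u ⊓ q) := by
  unfold normalCone
  simp only [Set.mem_ofPred_eq, mem_interval_iff hv hjoin, vec, meet_eq_inf]
  refine and_congr_right fun _ => and_congr_right fun _ => forall₂_congr fun u' _ => ?_
  constructor <;> intro h <;> linarith

theorem smul_mem_normalCone_iff (hv : IsValuation v)
    (hjoin : ∀ a b t : L, a ≤ t → b ≤ t → ∃ j, IsLUB {a, b} j) {p q u : L} :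
    ∀ c > 0, ∀ w : ℝ × ℝ, (c * w.1, c * w.2) ∈ normalCone v p q u ↔ w ∈ normalCone v p q u := by
  intro c hc w
  simp only [mem_normalCone_iff hv hjoin, mul_nonneg_iff_of_pos_left hc]
  refine and_congr_right fun _ => and_congr_right fun _ => forall₂_congr fun u' _ => ?_
  simp only [mul_assoc, ← mul_add]
  exact mul_le_mul_iff_right₀ hc

theorem mem_normalCone_iff_argmaxSet (hv : IsValuation v)
    (hjoin : ∀ a b t : L, a ≤ t → b ≤ t → ∃ j, IsLUB {a, b} j) {p q u : L} :
    ∀ l ∈ Set.Icc (0 : ℝ) 1, (1 - l, l) ∈ normalCone v p q u ↔ l ∈ argmaxSet v p q u := by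
  intro l hl
  rw [mem_normalCone_iff hv hjoin]
  exact ⟨fun h => ⟨hl, h.2.2⟩, fun h => ⟨sub_nonneg.2 hl.2, hl.1, h.2⟩⟩

theorem eq_zero_of_two_weights {l r a b : ℝ} (hlr : l < r) (h₁ : (1 - l) * a + l * b = 0)
    (h₂ : (1 - r) * a + r * b = 0) : a = 0 ∧ b = 0 := by
  have hne : r - l ≠ 0 := (sub_pos.2 hlr).ne'
  refine ⟨(mul_eq_zero.1 (?_ : (r - l) * a = 0)).resolve_left hne,
    (mul_eq_zero.1 (?_ : (r - l) * b = 0)).resolve_left hne⟩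
  · linear_combination r * h₁ - l * h₂
  · linear_combination (1 - l) * h₂ - (1 - r) * h₁

theorem le_of_mem_convI (hv : IsValuation v)
    (hjoin : ∀ a b t : L, a ≤ t → b ≤ t → ∃ j, IsLUB {a, b} j) {p q u : L} {l : ℝ}
    (hl : l ∈ argmaxSet v p q u) {z : ℝ × ℝ} (hz : z ∈ convI v p q) :
    (1 - l) * z.1 + l * z.2 ≤ (1 - l) * (vec v p q u).1 + l * (vec v p q u).2 := by
  have hlin : IsLinearMap ℝ (fun z : ℝ × ℝ => (1 - l) * z.1 + l * z.2) :=
    ⟨fun x y => by simp only [Prod.fst_add, Prod.snd_add]; ring,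
      fun c x => by simp only [Prod.smul_fst, Prod.smul_snd, smul_eq_mul]; ring⟩
  refine convexHull_min ?_ (convex_halfSpace_le hlin _) hz
  rintro _ ⟨u', hu', rfl⟩
  rw [mem_interval_iff hv hjoin] at hu'
  have := hl.2 u' hu'
  simp only [vec, meet_eq_inf, Set.mem_ofPred_eq]
  linarith

/-- Maximality for two weights puts the image of `u` on two non-parallel supporting lines, so it is
extreme; a nonzero nonnegative weight excludes translates by positive vectors. -/
theorem mem_envelope (hv : IsValuation v)
    (hjoin : ∀ a b t : L, a ≤ t → b ≤ t → ∃ j, IsLUB {a, b} j) {p q u : L}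
    (hu : InInterval v p q u) {l r : ℝ} (hlr : l < r) (hl : l ∈ argmaxSet v p q u)
    (hr : r ∈ argmaxSet v p q u) : u ∈ envelope v p q := by
  have hui : u ∈ interval v p q := (mem_interval_iff hv hjoin).2 hu
  refine ⟨hui, mem_extremePoints_iff_left.2
    ⟨subset_convexHull ℝ _ (Set.mem_image_of_mem _ hui), ?_⟩, ?_⟩
  · rintro x hx y hy ⟨a, b, ha, hb, hab, h⟩
    have hx1 := le_of_mem_convI hv hjoin hl hx
    have hx2 := le_of_mem_convI hv hjoin hr hx
    have hy1 := le_of_mem_convI hv hjoin hl hy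
    have hy2 := le_of_mem_convI hv hjoin hr hy
    rw [← h] at hx1 hx2 hy1 hy2 ⊢
    simp only [Prod.fst_add, Prod.snd_add, Prod.smul_fst, Prod.smul_snd, smul_eq_mul]
      at hx1 hx2 hy1 hy2
    obtain rfl : a = 1 - b := by linarith
    have k1 : (1 - l) * (x.1 - y.1) + l * (x.2 - y.2) = 0 := by
      refine le_antisymm ?_ ?_
      · refine le_of_mul_le_mul_left ?_ hb
        linarith
      · refine le_of_mul_le_mul_left ?_ ha
        linarith
    have k2 : (1 - r) * (x.1 - y.1) + r * (x.2 - y.2) = 0 := by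
      refine le_antisymm ?_ ?_
      · refine le_of_mul_le_mul_left ?_ hb
        linarith
      · refine le_of_mul_le_mul_left ?_ ha
        linarith
    obtain ⟨k3, k4⟩ := eq_zero_of_two_weights hlr k1 k2
    refine Prod.ext ?_ ?_ <;>
      simp only [Prod.fst_add, Prod.snd_add, Prod.smul_fst, Prod.smul_snd, smul_eq_mul]
    · linear_combination b * k3
    · linear_combination b * k4
  · intro ε h1 h2 hmem
    have := le_of_mem_convI hv hjoin hl hmem
    simp only [Prod.fst_add, Prod.snd_add] at this
    have hl0 := hl.1
    rcases hl0.1.eq_or_lt with h | h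
    · rw [← h] at this
      linarith
    · have k1 := mul_nonneg (sub_nonneg.2 hl0.2) h1.le
      have k2 := mul_pos h h2
      linarith

end Envelope

/-! ### The sweep over all weights. -/

section Sweep

variable {L : Type*} [SemilatticeInf L] {v : L → ℝ}

theorem argmaxSet_eq_value {p q u u' : L} (hu : InInterval v p q u) (hu' : InInterval v p q u')
    {l : ℝ} (h : l ∈ argmaxSet v p q u) (h' : l ∈ argmaxSet v p q u') :
    (1 - l) * v (u ⊓ p) + l * v (u ⊓ q) = (1 - l) * v (u' ⊓ p) + l * v (u' ⊓ q) :=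
  le_antisymm (h'.2 u hu) (h.2 u' hu')

/-- Maximizers for two different weights are unique. -/
theorem eq_of_mem_argmaxSet (hv : IsValuation v)
    (hjoin : ∀ a b t : L, a ≤ t → b ≤ t → ∃ j, IsLUB {a, b} j)
    (hjoin₃ : ∀ a b c : L, (∃ j, IsLUB {a, b} j) → (∃ j, IsLUB {b, c} j) →
      (∃ j, IsLUB {c, a} j) → ∃ j, IsLUB {a, b, c} j) {p q u u' : L}
    (hu : InInterval v p q u) (hu' : InInterval v p q u') {l r : ℝ} (hlr : l < r)
    (hl : l ∈ argmaxSet v p q u) (hr : r ∈ argmaxSet v p q u)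
    (hl' : l ∈ argmaxSet v p q u') (hr' : r ∈ argmaxSet v p q u') : u = u' := by
  -- The two uncrossed elements have the same total value as `u` and `u'`, so both are maximizers at
  -- both weights.
  obtain ⟨s, hs, hsp, -, -, hsq⟩ := hu.exchange hv hjoin hjoin₃ hu'
  obtain ⟨w, hw, hwq, -, -, hwp⟩ := hu.symm.exchange hv hjoin hjoin₃ hu'.symm
  have key : ∀ x, x ∈ argmaxSet v p q u → x ∈ argmaxSet v p q u' →
      (1 - x) * (v (u ⊓ p ⊓ (u' ⊓ p)) - v (u ⊓ p)) +
        x * (v (u' ⊓ q) - v (u ⊓ q ⊓ (u' ⊓ q))) = 0 := fun x hx hx' => by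
    have e1 := hx.2 s hs
    have e2 := hx.2 w hw.symm
    have e3 := argmaxSet_eq_value hu hu' hx hx'
    rw [hsp, hsq] at e1
    rw [hwp, hwq] at e2
    linarith
  obtain ⟨k1, k2⟩ := eq_zero_of_two_weights hlr (key l hl hl') (key r hr hr')
  have key' : ∀ x, x ∈ argmaxSet v p q u → x ∈ argmaxSet v p q u' →
      (1 - x) * (v (u ⊓ p) - v (u' ⊓ p)) + x * (v (u ⊓ q) - v (u' ⊓ q)) = 0 := fun x hx hx' => by
    have e3 := argmaxSet_eq_value hu hu' hx hx'
    linarith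
  obtain ⟨k3, k4⟩ := eq_zero_of_two_weights hlr (key' l hl hl') (key' r hr hr')
  have e1 := hv.eq_of_le (inf_le_left : u ⊓ p ⊓ (u' ⊓ p) ≤ u ⊓ p) (by linarith)
  have e2 := hv.eq_of_le (inf_le_right : u ⊓ p ⊓ (u' ⊓ p) ≤ u' ⊓ p) (by linarith)
  have e3 := hv.eq_of_le (inf_le_left : u ⊓ q ⊓ (u' ⊓ q) ≤ u ⊓ q) (by linarith)
  have e4 := hv.eq_of_le (inf_le_right : u ⊓ q ⊓ (u' ⊓ q) ≤ u' ⊓ q) (by linarith)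
  have h1 := (hu.isLUB hv hjoin).1
  rw [e1.symm.trans e2, e3.symm.trans e4] at h1
  exact h1.unique (hu'.isLUB hv hjoin).1

/-- As the weight grows, maximizers move from `p` to `q`. -/
theorem argmaxSet_mono (hv : IsValuation v)
    (hjoin : ∀ a b t : L, a ≤ t → b ≤ t → ∃ j, IsLUB {a, b} j)
    (hjoin₃ : ∀ a b c : L, (∃ j, IsLUB {a, b} j) → (∃ j, IsLUB {b, c} j) →
      (∃ j, IsLUB {c, a} j) → ∃ j, IsLUB {a, b, c} j) {p q u u' : L}
    (hu : InInterval v p q u) (hu' : InInterval v p q u') {l r : ℝ} (hlr : l < r)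
    (hl : l ∈ argmaxSet v p q u) (hr : r ∈ argmaxSet v p q u)
    (hr' : r ∈ argmaxSet v p q u') : u' ⊓ p ≤ u ⊓ p ∧ u ⊓ q ≤ u' ⊓ q := by
  obtain ⟨s, hs, hsp, -, -, hsq⟩ := hu.exchange hv hjoin hjoin₃ hu'
  obtain ⟨w, hw, hwq, -, hw', hwp⟩ := hu.symm.exchange hv hjoin hjoin₃ hu'.symm
  have e1 := hr.2 s hs
  have e3 := argmaxSet_eq_value hu hu' hr hr'
  rw [hsp, hsq] at e1
  have m1 := hv.mono (inf_le_right : u ⊓ p ⊓ (u' ⊓ p) ≤ u' ⊓ p)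
  have m2 := hv.mono (inf_le_left : u ⊓ q ⊓ (u' ⊓ q) ≤ u ⊓ q)
  -- The uncrossed element `w` is optimal at `r`. Having gained on the `p` side and lost on the `q`
  -- side, it is also optimal at the smaller `l`, so uniqueness gives `w = u`.
  have hge : (1 - r) * v (u ⊓ p) + r * v (u ⊓ q) ≤ (1 - r) * v (w ⊓ p) + r * v (w ⊓ q) := by
    rw [hwp, hwq]
    linarith
  have hge' : (1 - l) * v (u ⊓ p) + l * v (u ⊓ q) ≤ (1 - l) * v (w ⊓ p) + l * v (w ⊓ q) := by
    have n1 := mul_nonneg (sub_nonneg.2 hlr.le) (sub_nonneg.2 m1)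
    have n2 := mul_nonneg (sub_nonneg.2 hlr.le) (sub_nonneg.2 m2)
    rw [hwp, hwq] at hge ⊢
    linarith
  have := eq_of_mem_argmaxSet hv hjoin hjoin₃ hu hw.symm hlr hl hr
    ⟨hl.1, fun x hx => (hl.2 x hx).trans hge'⟩ ⟨hr.1, fun x hx => (hr.2 x hx).trans hge⟩
  refine ⟨?_, ?_⟩
  · rw [← this] at hw'
    exact hw'
  · rw [← this] at hwq
    rw [hwq]
    exact inf_le_right

/-- Consecutive maximizers form an antipodal pair. -/
theorem sweep_step (hv : IsValuation v)
    (hjoin : ∀ a b t : L, a ≤ t → b ≤ t → ∃ j, IsLUB {a, b} j)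
    {f : L → ℝ}
    (hsub : ∀ p q m j : L, IsGLB {p, q} m → IsLUB {p, q} j → f m + f j ≤ f p + f q)
    (hanti : ∀ (p q m : L) (w₁ w₂ : ℝ), IsGLB {p, q} m →
      w₁ * (v p - v m) = w₂ * (v q - v m) →
      (∀ a b, m ≤ a → a ≤ p → m ≤ b → b ≤ q → (∃ t, a ≤ t ∧ b ≤ t) →
        w₁ * (v a - v m) + w₂ * (v b - v m) ≤ w₁ * (v p - v m)) →
      (w₁ + w₂) * f m ≤ w₁ * f p + w₂ * f q)
    {p q u u' : L} (hu : InInterval v p q u) (hu' : InInterval v p q u') {r : ℝ}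
    (hr : r ∈ argmaxSet v p q u) (hr' : r ∈ argmaxSet v p q u') (hp : u' ⊓ p ≤ u ⊓ p)
    (hq : u ⊓ q ≤ u' ⊓ q) :
    f (u ⊓ q) + f u' ≤ f (u' ⊓ q) + ((1 - r) * f u + r * f u') := by
  have lu' := hu'.isLUB hv hjoin
  -- The meet of `u` and `u'` has projections `u' ⊓ p` and `u ⊓ q`.
  obtain ⟨he, heq⟩ := hu.of_le hv hjoin (w := u ⊓ u') inf_le_left
    (le_inf inf_le_left (hq.trans inf_le_left))
  obtain ⟨-, hep⟩ := hu'.symm.of_le hv hjoin (w := u ⊓ u') inf_le_right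
    (le_inf (hp.trans inf_le_left) inf_le_left)
  have ve : v (u' ⊓ p) + v (u ⊓ q) = v (u ⊓ u') + v (p ⊓ q) := by
    rw [← hep, ← heq]
    exact he
  have vu : v (u ⊓ p) + v (u ⊓ q) = v u + v (p ⊓ q) := hu
  have vu' : v (u' ⊓ p) + v (u' ⊓ q) = v u' + v (p ⊓ q) := hu'
  have hval := argmaxSet_eq_value hu hu' hr hr'
  have h1 : f (u ⊓ q) + f u' ≤ f (u' ⊓ q) + f (u ⊓ u') := by
    refine hsub _ _ _ _ ?_ ?_
    · refine isGLB_pair_iff.2 ⟨hq, le_inf inf_le_left (hq.trans inf_le_left), fun c h1 h2 => ?_⟩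
      exact le_inf (h2.trans inf_le_left) (h1.trans inf_le_right)
    · refine isLUB_pair_iff.2 ⟨inf_le_left, inf_le_right, fun c h1 h2 => ?_⟩
      exact (isLUB_pair_iff.1 lu'.1).2.2 c ((le_inf (hp.trans inf_le_left) inf_le_left).trans h2) h1
  have du : v u - v (u ⊓ u') = v (u ⊓ p) - v (u' ⊓ p) := by linarith
  have du' : v u' - v (u ⊓ u') = v (u' ⊓ q) - v (u ⊓ q) := by linarith
  have h2 := hanti u u' (u ⊓ u') (1 - r) r (isGLB_inf' u u') (by rw [du, du']; linarith) ?_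
  · linarith
  · rintro a b hea hau heb hbu ⟨t, hat, hbt⟩
    have ea : u ⊓ q ≤ u ⊓ u' := le_inf inf_le_left (hq.trans inf_le_left)
    have eb : u' ⊓ p ≤ u ⊓ u' := le_inf (hp.trans inf_le_left) inf_le_left
    obtain ⟨va, haq⟩ := hu.of_le hv hjoin hau (ea.trans hea)
    obtain ⟨vb, hbp⟩ := hu'.symm.of_le hv hjoin hbu (eb.trans heb)
    unfold InInterval at va vb
    rw [haq] at va
    rw [hbp, inf_comm q p] at vb
    -- Boundedness of `a`, `b` produces an interval element with these projections; optimality of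
    -- `u` at `r` tested on it is the antipodality condition.
    obtain ⟨c, hc⟩ := hjoin (a ⊓ p) (b ⊓ q) t (inf_le_left.trans hat) (inf_le_left.trans hbt)
    have hpe := (he.isLUB hv hjoin).2
    obtain ⟨hci, hcp, hcq⟩ := inInterval_of_isLUB hv (le_inf (hpe.trans hea) inf_le_left)
      inf_le_right (le_inf (hpe.trans heb) inf_le_right) inf_le_right hc
    have := hr.2 c hci
    rw [hcp, hcq] at this
    have da : v a - v (u ⊓ u') = v (a ⊓ p) - v (u' ⊓ p) := by linarith
    have db : v b - v (u ⊓ u') = v (b ⊓ q) - v (u ⊓ q) := by linarith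
    rw [du, da, db]
    linarith

variable [Finite L]

/-- A function that is submodular on pairs with joins and convex on antipodal pairs is
submodular. -/
theorem submodular_of_local (hv : IsValuation v)
    (hjoin : ∀ a b t : L, a ≤ t → b ≤ t → ∃ j, IsLUB {a, b} j)
    (hjoin₃ : ∀ a b c : L, (∃ j, IsLUB {a, b} j) → (∃ j, IsLUB {b, c} j) →
      (∃ j, IsLUB {c, a} j) → ∃ j, IsLUB {a, b, c} j)
    {f : L → ℝ}
    (hsub : ∀ p q m j : L, IsGLB {p, q} m → IsLUB {p, q} j → f m + f j ≤ f p + f q)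
    (hanti : ∀ (p q m : L) (w₁ w₂ : ℝ), IsGLB {p, q} m →
      w₁ * (v p - v m) = w₂ * (v q - v m) →
      (∀ a b, m ≤ a → a ≤ p → m ≤ b → b ≤ q → (∃ t, a ≤ t ∧ b ≤ t) →
        w₁ * (v a - v m) + w₂ * (v b - v m) ≤ w₁ * (v p - v m)) →
      (w₁ + w₂) * f m ≤ w₁ * f p + w₂ * f q) (p q : L) :
    f (meet p q) + ∑ᶠ u ∈ envelope v p q, coneVal (normalCone v p q u) * f u ≤ f p + f q := by
  have := Fintype.ofFinite L
  -- the endpoints of the intervals on which an element is a maximizer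
  let T : Finset ℝ := insert 0 (insert 1 ((Finset.univ.filter
    (fun u : L => (argmaxSet v p q u).Nonempty)).biUnion
      fun u => {sInf (argmaxSet v p q u), sSup (argmaxSet v p q u)}))
  have hIcc : ∀ u {l r : ℝ}, l ≤ r → argmaxSet v p q u = Set.Icc l r →
      0 ≤ l ∧ r ≤ 1 ∧ l ∈ T ∧ r ∈ T := fun u l r hlr h => by
    have h1 : l ∈ argmaxSet v p q u := h ▸ Set.left_mem_Icc.2 hlr
    have h2 : r ∈ argmaxSet v p q u := h ▸ Set.right_mem_Icc.2 hlr
    have h3 : l = sInf (argmaxSet v p q u) := by rw [h, csInf_Icc hlr]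
    have h4 : r = sSup (argmaxSet v p q u) := by rw [h, csSup_Icc hlr]
    refine ⟨h1.1.1, h2.1.2, ?_, ?_⟩ <;>
      refine Finset.mem_insert_of_mem (Finset.mem_insert_of_mem (Finset.mem_biUnion.2
        ⟨u, Finset.mem_filter.2 ⟨Finset.mem_univ _, l, h1⟩, ?_⟩))
    · rw [← h3]; exact Finset.mem_insert_self _ _
    · rw [← h4]; exact Finset.mem_insert_of_mem (Finset.mem_singleton_self _)
  obtain ⟨n, t, ht0, ht1, hmono, hsurj⟩ := exists_unit_subdivision T (by simp [T]) (by simp [T])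
    (fun x hx => by
      simp only [T, Finset.mem_insert, Finset.mem_biUnion, Finset.mem_filter, Finset.mem_univ,
        true_and, Finset.mem_singleton] at hx
      rcases hx with rfl | rfl | ⟨u, hu, hx⟩
      · simp
      · simp
      · obtain ⟨l, r, hlr, h⟩ := argmaxSet_eq_Icc hu
        obtain ⟨k1, k2, -, -⟩ := hIcc u hlr h
        rw [h, csInf_Icc hlr, csSup_Icc hlr] at hx
        rcases hx with rfl | rfl
        · exact ⟨k1, hlr.trans k2⟩
        · exact ⟨k1.trans hlr, k2⟩)
  have hmono' : ∀ i j, i ≤ j → j ≤ n + 1 → t i ≤ t j := fun i j hij hj => by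
    rcases hij.eq_or_lt with rfl | h
    · exact le_rfl
    · exact (hmono i j h hj).le
  have hmem : ∀ i ≤ n + 1, t i ∈ Set.Icc (0 : ℝ) 1 := fun i hi =>
    ⟨ht0 ▸ hmono' 0 i (Nat.zero_le i) hi, ht1 ▸ hmono' i (n + 1) hi le_rfl⟩
  -- maximality at an interior point of a cell means maximality on the cell
  have hcell : ∀ u i, i ≤ n → (t i + t (i + 1)) / 2 ∈ argmaxSet v p q u →
      t i ∈ argmaxSet v p q u ∧ t (i + 1) ∈ argmaxSet v p q u := fun u i hi h => by
    obtain ⟨l, r, hlr, hu⟩ := argmaxSet_eq_Icc ⟨_, h⟩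
    obtain ⟨-, -, hl, hr⟩ := hIcc u hlr hu
    obtain ⟨a, ha, rfl⟩ := hsurj l hl
    obtain ⟨b, hb, rfl⟩ := hsurj r hr
    rw [hu] at h ⊢
    have hlt := hmono i (i + 1) (by omega) (by omega)
    have hai : a ≤ i := by
      by_contra hcon
      have := hmono' (i + 1) a (by omega) ha
      linarith [h.1]
    have hib : i + 1 ≤ b := by
      by_contra hcon
      have := hmono' b i (by omega) (by omega)
      linarith [h.2]
    have k1 := hmono' a i hai (by omega)
    have k2 := hmono' (i + 1) b hib hb
    exact ⟨⟨k1, by linarith⟩, ⟨by linarith, k2⟩⟩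
  have hex : ∀ i, ∃ u, InInterval v p q u ∧ (i ≤ n → (t i + t (i + 1)) / 2 ∈ argmaxSet v p q u) :=
    fun i => by
      by_cases hi : i ≤ n
      · obtain ⟨u, h1, h2⟩ := exists_mem_argmaxSet v p q (l := (t i + t (i + 1)) / 2) (by
          have h1 := hmem i (by omega)
          have h2 := hmem (i + 1) (by omega)
          exact ⟨by linarith [h1.1, h2.1], by linarith [h1.2, h2.2]⟩)
        exact ⟨u, h1, fun _ => h2⟩
      · exact ⟨p, inInterval_left v p q, fun h => absurd h hi⟩
  choose u hu humid using hex
  have hul : ∀ i ≤ n, t i ∈ argmaxSet v p q (u i) := fun i hi => (hcell _ i hi (humid i hi)).1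
  have hur : ∀ i ≤ n, t (i + 1) ∈ argmaxSet v p q (u i) := fun i hi =>
    (hcell _ i hi (humid i hi)).2
  have huniq : ∀ i ≤ n, ∀ w, InInterval v p q w → (t i + t (i + 1)) / 2 ∈ argmaxSet v p q w →
      u i = w := fun i hi w hw hwm =>
    eq_of_mem_argmaxSet hv hjoin hjoin₃ (hu i) hw (hmono i (i + 1) (by omega) (by omega))
      (hul i hi) (hur i hi) (hcell w i hi hwm).1 (hcell w i hi hwm).2
  -- the sweep
  have hsweep : ∀ i ≤ n, f (p ⊓ q) + ∑ j ∈ Finset.range i, (t (j + 1) - t j) * f (u j) +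
      (1 - t i) * f (u i) ≤ f p + f (u i ⊓ q) := by
    intro i
    induction i with
    | zero =>
      intro _
      -- At weight 0 the maximizer lies above `p`, so it is the join of `p` and `u 0 ⊓ q`.
      have h0 := (hul 0 (Nat.zero_le n)).2 p (inInterval_left v p q)
      rw [ht0, inf_idem] at h0
      have h1 : u 0 ⊓ p = p := hv.eq_of_le inf_le_right (by linarith)
      have h2 := ((hu 0).isLUB hv hjoin).1
      rw [h1] at h2
      have h3 := hsub p (u 0 ⊓ q) (p ⊓ q) (u 0) (isGLB_pair_iff.2 ⟨inf_le_left,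
        inf_le_inf_right q (inf_eq_right.1 h1), fun c h h' => le_inf h (h'.trans inf_le_right)⟩) h2
      rw [ht0]
      simp only [Finset.range_zero, Finset.sum_empty]
      linarith
    | succ i ih =>
      intro hi
      have h1 := ih (by omega)
      have hm := argmaxSet_mono hv hjoin hjoin₃ (hu i) (hu (i + 1))
        (hmono i (i + 1) (by omega) (by omega)) (hul i (by omega)) (hur i (by omega))
        (hul (i + 1) hi)
      have h2 := sweep_step hv hjoin hsub hanti (hu i) (hu (i + 1)) (hur i (by omega))
        (hul (i + 1) hi) hm.1 hm.2
      rw [Finset.sum_range_succ]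
      linarith
  have hlast : u n ⊓ q = q := by
    have h0 := (hur n le_rfl).2 q (inInterval_left v q p).symm
    rw [ht1, inf_idem] at h0
    exact hv.eq_of_le inf_le_right (by linarith)
  have hmain := hsweep n le_rfl
  rw [hlast] at hmain
  have hsum : ∑ᶠ w ∈ envelope v p q, coneVal (normalCone v p q w) * f w =
      ∑ j ∈ Finset.range (n + 1), (t (j + 1) - t j) * f (u j) := by
    -- Both sides are `f w` times the length of the weight interval of `w`; membership in the
    -- envelope matters only when that length is positive.
    have hw : ∀ w, (if w ∈ envelope v p q then coneVal (normalCone v p q w) * f w else 0) =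
        ∑ j ∈ Finset.range (n + 1), if u j = w then (t (j + 1) - t j) * f w else 0 := by
      intro w
      by_cases hwI : InInterval v p q w
      · rcases (argmaxSet v p q w).eq_empty_or_nonempty with hS | hS
        · have hC := coneVal_eq_zero (smul_mem_normalCone_iff hv hjoin (p := p) (q := q) (u := w))
            (by rw [← hS]; exact mem_normalCone_iff_argmaxSet hv hjoin)
          rw [hC, zero_mul, ite_self]
          refine (Finset.sum_eq_zero fun j hj => if_neg ?_).symm
          rintro rfl
          have := humid j (by have := Finset.mem_range.1 hj; omega)
          rw [hS] at this
          exact this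
        · obtain ⟨l, r, hlr, hS⟩ := argmaxSet_eq_Icc hS
          obtain ⟨hl0, hr1, hl, hr⟩ := hIcc w hlr hS
          have hC := coneVal_eq (smul_mem_normalCone_iff hv hjoin (p := p) (q := q) (u := w))
            (mem_normalCone_iff_argmaxSet hv hjoin) hlr hl0 hr1 hS
          have henv : (if w ∈ envelope v p q then coneVal (normalCone v p q w) * f w else 0) =
              (r - l) * f w := by
            split_ifs with h
            · rw [hC]
            · rcases hlr.eq_or_lt with rfl | hlt
              · simp
              · refine absurd (mem_envelope hv hjoin hwI hlt ?_ ?_) h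
                · exact hS ▸ Set.left_mem_Icc.2 hlr
                · exact hS ▸ Set.right_mem_Icc.2 hlr
          rw [henv]
          obtain ⟨a, ha, rfl⟩ := hsurj l hl
          obtain ⟨b, hb, rfl⟩ := hsurj r hr
          have hab : a ≤ b := by
            by_contra hcon
            have := hmono b a (by omega) ha
            linarith
          have hiff : ∀ j ∈ Finset.range (n + 1), u j = w ↔ j ∈ Finset.Ico a b := fun j hj => by
            have hj' : j ≤ n := by have := Finset.mem_range.1 hj; omega
            have hlt := hmono j (j + 1) (by omega) (by omega)
            rw [Finset.mem_Ico]
            constructor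
            · rintro rfl
              have hj'' := humid j hj'
              rw [hS] at hj''
              constructor
              · by_contra hcon
                have := hmono' (j + 1) a (by omega) ha
                linarith [hj''.1]
              · by_contra hcon
                have := hmono' b j (by omega) (by omega)
                linarith [hj''.2]
            · rintro ⟨h1, h2⟩
              refine huniq j hj' w hwI ?_
              rw [hS]
              have k1 := hmono' a j h1 (by omega)
              have k2 := hmono' (j + 1) b h2 hb
              exact ⟨by linarith, by linarith⟩
          rw [Finset.sum_congr rfl fun j hj => if_congr (hiff j hj) rfl rfl, ← Finset.sum_filter,
            Finset.filter_mem_eq_inter, Finset.inter_eq_right.2 (fun j hj => Finset.mem_range.2 (by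
              have := (Finset.mem_Ico.1 hj).2
              omega)), ← Finset.sum_mul, Finset.sum_Ico_sub _ hab]
      · rw [if_neg fun h => hwI ((mem_interval_iff hv hjoin).1 h.1)]
        refine (Finset.sum_eq_zero fun j _ => if_neg ?_).symm
        rintro rfl
        exact hwI (hu j)
    have hfin : ∑ᶠ w ∈ envelope v p q, coneVal (normalCone v p q w) * f w =
        ∑ w, if w ∈ envelope v p q then coneVal (normalCone v p q w) * f w else 0 := by
      rw [finsum_mem_def, finsum_eq_sum_of_fintype]
      rfl
    rw [hfin, Finset.sum_congr rfl fun w _ => hw w, Finset.sum_comm]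
    refine Finset.sum_congr rfl fun j _ => ?_
    simp
  rw [hsum, meet_eq_inf, Finset.sum_range_succ, ht1]
  linarith

end Sweep

/-- The criterion for submodularity, for a modular semilattice given by a preorder. -/
theorem isSubmodular_of_local {L : Type*} [Preorder L] [Finite L] {v f : L → ℝ}
    (hL : IsModularSemilattice L) (hv : IsValuation v)
    (hsub : ∀ p q m j : L, IsGLB {p, q} m → IsLUB {p, q} j → f m + f j ≤ f p + f q)
    (hanti : ∀ (p q m : L) (w₁ w₂ : ℝ), IsGLB {p, q} m →
      w₁ * (v p - v m) = w₂ * (v q - v m) →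
      (∀ a b, m ≤ a → a ≤ p → m ≤ b → b ≤ q → (∃ t, a ≤ t ∧ b ≤ t) →
        w₁ * (v a - v m) + w₂ * (v b - v m) ≤ w₁ * (v p - v m)) →
      (w₁ + w₂) * f m ≤ w₁ * f p + w₂ * f q) : IsSubmodular v f where
  semilattice := hL
  valuation := hv
  ineq := by
    choose g hg using hL.exists_meet
    -- The preorder is kept, so `meet`, the covering graph and the envelope are unchanged.
    let inst : SemilatticeInf L :=
      { (inferInstance : Preorder L) with
        le_antisymm := hL.antisymm
        inf := g
        inf_le_left := fun a b => (isGLB_pair_iff.1 (hg a b)).1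
        inf_le_right := fun a b => (isGLB_pair_iff.1 (hg a b)).2.1
        le_inf := fun a b c h h' => (isGLB_pair_iff.1 (hg b c)).2.2 a h h' }
    exact submodular_of_local (L := L) hv hL.exists_join hL.exists_join₃ hsub hanti

end LConvex

end

theorem mainTheorem4 {V : Type*} [Finite V] (X : LConvex.Complex V) (hX : X.IsModularComplex) :
    (X.prod X).IsLConvex (fun a : V × V => X.dist a.1 a.2) where
  modularComplex := hX.prod hX
  submodular p := by
    have hfin : Finite ((X.prod X).Nbhd p) := by
      have : Finite (X.prod X).BoolPair := Subtype.finite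
      exact Subtype.finite
    exact LConvex.isSubmodular_of_local ((hX.prod hX).nbhd_isModularSemilattice p)
      ((hX.prod hX).nbhd_isValuation p)
      (fun _ _ _ _ hm hj => hX.lovasz_dist_submodular hm hj)
      (fun _ _ _ _ _ hm hw h => hX.lovasz_dist_antipodal hm hw h)
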